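/- **Lemma 2.7.** Let $n\ge 3$ and let $X,Y$ be smooth vector fields on $\mathbb R^n$, linearly independent at every point; consider the rank $2$ distribution they span with the metric for which $(X,Y)$ is orthonormal. For $q\in\mathbb R^n$ let $d(0,q)\in[0,\infty]$ be the sub-Riemannian distance, i.e. the infimum of the times $S\ge 0$ such that $q=x(S)$ for a solution on $[0,S]$ of $\dot x=vX(x)+uY(x)$, $x(0)=0$, with measurable controls satisfying $v^2+u^2\le 1$, and let $S(0,T)=\{q : d(0,q)=T\}$. Write $\mathrm{ad}X.Y=[X,Y]$. Let $\tau>0$ and let $\gamma:[0,\tau]\to\mathbb R^n$ be the integral curve of $X$ with $\gamma(0)=0$. Assume that $\gamma$ (control $v=1$, $u=0$) is abnormal, i.e. there is a nontrivial adjoint vector $p(\cdot)$ on $[0,\tau]$ with $\dot p=-p\,dX(\gamma)$ and $\langle p,X(\gamma)\rangle=\langle p,Y(\gamma)\rangle=0$. With $K(t)=\mathrm{Span}\{\mathrm{ad}^kX.Y(\gamma(t)) : k\in\mathbb N\}$ assume moreover, for all $t\in[0,\tau]$: * $(H_0)$ $\gamma$ is injective on $[0,\tau]$; * $(H_1)$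 $K(t)$ has codimension $1$ and $K(t)=\mathrm{Span}\{\mathrm{ad}^kX.Y(\gamma(t)) : 0\le k\le n-2\}$; * $(H_2)$ $\mathrm{ad}^2Y.X(\gamma(t))\notin K(t)$; * $(H_3)$ $X(\gamma(t))\notin\mathrm{Span}\{\mathrm{ad}^kX.Y(\gamma(t)) : 0\le k\le n-3\}$. Then for every sufficiently small $T>0$ (that is, there is $T_0\in(0,\tau]$ such that for every $T\in(0,T_0)$) the curve $\gamma$ is minimizing on $[0,T]$, so that $A=\gamma(T)\in S(0,T)$, and the following holds. Let $(x_1,\dots,x_n)$ be any smooth coordinates on a neighborhood of $\gamma([0,\tau])$ in which $\gamma(t)=(t,0,\dots,0)$ and $K(t)=\mathrm{Span}\{\partial/\partial x_1,\dots,\partial/\partial x_{n-1}\}_{|\gamma(t)}$, with $x_n$ oriented by $dx_n(\mathrm{ad}^2Y.X)>0$ along $\gamma$. Then for every neighborhood $V$ of $A$ in $\mathbb R^n$ $$S(0,T)\cap V\cap\{x_n<0\}\neq\emptyset .$$ -/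

import Mathlib

open Set MeasureTheory Topology
open scoped ContDiff ENNReal

namespace SubRiemannian

/-- The space `ℝⁿ`. -/
abbrev Space (n : ℕ) : Type := EuclideanSpace ℝ (Fin n)

/-- The iterated Lie bracket `ad^k X.Y`, where `ad X.Y = [X, Y]`. -/
noncomputable def ad {n : ℕ} (X Y : Space n → Space n) (k : ℕ) : Space n → Space n :=
  (VectorField.lieBracket ℝ X)^[k] Y

/-- The span of all the vectors `ad^k X.Y (q)`, `k ∈ ℕ`. Along the reference trajectory
this is the first Pontryagin cone `K(t)`. -/
noncomputable def cone {n : ℕ} (X Y : Space n → Space n) (q : Space n) : Submodule ℝ (Space n) :=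
  Submodule.span ℝ (range fun k : ℕ => ad X Y k q)

/-- `γ` is, on `[0, τ]`, the integral curve of `X` through the origin, that is, the trajectory of
`x' = v X(x) + u Y(x)`, `x(0) = 0`, for the reference control `v = 1`, `u = 0`. -/
structure IsReferenceCurve {n : ℕ} (X : Space n → Space n) (γ : ℝ → Space n) (τ : ℝ) : Prop where
  init : γ 0 = 0
  deriv : ∀ t ∈ Icc 0 τ, HasDerivWithinAt γ (X (γ t)) (Icc 0 τ) t

/-- The reference curve `γ` (control `v = 1`, `u = 0`) is abnormal on `[0, τ]` for the system
`x' = v X(x) + u Y(x)`: with the Hamiltonian `H = v ⟨p, X⟩ + u ⟨p, Y⟩` there is a nontrivial adjoint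
vector `p`, with `p' = -∂H/∂x`, `∂H/∂v = ⟨p, X⟩ = 0` and `∂H/∂u = ⟨p, Y⟩ = 0` (so that `H = 0`).
The adjoint equation has continuous coefficients here, so `p` is continuously differentiable and
the equation holds at every time. -/
def IsAbnormal {n : ℕ} (X Y : Space n → Space n) (γ : ℝ → Space n) (τ : ℝ) : Prop :=
  ∃ p : ℝ → (Space n →L[ℝ] ℝ),
    (∃ t ∈ Icc 0 τ, p t ≠ 0) ∧
    (∀ t ∈ Icc 0 τ,
      HasDerivWithinAt p (-((p t).comp (fderiv ℝ X (γ t)))) (Icc 0 τ) t) ∧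
    (∀ t ∈ Icc 0 τ, p t (X (γ t)) = 0) ∧
    (∀ t ∈ Icc 0 τ, p t (Y (γ t)) = 0)

/-- The generic assumptions `(H₀)`-`(H₃)` along `γ` on `[0, τ]`. -/
structure GenericAlong {n : ℕ} (X Y : Space n → Space n) (γ : ℝ → Space n) (τ : ℝ) : Prop where
  /-- `γ` is injective. -/
  injective : InjOn γ (Icc 0 τ)
  /-- `K(t)` has codimension one. -/
  codim_one : ∀ t ∈ Icc 0 τ, Module.finrank ℝ (cone X Y (γ t)) + 1 = n
  /-- `K(t)` is spanned by `ad^k X.Y (γ(t))`, `k = 0, …, n - 2`. -/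
  spanned : ∀ t ∈ Icc 0 τ,
    cone X Y (γ t) = Submodule.span ℝ ((fun k : ℕ => ad X Y k (γ t)) '' {k | k + 2 ≤ n})
  /-- `ad² Y.X (γ(t))` does not lie in `K(t)`. -/
  ad_sq : ∀ t ∈ Icc 0 τ, ad Y X 2 (γ t) ∉ cone X Y (γ t)
  /-- `X(γ(t))` is not in the span of `ad^k X.Y (γ(t))`, `k = 0, …, n - 3`. -/
  drift : ∀ t ∈ Icc 0 τ,
    X (γ t) ∉ Submodule.span ℝ ((fun k : ℕ => ad X Y k (γ t)) '' {k | k + 3 ≤ n})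

/-- `x` is on `[0, S]` a (Carathéodory) solution of `x' = v X(x) + u Y(x)`, `x(0) = 0`. -/
structure IsTrajectory {n : ℕ} (X Y : Space n → Space n) (S : ℝ) (v u : ℝ → ℝ)
    (x : ℝ → Space n) : Prop where
  cont : ContinuousOn x (Icc 0 S)
  init : x 0 = 0
  eq : ∀ t ∈ Icc 0 S, x t = ∫ s in (0 : ℝ)..t, (v s • X (x s) + u s • Y (x s))

/-- The set of points that are reached from the origin in time `S` by the system
`x' = v X(x) + u Y(x)` with measurable controls such that `v² + u² ≤ 1`. -/
def reachable {n : ℕ} (X Y : Space n → Space n) (S : ℝ) : Set (Space n) :=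
  {q | ∃ v u : ℝ → ℝ, ∃ x : ℝ → Space n, Measurable v ∧ Measurable u ∧
    (∀ t ∈ Icc 0 S, v t ^ 2 + u t ^ 2 ≤ 1) ∧ IsTrajectory X Y S v u x ∧ x S = q}

/-- The sub-Riemannian distance from the origin to `q`, for the metric on the distribution spanned
by `X`, `Y` which makes `X`, `Y` orthonormal: the infimum of the times in which `q` is reached with
speed at most one (`∞` if `q` is never reached). -/
noncomputable def srDist {n : ℕ} (X Y : Space n → Space n) (q : Space n) : ℝ≥0∞ :=
  ⨅ (S : ℝ) (_ : 0 ≤ S) (_ : q ∈ reachable X Y S), ENNReal.ofReal S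

/-- The sub-Riemannian sphere `S(0, T)`. -/
def srSphere {n : ℕ} (X Y : Space n → Space n) (T : ℝ) : Set (Space n) :=
  {q | srDist X Y q = ENNReal.ofReal T}

/-- `φ = (x₁, …, xₙ)` is a system of smooth coordinates on a neighborhood of `γ([0, τ])`, in which
`γ(t) = (t, 0, …, 0)` and the first Pontryagin cone is
`K(t) = Vect {∂/∂x₁, …, ∂/∂x_{n-1}} = ker dxₙ`, the last coordinate being oriented so that
`ad² Y.X` points into `xₙ > 0` along `γ`. -/
structure IsAdapted {n : ℕ} (hn : 3 ≤ n) (X Y : Space n → Space n) (γ : ℝ → Space n) (τ : ℝ)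
    (φ : OpenPartialHomeomorph (Space n) (Space n)) : Prop where
  smooth : ContDiffOn ℝ ∞ φ φ.source
  smooth_symm : ContDiffOn ℝ ∞ φ.symm φ.target
  mem_source : ∀ t ∈ Icc 0 τ, γ t ∈ φ.source
  straight : ∀ t ∈ Icc 0 τ, φ (γ t) = EuclideanSpace.single (⟨0, by omega⟩ : Fin n) t
  cone_eq : ∀ t ∈ Icc 0 τ, ∀ w : Space n,
    w ∈ cone X Y (γ t) ↔ (fderiv ℝ φ (γ t) w) (⟨n - 1, by omega⟩ : Fin n) = 0
  orient : ∀ t ∈ Icc 0 τ,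
    0 < (fderiv ℝ φ (γ t) (ad Y X 2 (γ t))) (⟨n - 1, by omega⟩ : Fin n)

end SubRiemannian

/-! Straighten `X` near the origin. In a chart `Ψ` tangent to the identity, `X` becomes a constant
field `e`, `Y` becomes `F • Z` with `F` close to `1`, and `γ` becomes the line `t • e`. In this
chart the adjoint equation says that the abnormal covector is a constant `p`; it kills `e`, and it
kills `Z` along the line. Two more functionals serve as coordinates: `ℓ`, with `ℓ e = 1`, measures
progress along the line, and `m`, with `m e = 0` and `m (Z x) = 1`, is the primitive of the control
of `Z`.

The core is a second-order expansion (`exists_expansion`). For a curve `x' = v e + w Z(x)` in a ball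
of radius `ρ` that starts on the line, has `m = 0` at both ends and does not go far below `ℓ = 0`,
one has `p (x S) = κ/2 ∫ v m² + O(ρ + S) ∫ m²`. Here `κ = p([Z,[Z,e]])` equals `p(ad²Y.X)` at the
origin; it is nonzero by (H₂) and positive after choosing the sign of `p`. So the side of `p = 0` on
which the curve ends is decided by the direction of travel along the line.

Forward travel (`exists_apply_le_time`): a curve from the origin that ends in `m = 0`, `p ≤ 0` with
`ℓ` larger than its duration would have `v` close to `1` on average. The expansion then gives `p >
0` unless `m` vanishes identically, and that case is impossible too. Hence `d(0, ·) ≥ ℓ` on `{m = 0,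
p ≤ 0}` near the origin. This already shows that `γ` is minimizing.

Backward travel (`exists_backward_loop`): with `v = -1/2` and a control of `Z` of mean zero during a
short time `θ`, the curve ends with `m = 0` and `p < 0`, and its transverse displacement squared is
`O(θ |p|)`.

Combine the two (`exists_sphere_point`). Follow `γ` until `T/2`, perform the backward loop, then
continue along `e`, which changes neither `m`, nor `p`, nor the transverse part. The distance is at
most `T/2 + θ` when this last segment starts and at least `T` when `ℓ = T`; by continuity it equals
`T` somewhere, and that point is `O(θ)`-close to `T • e`. Finally `xₙ ∘ Ψ` vanishes on the line,
where its differential is a positive multiple of `p`. Hence `xₙ ≤ c p + C |transverse|²` when `p ≤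
0`, which is negative at the point found once `θ` is small. -/

namespace SubRiemannian

/-! ### Smoothness of the superposition operator on continuous maps. -/

section Superposition

universe u

/-- Pointwise application of a continuous family of operators to a continuous map. -/
noncomputable def pointwiseApply (K : Type*) [TopologicalSpace K] [CompactSpace K]
    (E F : Type*) [NormedAddCommGroup E] [NormedSpace ℝ E] [NormedAddCommGroup F]
    [NormedSpace ℝ F] : C(K, E →L[ℝ] F) →L[ℝ] C(K, E) →L[ℝ] C(K, F) :=
  LinearMap.mkContinuous₂
    (LinearMap.mk₂ ℝ (fun (A : C(K, E →L[ℝ] F)) (β : C(K, E)) =>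
      (⟨fun t => A t (β t), by fun_prop⟩ : C(K, F)))
      (fun _ _ _ => by ext; simp) (fun _ _ _ => by ext; simp)
      (fun _ _ _ => by ext; simp) (fun _ _ _ => by ext; simp)) 1
    (fun A β => by
      rw [ContinuousMap.norm_le _ (by positivity)]
      intro t
      calc ‖A t (β t)‖ ≤ ‖A t‖ * ‖β t‖ := (A t).le_opNorm _
        _ ≤ 1 * ‖A‖ * ‖β‖ := by
          rw [one_mul]
          gcongr
          · exact A.norm_coe_le_norm t
          · exact β.norm_coe_le_norm t)

variable {K : Type*} [TopologicalSpace K]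

@[simp]
lemma pointwiseApply_apply [CompactSpace K] {E F : Type*} [NormedAddCommGroup E] [NormedSpace ℝ E]
    [NormedAddCommGroup F] [NormedSpace ℝ F] (A : C(K, E →L[ℝ] F)) (β : C(K, E)) (t : K) :
    pointwiseApply K E F A β t = A t (β t) := rfl

/-- The superposition operator `α ↦ f ∘ α`. -/
def superposition (K : Type*) [TopologicalSpace K] {E F : Type*} [TopologicalSpace E]
    [TopologicalSpace F] (f : E → F) (hf : Continuous f) (α : C(K, E)) : C(K, F) :=
  (⟨f, hf⟩ : C(E, F)).comp α

@[simp]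
lemma superposition_apply {E F : Type*} [TopologicalSpace E] [TopologicalSpace F] (f : E → F)
    (hf : Continuous f) (α : C(K, E)) (t : K) : superposition K f hf α t = f (α t) := rfl

variable [CompactSpace K]

/-- The point is uniformity in `t`. It comes from continuity, in the sup norm, of the superposition
operator of `fderiv ℝ f`: tested on `α` plus a constant, it bounds the oscillation of `fderiv ℝ f`
on a ball around `α t` whose radius does not depend on `t`. -/
lemma hasFDerivAt_superposition {E F : Type*} [NormedAddCommGroup E] [NormedSpace ℝ E]
    [NormedAddCommGroup F] [NormedSpace ℝ F] {f : E → F} (hf : Differentiable ℝ f)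
    (hf' : Continuous (fderiv ℝ f)) (α : C(K, E)) :
    HasFDerivAt (superposition K f hf.continuous)
      (pointwiseApply K E F (superposition K (fderiv ℝ f) hf' α)) α := by
  rw [hasFDerivAt_iff_isLittleO_nhds_zero, Asymptotics.isLittleO_iff]
  intro ε hε
  have hc : Continuous (superposition K (fderiv ℝ f) hf') :=
    ContinuousMap.continuous_postcomp _
  obtain ⟨δ, hδ, H⟩ := (Metric.continuousAt_iff (α := C(K, E))
    (β := C(K, E →L[ℝ] F))).1 (hc.continuousAt (x := α)) ε hε
  filter_upwards [Metric.ball_mem_nhds (0 : C(K, E)) hδ] with β hβ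
  rw [mem_ball_zero_iff] at hβ
  rw [ContinuousMap.norm_le _ (by positivity)]
  intro t
  have hbound : ∀ x ∈ Metric.ball (α t) δ, ‖fderiv ℝ f x - fderiv ℝ f (α t)‖ ≤ ε := by
    intro x hx
    rw [mem_ball_iff_norm] at hx
    have h1 : ‖ContinuousMap.const K (x - α t)‖ ≤ ‖x - α t‖ := by
      rw [ContinuousMap.norm_le _ (norm_nonneg _)]
      intro _; simp
    have h2 := H (x := α + ContinuousMap.const K (x - α t))
      (by rw [dist_eq_norm]; simpa using lt_of_le_of_lt h1 hx)
    have h3 := (ContinuousMap.dist_apply_le_dist t).trans h2.le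
    rw [dist_eq_norm] at h3
    simpa using h3
  have hmem : α t + β t ∈ Metric.ball (α t) δ := by
    rw [mem_ball_iff_norm]
    simpa using lt_of_le_of_lt (β.norm_coe_le_norm t) hβ
  have := (convex_ball (α t) δ).norm_image_sub_le_of_norm_fderiv_le' (φ := fderiv ℝ f (α t))
    (fun x _ => hf x) hbound (Metric.mem_ball_self hδ) hmem
  simp only [add_sub_cancel_left] at this
  calc _ = ‖f (α t + β t) - f (α t) - fderiv ℝ f (α t) (β t)‖ := rfl
    _ ≤ ε * ‖β t‖ := this
    _ ≤ ε * ‖β‖ := by gcongr; exact β.norm_coe_le_norm t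

/-- Induction on the order: the derivative is again a superposition operator, that of `fderiv ℝ f`,
followed by a bounded linear map. `E` and `F` share a universe so that the induction hypothesis
applies with target `E →L[ℝ] F`. -/
lemma contDiff_superposition {E : Type u} [NormedAddCommGroup E] [NormedSpace ℝ E] (N : ℕ) :
    ∀ {F : Type u} [NormedAddCommGroup F] [NormedSpace ℝ F] {f : E → F} (hf : ContDiff ℝ ∞ f),
      ContDiff ℝ N (superposition K f hf.continuous) := by
  induction N with
  | zero =>
    intro F _ _ f hf
    exact contDiff_zero.2 (ContinuousMap.continuous_postcomp _)
  | succ N ih =>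
    intro F _ _ f hf
    have hf' : ContDiff ℝ ∞ (fderiv ℝ f) := hf.fderiv_right (by simp)
    have h1 : ContDiff ℝ N fun A : C(K, E →L[ℝ] F) => pointwiseApply K E F A :=
      ContinuousLinearMap.contDiff _
    push_cast
    rw [contDiff_succ_iff_hasFDerivAt]
    exact ⟨fun α => pointwiseApply K E F (superposition K (fderiv ℝ f) hf'.continuous α),
      h1.comp (ih hf'),
      fun α => hasFDerivAt_superposition (hf.differentiable (by simp)) hf'.continuous α⟩

end Superposition

/-! ### The local flow, by the implicit function theorem in a space of curves. -/

section Flow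

/-- The primitive of a continuous function on `[-1, 1]`, vanishing at `0`. -/
noncomputable def primitiveCLM (E : Type*) [NormedAddCommGroup E] [NormedSpace ℝ E] :
    C(Icc (-1 : ℝ) 1, E) →L[ℝ] C(Icc (-1 : ℝ) 1, E) :=
  LinearMap.mkContinuous
    { toFun := fun α => ⟨fun t => ∫ s in (0 : ℝ)..t, IccExtend (by norm_num) α s, by
        have : Continuous fun t : ℝ => ∫ s in (0 : ℝ)..t, IccExtend (by norm_num) α s :=
          intervalIntegral.continuous_primitive
            (fun a b => (α.continuous.Icc_extend').intervalIntegrable a b) 0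
        exact this.comp continuous_subtype_val⟩
      map_add' := fun α β => by
        ext t
        exact intervalIntegral.integral_add (α.continuous.Icc_extend'.intervalIntegrable _ _)
          (β.continuous.Icc_extend'.intervalIntegrable _ _)
      map_smul' := fun c α => by
        ext t
        exact intervalIntegral.integral_smul c _ } 1
    (fun α => by
      rw [ContinuousMap.norm_le _ (by positivity)]
      intro t
      calc ‖∫ s in (0 : ℝ)..t, IccExtend (by norm_num) α s‖ ≤ ‖α‖ * |(t : ℝ) - 0| :=
            intervalIntegral.norm_integral_le_of_norm_le_const
              (fun s _ => α.norm_coe_le_norm _)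
        _ ≤ 1 * ‖α‖ := by
          rw [mul_comm, sub_zero]
          gcongr
          exact abs_le.2 t.2)

variable {E : Type*} [NormedAddCommGroup E] [NormedSpace ℝ E]

/-- The integral equation of the flow of `X`, with time rescaled to `[-1, 1]`. -/
noncomputable def flowEquation (X : E → E) (hX : Continuous X)
    (q : (E × ℝ) × C(Icc (-1 : ℝ) 1, E)) : C(Icc (-1 : ℝ) 1, E) :=
  q.2 - ContinuousLinearMap.const ℝ (Icc (-1 : ℝ) 1) q.1.1
    - q.1.2 • primitiveCLM E (superposition _ X hX q.2)

lemma contDiff_flowEquation {X : E → E} (hX : ContDiff ℝ ∞ X) (N : ℕ) :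
    ContDiff ℝ N (flowEquation X hX.continuous) := by
  have h : ContDiff ℝ N fun q : (E × ℝ) × C(Icc (-1 : ℝ) 1, E) =>
      superposition (Icc (-1 : ℝ) 1) X hX.continuous q.2 :=
    (contDiff_superposition N hX).comp contDiff_snd
  unfold flowEquation
  refine (contDiff_snd.sub ?_).sub ((contDiff_snd.comp contDiff_fst).smul ?_)
  · exact (ContinuousLinearMap.contDiff (E := E) (F := C(Icc (-1 : ℝ) 1, E))
      (ContinuousLinearMap.const ℝ (Icc (-1 : ℝ) 1))).comp
      (contDiff_fst.comp contDiff_fst)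
  · exact (ContinuousLinearMap.contDiff (E := C(Icc (-1 : ℝ) 1, E)) (F := C(Icc (-1 : ℝ) 1, E))
      (primitiveCLM E)).comp h

lemma flowEquation_eq_zero_iff {X : E → E} (hX : Continuous X) (x : E) (s : ℝ)
    (α : C(Icc (-1 : ℝ) 1, E)) : flowEquation X hX ((x, s), α) = 0 ↔
      ∀ t : Icc (-1 : ℝ) 1,
        α t = x + s • ∫ τ in (0 : ℝ)..t, X (IccExtend (by norm_num) α τ) := by
  rw [ContinuousMap.ext_iff]
  refine forall_congr' fun t => ?_
  have : flowEquation X hX ((x, s), α) t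
      = α t - x - s • ∫ τ in (0 : ℝ)..t, X (IccExtend (by norm_num) α τ) := rfl
  rw [this, ContinuousMap.zero_apply, sub_sub, sub_eq_zero]

/-- At parameter `0` the map is the identity in `α`, so its partial derivative there is invertible
and the implicit function theorem applies. The equivalence also records local uniqueness. -/
lemma exists_implicit_of_slice_eq_id {P V : Type*} [NormedAddCommGroup P] [NormedSpace ℝ P]
    [CompleteSpace P] [NormedAddCommGroup V] [NormedSpace ℝ V] [CompleteSpace V] {f : P × V → V}
    {N : ℕ} (hN : N ≠ 0) (hf : ContDiffAt ℝ N f 0) (hf0 : ∀ α, f (0, α) = α) :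
    ∃ A : P → V, A 0 = 0 ∧ ContDiffAt ℝ N A 0 ∧ ∃ δ > 0, ∀ p α, ‖p‖ < δ → ‖α‖ < δ →
      (f (p, α) = 0 ↔ A p = α) := by
  have hN' : (N : WithTop ℕ∞) ≠ 0 := by exact_mod_cast hN
  have hid : fderiv ℝ f 0 ∘L ContinuousLinearMap.inr ℝ P V = ContinuousLinearMap.id ℝ V := by
    have h1 : HasFDerivAt (fun α => f (ContinuousLinearMap.inr ℝ P V α))
        (fderiv ℝ f 0 ∘L ContinuousLinearMap.inr ℝ P V) 0 := by
      refine HasFDerivAt.comp (0 : V) ?_ (ContinuousLinearMap.inr ℝ P V).hasFDerivAt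
      rw [map_zero]
      exact (hf.differentiableAt hN').hasFDerivAt
    have h2 : (fun α => f (ContinuousLinearMap.inr ℝ P V α)) = id := by
      funext α
      simpa using hf0 α
    rw [h2] at h1
    exact h1.unique (hasFDerivAt_id _)
  have hinv : (fderiv ℝ f 0 ∘L ContinuousLinearMap.inr ℝ P V).IsInvertible := by
    rw [hid]; exact ⟨ContinuousLinearEquiv.refl ℝ _, rfl⟩
  have hiff := hf.eventually_apply_eq_iff_implicitFunction hN' hinv
  have hf00 : f 0 = 0 := hf0 0
  rw [hf00] at hiff
  obtain ⟨δ, hδ, hiff⟩ := Metric.eventually_nhds_iff.1 hiff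
  refine ⟨hf.implicitFunction hN' hinv, hf.implicitFunction_apply_self hN' hinv,
    hf.contDiffAt_implicitFunction hN' hinv, δ, hδ, fun p α hp hα => hiff (y := (p, α)) ?_⟩
  rw [dist_zero_right, Prod.norm_def]
  exact max_lt hp hα

/-- The local flow of a smooth vector field is of class `C^N` in all variables. -/
theorem exists_contDiffAt_flow [CompleteSpace E] {X : E → E} (hX : ContDiff ℝ ∞ X) {N : ℕ}
    (hN : N ≠ 0) :
    ∃ Φ : E × ℝ → E, ContDiffAt ℝ N Φ 0 ∧ ∀ᶠ q in 𝓝 (0 : E × ℝ),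
      Φ (q.1, 0) = q.1 ∧ HasDerivAt (fun s => Φ (q.1, s)) (X (Φ q)) q.2 := by
  obtain ⟨A, hA0, hAc, δ, hδ, hiff⟩ := exists_implicit_of_slice_eq_id hN
    (contDiff_flowEquation hX N).contDiffAt (fun α => by simp [flowEquation])
  obtain ⟨δ', hδ', hAδ⟩ := (Metric.continuousAt_iff (α := E × ℝ)
    (β := C(Icc (-1 : ℝ) 1, E))).1 hAc.continuousAt δ hδ
  rw [hA0] at hAδ
  obtain ⟨s₀, hs₀, hs₀'⟩ : ∃ s₀ : ℝ, 0 < s₀ ∧ s₀ < min δ δ' :=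
    exists_between (lt_min hδ hδ')
  -- A time `s = s₀ t` can be encoded as the parameter of the equation, evaluated at the end point,
  -- or as the evaluation time `t` for the fixed parameter `s₀`. The first form is smooth in `(x,
  -- s)`, the second visibly solves the differential equation in `s`.
  have key : ∀ x : E, ‖x‖ < s₀ → ∀ t : Icc (-1 : ℝ) 1,
      A (x, s₀ * t) ⟨1, by norm_num⟩ = A (x, s₀) t ∧
      A (x, s₀) t = x + s₀ • ∫ τ in (0 : ℝ)..t, X (IccExtend (by norm_num) (A (x, s₀)) τ) := by
    intro x hx t
    have hlt : s₀ < δ ∧ s₀ < δ' := lt_min_iff.1 hs₀'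
    have hxs : ‖(x, s₀)‖ = s₀ := by
      simp [Prod.norm_def, abs_of_pos hs₀, hx.le]
    have hAx : ‖A (x, s₀)‖ < δ := by
      have := hAδ (x := (x, s₀)) (by rw [dist_zero_right, hxs]; exact hlt.2)
      rwa [dist_zero_right] at this
    have h0 : flowEquation X hX.continuous ((x, s₀), A (x, s₀)) = 0 := by
      exact (hiff _ _ (by rw [hxs]; exact hlt.1) hAx).2 rfl
    rw [flowEquation_eq_zero_iff] at h0
    refine ⟨?_, h0 t⟩
    -- The curve `A (x, s₀)` run at speed `t`. It solves the equation with parameter `s₀ t` and is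
    -- small, so uniqueness identifies it with `A (x, s₀ * t)`.
    let β : C(Icc (-1 : ℝ) 1, E) := (A (x, s₀)).comp
      ⟨fun r => ⟨t * r, abs_le.1 (by
        rw [abs_mul]
        exact mul_le_one₀ (abs_le.2 t.2) (abs_nonneg _) (abs_le.2 r.2))⟩, by fun_prop⟩
    have hβ : ∀ r : Icc (-1 : ℝ) 1, β r = IccExtend (by norm_num) (A (x, s₀)) (t * r) := by
      intro r
      rw [IccExtend_of_mem]
      rfl
    have hβn : ‖β‖ ≤ ‖A (x, s₀)‖ := by
      rw [ContinuousMap.norm_le _ (norm_nonneg _)]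
      intro r
      exact ContinuousMap.norm_coe_le_norm (A (x, s₀)) _
    have hβ0 : flowEquation X hX.continuous ((x, s₀ * t), β) = 0 := by
      rw [flowEquation_eq_zero_iff]
      intro r
      have e1 : β r = x + s₀ • ∫ τ in (0 : ℝ)..(t * r),
          X (IccExtend (by norm_num) (A (x, s₀)) τ) := h0 _
      rw [e1, mul_smul]
      congr 2
      have e2 : ∀ τ ∈ uIcc (0 : ℝ) r, X (IccExtend (by norm_num) β τ)
          = X (IccExtend (by norm_num) (A (x, s₀)) (t * τ)) := by
        intro τ hτ
        have hτ' : τ ∈ Icc (-1 : ℝ) 1 := by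
          refine (uIcc_subset_Icc ?_ r.2) hτ
          norm_num
        rw [IccExtend_of_mem _ _ hτ', hβ]
      rw [intervalIntegral.integral_congr e2]
      have := intervalIntegral.smul_integral_comp_mul_left
        (fun τ => X (IccExtend (by norm_num) (A (x, s₀)) τ)) (t : ℝ) (a := 0) (b := r)
      rw [this, mul_zero]
    have ht1 : |(t : ℝ)| ≤ 1 := abs_le.2 t.2
    have := (hiff (x, s₀ * t) β ?_ (hβn.trans_lt hAx)).1 hβ0
    · rw [this]
      change A (x, s₀) _ = _
      congr 1
      ext
      simp
    · rw [Prod.norm_def, max_lt_iff]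
      refine ⟨hx.trans hlt.1, ?_⟩
      change |s₀ * t| < δ
      rw [abs_mul, abs_of_pos hs₀]
      nlinarith
  refine ⟨fun q => A q ⟨1, by norm_num⟩, ?_, ?_⟩
  · have h1 : ContDiff ℝ N fun α : C(Icc (-1 : ℝ) 1, E) =>
        ContinuousMap.evalCLM ℝ (⟨1, by norm_num⟩ : Icc (-1 : ℝ) 1) α :=
      ContinuousLinearMap.contDiff _
    exact h1.contDiffAt.comp (0 : E × ℝ) hAc
  · filter_upwards [Metric.ball_mem_nhds (0 : E × ℝ) hs₀] with q hq
    rw [mem_ball_zero_iff, Prod.norm_def, max_lt_iff] at hq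
    have hval : ∀ s : ℝ, |s| < s₀ → A (q.1, s) ⟨1, by norm_num⟩
        = q.1 + s₀ • ∫ τ in (0 : ℝ)..(s / s₀),
          X (IccExtend (by norm_num) (A (q.1, s₀)) τ) ∧ A (q.1, s) ⟨1, by norm_num⟩
        = IccExtend (by norm_num) (A (q.1, s₀)) (s / s₀) := by
      intro s hs
      have hmem : s / s₀ ∈ Icc (-1 : ℝ) 1 := by
        rw [mem_Icc, ← abs_le, abs_div, abs_of_pos hs₀]
        exact (div_le_one hs₀).2 hs.le
      obtain ⟨h1, h2⟩ := key q.1 hq.1 ⟨s / s₀, hmem⟩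
      rw [mul_div_cancel₀ _ hs₀.ne'] at h1
      rw [h1, IccExtend_of_mem _ _ hmem]
      exact ⟨h2, rfl⟩
    refine ⟨?_, ?_⟩
    · have := (hval 0 (by simpa using hs₀)).1
      simpa using this
    · have hq2 : |q.2| < s₀ := hq.2
      have hcont : Continuous fun τ => X (IccExtend (by norm_num) (A (q.1, s₀)) τ) :=
        hX.continuous.comp (A (q.1, s₀)).continuous.Icc_extend'
      have hd : HasDerivAt (fun s : ℝ => q.1 + s₀ • ∫ τ in (0 : ℝ)..(s / s₀),
          X (IccExtend (by norm_num) (A (q.1, s₀)) τ))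
          (X (IccExtend (by norm_num) (A (q.1, s₀)) (q.2 / s₀))) q.2 := by
        have h1 := hcont.integral_hasStrictDerivAt 0 (q.2 / s₀)
        have h2 := (h1.hasDerivAt.scomp q.2 ((hasDerivAt_id q.2).div_const s₀)).const_smul s₀
        have h3 := h2.const_add q.1
        convert! h3 using 1
        rw [smul_smul, mul_one_div_cancel hs₀.ne', one_smul]
      rw [← (hval q.2 hq2).2] at hd
      refine hd.congr_of_eventuallyEq ?_
      filter_upwards [(isOpen_lt continuous_abs continuous_const).mem_nhds hq2] with s hs
      exact (hval s hs).1

end Flow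

/-! ### Flow box for a nonvanishing field. -/

section FlowBox

variable {E : Type*} [NormedAddCommGroup E] [NormedSpace ℝ E]

/-- **Flow box**: in suitable local coordinates of class `C^N`, tangent to the identity at the
origin, a smooth vector field which does not vanish at the origin is constant. -/
theorem exists_flowBox [CompleteSpace E] {X : E → E} (hX : ContDiff ℝ ∞ X) (hX0 : X 0 ≠ 0) {N : ℕ}
    (hN : N ≠ 0) :
    ∃ Ψ : OpenPartialHomeomorph E E, 0 ∈ Ψ.source ∧ Ψ 0 = 0 ∧
      ContDiffOn ℝ N Ψ Ψ.source ∧ ContDiffOn ℝ N Ψ.symm Ψ.target ∧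
      HasFDerivAt Ψ (ContinuousLinearMap.id ℝ E) 0 ∧
      ∀ y ∈ Ψ.source, fderiv ℝ Ψ y (X 0) = X (Ψ y) := by
  have hN' : (N : WithTop ℕ∞) ≠ 0 := by exact_mod_cast hN
  obtain ⟨Φ, hΦ, hflow⟩ := exists_contDiffAt_flow hX hN
  obtain ⟨ℓ, hℓ⟩ := SeparatingDual.exists_eq_one (R := ℝ) hX0
  have h00 := hflow.self_of_nhds
  have hΦ0 : Φ 0 = 0 := h00.1
  -- Project `y` to the hyperplane `ker ℓ` along `X 0`, then flow for time `ℓ y`.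
  let A : E →L[ℝ] E × ℝ := (ContinuousLinearMap.id ℝ E - ℓ.smulRight (X 0)).prod ℓ
  have hA : ∀ y, A y = (y - ℓ y • X 0, ℓ y) := fun y => rfl
  let ψ : E → E := fun y => Φ (A y)
  have hψ : ContDiffAt ℝ N ψ 0 := by
    refine ContDiffAt.comp (0 : E) ?_ A.contDiff.contDiffAt
    rwa [map_zero]
  have hΦd : HasFDerivAt Φ (fderiv ℝ Φ 0) 0 := (hΦ.differentiableAt hN').hasFDerivAt
  have hspace : ∀ y : E, fderiv ℝ Φ 0 (y, 0) = y := by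
    intro y
    have h1 : HasFDerivAt (fun y : E => Φ (ContinuousLinearMap.inl ℝ E ℝ y))
        (fderiv ℝ Φ 0 ∘L ContinuousLinearMap.inl ℝ E ℝ) 0 := by
      refine HasFDerivAt.comp (0 : E) ?_ (ContinuousLinearMap.inl ℝ E ℝ).hasFDerivAt
      rwa [map_zero]
    have h2 : (fun y : E => Φ (ContinuousLinearMap.inl ℝ E ℝ y)) =ᶠ[𝓝 0] id := by
      have : Filter.Tendsto (fun y : E => ((y, 0) : E × ℝ)) (𝓝 0) (𝓝 0) :=
        (Continuous.prodMk_left (0 : ℝ)).tendsto' _ _ rfl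
      filter_upwards [this.eventually hflow] with y hy using hy.1
    have h3 := (h1.congr_of_eventuallyEq h2.symm).unique (hasFDerivAt_id _)
    simpa using DFunLike.congr_fun h3 y
  have htime : fderiv ℝ Φ 0 (0, 1) = X 0 := by
    have h1 : HasDerivAt (fun s : ℝ => ((0 : E), s)) (0, 1) 0 :=
      (hasDerivAt_const _ _).prodMk (hasDerivAt_id _)
    have h2 := HasFDerivAt.comp_hasDerivAt_of_eq (0 : ℝ) hΦd h1 rfl
    have h3 := h00.2
    rw [hΦ0] at h3
    exact h2.unique h3
  have hψd : HasFDerivAt ψ (ContinuousLinearMap.id ℝ E) 0 := by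
    have h1 : HasFDerivAt ψ (fderiv ℝ Φ 0 ∘L A) 0 := by
      refine HasFDerivAt.comp (0 : E) ?_ A.hasFDerivAt
      rwa [map_zero]
    convert! h1 using 1
    ext y
    have : A y = (y - ℓ y • X 0, 0) + ℓ y • (0, 1) := by simp [hA]
    rw [ContinuousLinearMap.comp_apply, this, map_add, map_smul, hspace, htime]
    simp
  have hψX : ∀ᶠ y in 𝓝 (0 : E), fderiv ℝ ψ y (X 0) = X (ψ y) := by
    have hA0 : Filter.Tendsto A (𝓝 0) (𝓝 0) := A.continuous.tendsto' _ _ (map_zero A)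
    have hd : ∀ᶠ y in 𝓝 (0 : E), DifferentiableAt ℝ ψ y := by
      have := hψ.of_le (m := 1) (by exact_mod_cast Nat.one_le_iff_ne_zero.2 hN)
      filter_upwards [this.eventually (by simp)] with y hy
        using hy.differentiableAt (by simp)
    filter_upwards [hA0.eventually hflow, hd] with y hy hyd
    have h1 : HasDerivAt (fun r : ℝ => ψ (y + r • X 0)) (fderiv ℝ ψ y (X 0)) 0 := by
      have h1 : HasDerivAt (fun r : ℝ => y + r • X 0) (X 0) 0 := by
        simpa using ((hasDerivAt_id (0 : ℝ)).smul_const (X 0)).const_add y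
      exact HasFDerivAt.comp_hasDerivAt_of_eq (0 : ℝ) hyd.hasFDerivAt h1 (by simp)
    have h2 : HasDerivAt (fun r : ℝ => ψ (y + r • X 0)) (X (ψ y)) 0 := by
      have h3 : HasDerivAt (fun r : ℝ => ℓ y + r) 1 0 := by
        simpa using (hasDerivAt_id (0 : ℝ)).const_add (ℓ y)
      have h4 := HasDerivAt.scomp_of_eq (0 : ℝ) hy.2 h3 (by simp [hA])
      rw [one_smul] at h4
      convert! h4 using 1
      funext r
      simp [ψ, hA, hℓ, add_smul]
    exact h1.unique h2
  have hψd' : HasFDerivAt ψ ((ContinuousLinearEquiv.refl ℝ E : E ≃L[ℝ] E) : E →L[ℝ] E) 0 := hψd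
  let Ψ := hψ.toOpenPartialHomeomorph ψ hψd' hN'
  have hmem : (0 : E) ∈ Ψ.source := hψ.mem_toOpenPartialHomeomorph_source hψd' hN'
  have hψ0 : ψ 0 = 0 := by simp [ψ, hΦ0]
  have hsymm : ContDiffAt ℝ N Ψ.symm 0 := by
    have := hψ.to_localInverse hψd' hN'
    rwa [hψ0] at this
  have hN1 : (N : WithTop ℕ∞) ≠ (∞ : WithTop ℕ∞) := by simp
  have hΨ0 : Ψ.symm 0 = 0 := by
    have := Ψ.left_inv hmem
    change Ψ.symm (ψ 0) = 0 at this
    rwa [hψ0] at this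
  have hsymm' : ∀ᶠ y in 𝓝 (0 : E), ContDiffAt ℝ N Ψ.symm (ψ y) := by
    have : Filter.Tendsto ψ (𝓝 0) (𝓝 0) := by
      have := hψ.continuousAt.tendsto
      rwa [hψ0] at this
    exact this.eventually (hsymm.eventually hN1)
  obtain ⟨U, hU, hUo, h0U⟩ := eventually_nhds_iff.1
    ((hψ.eventually hN1).and (hsymm'.and hψX))
  refine ⟨Ψ.restrOpen U hUo, ⟨hmem, h0U⟩, hψ0, ?_, ?_, hψd, fun y hy => (hU y hy.2).2.2⟩
  · exact fun y hy => (hU y hy.2).1.contDiffWithinAt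
  · intro z hz
    have hz' := (Ψ.restrOpen U hUo).map_target hz
    have h1 := (hU _ hz'.2).2.1
    have h2 : ψ ((Ψ.restrOpen U hUo).symm z) = z := (Ψ.restrOpen U hUo).right_inv hz
    rw [h2] at h1
    exact h1.contDiffWithinAt

end FlowBox

/-! ### Lipschitz curves of the straightened system. -/

section FlatCurves

variable {E : Type*} [NormedAddCommGroup E] [NormedSpace ℝ E]

/-- The derivative of the function `F` along the vector field `V`. -/
noncomputable def dirDeriv {G : Type*} [NormedAddCommGroup G] [NormedSpace ℝ G] (V : E → E)
    (F : E → G) (x : E) : G :=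
  fderiv ℝ F x (V x)

lemma ContDiff.dirDeriv {G : Type*} [NormedAddCommGroup G] [NormedSpace ℝ G] {V : E → E}
    {F : E → G} {k l : ℕ} (hV : ContDiff ℝ k V) (hF : ContDiff ℝ l F) (hkl : k + 1 ≤ l) :
    ContDiff ℝ k (dirDeriv V F) :=
  (hF.fderiv_right (by exact_mod_cast hkl)).clm_apply hV

/-- `x` is a Lipschitz solution on `[0, S]` of `x' = v e + w Z(x)`, where `|v| ≤ 1`, `|w| ≤ 2`. -/
structure IsFlatCurve (e : E) (Z : E → E) (S : ℝ) (v w : ℝ → ℝ) (x : ℝ → E) : Prop where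
  lip : ∃ K, LipschitzOnWith K x (Icc 0 S)
  deriv : ∀ᵐ t, t ∈ Ioo 0 S → HasDerivAt x (v t • e + w t • Z (x t)) t
  meas : Measurable v
  v_le : ∀ t ∈ Icc 0 S, |v t| ≤ 1
  w_le : ∀ t ∈ Icc 0 S, |w t| ≤ 2

lemma sub_le_integral_of_ae_hasDerivAt_le {f φ : ℝ → ℝ} {s : ℝ} (hs : 0 ≤ s)
    (hf : AbsolutelyContinuousOnInterval f 0 s) (hφ : IntervalIntegrable φ volume 0 s)
    (H : ∀ᵐ t, t ∈ Ioo 0 s → ∃ d ≤ φ t, HasDerivAt f d t) :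
    f s - f 0 ≤ ∫ t in (0 : ℝ)..s, φ t := by
  rw [← hf.integral_deriv_eq_sub]
  refine intervalIntegral.integral_mono_ae_restrict hs hf.intervalIntegrable_deriv hφ ?_
  rw [Filter.EventuallyLE, ← MeasureTheory.restrict_Ioo_eq_restrict_Icc,
    ae_restrict_iff' measurableSet_Ioo]
  filter_upwards [H] with t ht hts
  obtain ⟨d, hd, hd'⟩ := ht hts
  rwa [hd'.deriv]

namespace IsFlatCurve

variable {e : E} {Z : E → E} {S : ℝ} {v w : ℝ → ℝ} {x : ℝ → E}

lemma continuousOn (h : IsFlatCurve e Z S v w x) : ContinuousOn x (Icc 0 S) :=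
  h.lip.choose_spec.continuousOn

lemma intervalIntegrable (h : IsFlatCurve e Z S v w x) {s : ℝ} (hs : s ∈ Icc 0 S) {F : E → ℝ}
    (hF : Continuous F) : IntervalIntegrable (fun t => F (x t)) volume 0 s := by
  refine ContinuousOn.intervalIntegrable ?_
  rw [uIcc_of_le hs.1]
  exact hF.comp_continuousOn (h.continuousOn.mono (Icc_subset_Icc_right hs.2))

lemma intervalIntegrable_mul (h : IsFlatCurve e Z S v w x) {s : ℝ} (hs : s ∈ Icc 0 S) {F : E → ℝ}
    (hF : Continuous F) : IntervalIntegrable (fun t => v t * F (x t)) volume 0 s := by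
  have h1 := h.intervalIntegrable hs hF
  rw [intervalIntegrable_iff_integrableOn_Icc_of_le hs.1] at h1 ⊢
  refine h1.bdd_mul (c := 1) h.meas.aestronglyMeasurable ?_
  rw [ae_restrict_iff' measurableSet_Icc]
  exact Filter.Eventually.of_forall fun t ht => h.v_le t ⟨ht.1, ht.2.trans hs.2⟩

/-- All estimates along flat curves are obtained from this one by choosing a test function `F`.
Measurability of `w` is never needed, only pointwise bounds by an integrable `φ`. -/
lemma sub_le_integral [FiniteDimensional ℝ E] (h : IsFlatCurve e Z S v w x) {s : ℝ}
    (hs : s ∈ Icc 0 S) {F : E → ℝ}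
    (hF : ContDiff ℝ 1 F) {φ : ℝ → ℝ} (hφ : IntervalIntegrable φ volume 0 s)
    (H : ∀ t ∈ Ioo 0 S, fderiv ℝ F (x t) (v t • e + w t • Z (x t)) ≤ φ t) :
    F (x s) - F (x 0) ≤ ∫ t in (0 : ℝ)..s, φ t := by
  refine sub_le_integral_of_ae_hasDerivAt_le (f := fun t => F (x t)) hs.1 ?_ hφ ?_
  · obtain ⟨K, hK⟩ := h.lip
    obtain ⟨R, hR⟩ := isCompact_Icc.exists_bound_of_continuousOn h.continuousOn
    obtain ⟨L, hL⟩ := hF.contDiffOn.exists_lipschitzOnWith (by simp)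
      (convex_closedBall (0 : E) R) (isCompact_closedBall _ _)
    have h1 := hL.comp hK fun t ht => mem_closedBall_zero_iff.2 (hR t ht)
    refine (h1.mono ?_).absolutelyContinuousOnInterval
    rw [uIcc_of_le hs.1]
    exact Icc_subset_Icc_right hs.2
  · filter_upwards [h.deriv] with t ht hts
    have hts' : t ∈ Ioo 0 S := ⟨hts.1, hts.2.trans_le hs.2⟩
    exact ⟨_, H t hts', (hF.differentiable (by simp) _).hasFDerivAt.comp_hasDerivAt t (ht hts')⟩

end IsFlatCurve

variable [FiniteDimensional ℝ E]

lemma exists_norm_le_of_continuous {G : Type*} [NormedAddCommGroup G] {F : E → G}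
    (hF : Continuous F) (r : ℝ) : ∃ C > 0, ∀ x, ‖x‖ ≤ r → ‖F x‖ ≤ C := by
  obtain ⟨C, hC⟩ := (isCompact_closedBall (0 : E) r).exists_bound_of_continuousOn hF.continuousOn
  exact ⟨max C 1, by positivity, fun x hx =>
    (hC x (mem_closedBall_zero_iff.2 hx)).trans (le_max_left _ _)⟩

lemma exists_norm_sub_le_of_contDiff {G : Type*} [NormedAddCommGroup G] [NormedSpace ℝ G]
    {F : E → G} (hF : ContDiff ℝ 1 F) (r : ℝ) :
    ∃ C > 0, ∀ x y, ‖x‖ ≤ r → ‖y‖ ≤ r → ‖F x - F y‖ ≤ C * ‖x - y‖ := by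
  obtain ⟨K, hK⟩ := hF.contDiffOn.exists_lipschitzOnWith (by simp) (convex_closedBall (0 : E) r)
    (isCompact_closedBall _ _)
  refine ⟨K + 1, by positivity, fun x y hx hy => ?_⟩
  have := hK.norm_sub_le (mem_closedBall_zero_iff.2 hx) (mem_closedBall_zero_iff.2 hy)
  refine this.trans ?_
  gcongr
  linarith

end FlatCurves

/-! ### The normal form and first-order estimates. -/

section NormalForm

variable {E : Type*} [NormedAddCommGroup E] [NormedSpace ℝ E]

/-- A pair of vector fields in straightened form: the first one is the constant field `e`, the
second one is `Z`; the line `t ↦ t e` is abnormal on `[0, t₁]`, with constant adjoint vector `p`;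
`ℓ` measures time along the line, and `m` integrates the control of `Z`. -/
structure IsNormalForm (e : E) (Z : E → E) (ℓ m p : E →L[ℝ] ℝ) (r t₁ : ℝ) : Prop where
  contDiff : ContDiff ℝ 4 Z
  r_pos : 0 < r
  r_le : r ≤ 1
  t_pos : 0 < t₁
  ℓ_e : ℓ e = 1
  ℓ_Z : ℓ (Z 0) = 0
  m_e : m e = 0
  m_Z : ∀ x, ‖x‖ ≤ r → m (Z x) = 1
  p_e : p e = 0
  p_Z : ∀ t ∈ Icc 0 t₁, p (Z (t • e)) = 0

/-- The component of `x` transverse to the line `ℝ e`. -/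
noncomputable def transverse (e : E) (ℓ : E →L[ℝ] ℝ) : E →L[ℝ] E :=
  ContinuousLinearMap.id ℝ E - ℓ.smulRight e

lemma transverse_apply (e : E) (ℓ : E →L[ℝ] ℝ) (x : E) : transverse e ℓ x = x - ℓ x • e := rfl

/-- The derivative along `e` of the function `p ∘ Z`. -/
noncomputable def slope (e : E) (Z : E → E) (p : E →L[ℝ] ℝ) : E → ℝ :=
  dirDeriv (fun _ => e) fun x => p (Z x)

/-- The value at the origin of `p ([Z, [Z, e]])`, in terms of derivatives of `p ∘ Z`. -/
noncomputable def curvature (e : E) (Z : E → E) (p : E →L[ℝ] ℝ) : ℝ :=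
  dirDeriv (fun _ => e) (dirDeriv Z fun x => p (Z x)) 0 - 2 * fderiv ℝ (slope e Z p) 0 (Z 0)

lemma IsNormalForm.slope_eq_zero {e : E} {Z : E → E} {ℓ m p : E →L[ℝ] ℝ} {r t₁ : ℝ}
    (h : IsNormalForm e Z ℓ m p r t₁) {t : ℝ} (ht : t ∈ Icc 0 t₁) :
    slope e Z p (t • e) = 0 := by
  have hg : Differentiable ℝ fun x => p (Z x) :=
    (p.contDiff.comp h.contDiff).differentiable (by simp)
  have h1 : HasDerivAt (fun s : ℝ => s • e) e t := by
    simpa using (hasDerivAt_id t).smul_const e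
  have h2 : HasDerivAt (fun s : ℝ => p (Z (s • e))) (slope e Z p (t • e)) t :=
    HasFDerivAt.comp_hasDerivAt (l := fun x => p (Z x)) t (hg (t • e)).hasFDerivAt h1
  have h3 : HasDerivWithinAt (fun s : ℝ => p (Z (s • e))) 0 (Icc 0 t₁) t :=
    (hasDerivWithinAt_const t (Icc 0 t₁) (0 : ℝ)).congr (fun s hs => h.p_Z s hs) (h.p_Z t ht)
  exact (uniqueDiffOn_Icc h.t_pos t ht).eq_deriv _ h2.hasDerivWithinAt h3

variable [FiniteDimensional ℝ E] {e : E} {Z : E → E} {ℓ m p : E →L[ℝ] ℝ} {r t₁ : ℝ}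

namespace IsNormalForm

/-- Integration by parts: the transverse part of `x` has derivative `w B(x)` with `B = transverse ∘
Z`, and `w` is the derivative of `m(x)`. After subtracting `m B` only the term `m · dB(x')` is left.
-/
lemma exists_transverse_le (h : IsNormalForm e Z ℓ m p r t₁) :
    ∃ C > 0, ∀ S v w x, IsFlatCurve e Z S v w x → (∀ t ∈ Icc 0 S, ‖x t‖ ≤ r) →
      transverse e ℓ (x 0) = 0 → m (x 0) = 0 → ∀ s ∈ Icc 0 S,
      ‖transverse e ℓ (x s) - m (x s) • transverse e ℓ (Z (x s))‖
        ≤ C * ∫ t in (0 : ℝ)..s, |m (x t)| := by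
  set B : E → E := fun x => transverse e ℓ (Z x) with hB
  have hB1 : ContDiff ℝ 1 B :=
    (transverse e ℓ).contDiff.comp (h.contDiff.of_le (by norm_num))
  have hBd : Differentiable ℝ B := hB1.differentiable (by simp)
  obtain ⟨C₁, hC₁, hB'⟩ := exists_norm_le_of_continuous (hB1.continuous_fderiv (by simp)) r
  obtain ⟨C₂, hC₂, hZ⟩ := exists_norm_le_of_continuous h.contDiff.continuous r
  refine ⟨C₁ * (‖e‖ + 2 * C₂), by positivity, fun S v w x hx hxr h0 hm0 s hs => ?_⟩
  -- A norming functional reduces the vector estimate to a scalar test function.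
  obtain ⟨φ, hφ, hφs⟩ := exists_dual_vector'' ℝ
    (transverse e ℓ (x s) - m (x s) • transverse e ℓ (Z (x s)))
  let F : E → ℝ := fun y => φ (transverse e ℓ y - m y • B y)
  have hF : ContDiff ℝ 1 F :=
    φ.contDiff.comp ((transverse e ℓ).contDiff.sub (m.contDiff.smul hB1))
  have key := hx.sub_le_integral hs hF
    (φ := fun t => C₁ * (‖e‖ + 2 * C₂) * |m (x t)|)
    ((hx.intervalIntegrable hs (F := fun y => |m y|) (by fun_prop)).const_mul _) ?_
  · have hF0 : F (x 0) = 0 := by simp [F, h0, hm0]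
    rw [hF0, sub_zero, intervalIntegral.integral_const_mul] at key
    refine le_trans (le_of_eq ?_) key
    exact hφs.symm
  · intro t ht
    have ht' := Ioo_subset_Icc_self ht
    set y := x t
    have hd : HasFDerivAt F (φ ∘L (transverse e ℓ - (m y • fderiv ℝ B y + m.smulRight (B y)))) y :=
      φ.hasFDerivAt.comp y ((transverse e ℓ).hasFDerivAt.sub
        (m.hasFDerivAt.smul (hBd y).hasFDerivAt))
    rw [hd.fderiv]
    have hcalc : (φ ∘L (transverse e ℓ - (m y • fderiv ℝ B y + m.smulRight (B y))))
        (v t • e + w t • Z y) = φ (-(m y • fderiv ℝ B y (v t • e + w t • Z y))) := by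
      simp only [ContinuousLinearMap.comp_apply, _root_.sub_apply,
        _root_.add_apply, _root_.smul_apply,
        ContinuousLinearMap.smulRight_apply]
      congr 1
      have h1 : m (v t • e + w t • Z y) = w t := by
        simp [h.m_e, h.m_Z y (hxr t ht')]
      have h2 : transverse e ℓ (v t • e + w t • Z y) = w t • B y := by
        rw [map_add, map_smul, map_smul, transverse_apply e ℓ e, h.ℓ_e]
        simp [hB]
      rw [h1, h2]
      abel
    rw [hcalc]
    refine (le_abs_self _).trans ((φ.le_opNorm _).trans ?_)
    refine (mul_le_of_le_one_left (norm_nonneg _) hφ).trans ?_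
    rw [norm_neg, norm_smul, Real.norm_eq_abs, mul_comm]
    gcongr
    refine ((fderiv ℝ B y).le_opNorm _).trans ?_
    gcongr
    · exact hB' y (hxr t ht')
    · refine (norm_add_le _ _).trans ?_
      rw [norm_smul, norm_smul]
      gcongr
      · exact mul_le_of_le_one_left (norm_nonneg _) (hx.v_le t ht')
      · exact hx.w_le t ht'
      · exact hZ y (hxr t ht')

/-- The same integration by parts, for `ℓ(x)' = v + w ℓ(Z(x))`. -/
lemma exists_longitudinal_le (h : IsNormalForm e Z ℓ m p r t₁) :
    ∃ C > 0, ∀ S v w x, IsFlatCurve e Z S v w x → (∀ t ∈ Icc 0 S, ‖x t‖ ≤ r) →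
      m (x 0) = 0 → ∀ s ∈ Icc 0 S,
      |ℓ (x s) - ℓ (x 0) - (∫ t in (0 : ℝ)..s, v t) - m (x s) * ℓ (Z (x s))|
        ≤ C * ∫ t in (0 : ℝ)..s, |m (x t)| := by
  set B : E → ℝ := fun x => ℓ (Z x) with hB
  have hB1 : ContDiff ℝ 1 B := ℓ.contDiff.comp (h.contDiff.of_le (by norm_num))
  have hBd : Differentiable ℝ B := hB1.differentiable (by simp)
  obtain ⟨C₁, hC₁, hB'⟩ := exists_norm_le_of_continuous (hB1.continuous_fderiv (by simp)) r
  obtain ⟨C₂, hC₂, hZ⟩ := exists_norm_le_of_continuous h.contDiff.continuous r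
  refine ⟨C₁ * (‖e‖ + 2 * C₂), by positivity, fun S v w x hx hxr hm0 s hs => ?_⟩
  have hv : IntervalIntegrable v volume 0 s := by
    simpa using hx.intervalIntegrable_mul hs (F := fun _ => 1) continuous_const
  have hm : IntervalIntegrable (fun t => C₁ * (‖e‖ + 2 * C₂) * |m (x t)|) volume 0 s :=
    (hx.intervalIntegrable hs (F := fun y => |m y|) (by fun_prop)).const_mul _
  let F : E → ℝ := fun y => ℓ y - m y * B y
  have hF : ContDiff ℝ 1 F := ℓ.contDiff.sub (m.contDiff.mul hB1)
  have hd : ∀ t ∈ Ioo 0 S, |fderiv ℝ F (x t) (v t • e + w t • Z (x t)) - v t|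
      ≤ C₁ * (‖e‖ + 2 * C₂) * |m (x t)| := by
    intro t ht
    have ht' := Ioo_subset_Icc_self ht
    set y := x t
    have hd : HasFDerivAt F (ℓ - (m y • fderiv ℝ B y + B y • m)) y :=
      ℓ.hasFDerivAt.sub (m.hasFDerivAt.mul (hBd y).hasFDerivAt)
    rw [hd.fderiv]
    have h1 : m (v t • e + w t • Z y) = w t := by
      simp [h.m_e, h.m_Z y (hxr t ht')]
    have h2 : ℓ (v t • e + w t • Z y) = v t + w t * B y := by
      simp [hB, h.ℓ_e]
    have hcalc : (ℓ - (m y • fderiv ℝ B y + B y • m)) (v t • e + w t • Z y) - v t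
        = -(fderiv ℝ B y (v t • e + w t • Z y) * m y) := by
      simp only [_root_.sub_apply, _root_.add_apply,
        _root_.smul_apply, smul_eq_mul]
      rw [h1, h2]
      ring
    rw [hcalc, abs_neg, abs_mul]
    gcongr
    refine ((fderiv ℝ B y).le_opNorm _).trans ?_
    gcongr
    · exact hB' y (hxr t ht')
    · refine (norm_add_le _ _).trans ?_
      rw [norm_smul, norm_smul]
      gcongr
      · exact mul_le_of_le_one_left (norm_nonneg _) (hx.v_le t ht')
      · exact hx.w_le t ht'
      · exact hZ y (hxr t ht')
  have up := hx.sub_le_integral hs hF (hv.add hm)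
    (fun t ht => by have := (abs_le.1 (hd t ht)).2; linarith)
  have lo := hx.sub_le_integral hs hF.neg (hm.sub hv) (fun t ht => by
    have := (abs_le.1 (hd t ht)).1
    rw [fderiv_fun_neg, _root_.neg_apply]
    linarith)
  rw [intervalIntegral.integral_add hv hm, intervalIntegral.integral_const_mul] at up
  rw [intervalIntegral.integral_sub hm hv, intervalIntegral.integral_const_mul] at lo
  simp only [F, hm0, zero_mul, sub_zero] at up lo
  rw [abs_le]
  constructor <;> linarith

/-- Expand `slope` at the foot point `ℓ(y) e`. It vanishes there if `ℓ y ≥ 0`; otherwise the lower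
bound on `ℓ y` keeps it small by Lipschitz continuity. The remaining displacement is `m(y) Z(0)` up
to an admissible error. `I` stands for `∫ |m|`. -/
lemma exists_slope_sub_le (h : IsNormalForm e Z ℓ m p r t₁) (C₀ : ℝ) (hC₀ : 0 < C₀) :
    ∃ C > 0, ∀ ρ y I, 0 ≤ I → ‖y‖ ≤ ρ → ρ ≤ r → ‖ℓ‖ * ρ ≤ t₁ →
      ‖transverse e ℓ y - m y • transverse e ℓ (Z y)‖ ≤ C₀ * I →
      -(C₀ * (I + ρ * |m y|)) ≤ ℓ y →
      |slope e Z p y - fderiv ℝ (slope e Z p) 0 (Z 0) * m y| ≤ C * (I + ρ * |m y|) := by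
  have hh : ContDiff ℝ 3 (slope e Z p) :=
    ContDiff.dirDeriv (k := 3) (l := 4) contDiff_const (p.contDiff.comp h.contDiff) (by norm_num)
  set R := r * (1 + ‖ℓ‖ * ‖e‖) with hR
  obtain ⟨C₁, hC₁, H1⟩ := exists_norm_sub_le_of_contDiff
    (hh.fderiv_right (m := 1) (by norm_num)) R
  obtain ⟨C₂, hC₂, H2⟩ := exists_norm_sub_le_of_contDiff
    (hh.of_le (by norm_num) : ContDiff ℝ 1 (slope e Z p)) R
  obtain ⟨C₃, hC₃, H3⟩ := exists_norm_sub_le_of_contDiff (F := fun x => transverse e ℓ (Z x))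
    ((transverse e ℓ).contDiff.comp (h.contDiff.of_le (by norm_num))) R
  obtain ⟨C₄, hC₄, H4⟩ := exists_norm_le_of_continuous (F := fun x => transverse e ℓ (Z x))
    ((transverse e ℓ).continuous.comp h.contDiff.continuous) R
  set A := ‖fderiv ℝ (slope e Z p) 0‖ with hA
  set q := 1 + ‖ℓ‖ * ‖e‖ with hq
  have hq0 : 1 ≤ q := by
    simp only [hq]
    nlinarith [norm_nonneg ℓ, norm_nonneg e, mul_nonneg (norm_nonneg ℓ) (norm_nonneg e)]
  refine ⟨C₁ * q * (C₀ + C₄) + C₂ * C₀ * ‖e‖ + A * (C₀ + C₃) + 1, by positivity,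
    fun ρ y I hI hy hρ hρt hz hl => ?_⟩
  have hρ0 : 0 ≤ ρ := (norm_nonneg y).trans hy
  have hyr : ‖y‖ ≤ r := hy.trans hρ
  have hyR : ‖y‖ ≤ R := hyr.trans (le_mul_of_one_le_right h.r_pos.le hq0)
  have h0R : ‖(0 : E)‖ ≤ R := by rw [norm_zero]; exact (norm_nonneg y).trans hyR
  have hℓy : |ℓ y| ≤ ‖ℓ‖ * ρ := (ℓ.le_opNorm y).trans (by gcongr)
  have hℓe : ‖ℓ y • e‖ ≤ ρ * q := by
    rw [norm_smul, Real.norm_eq_abs]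
    calc |ℓ y| * ‖e‖ ≤ (‖ℓ‖ * ρ) * ‖e‖ := by gcongr
      _ ≤ ρ * q := by simp only [hq]; nlinarith
  have hρR : ρ * q ≤ R := by rw [hR]; gcongr
  have hℓeR : ‖ℓ y • e‖ ≤ R := hℓe.trans hρR
  -- the transverse part
  have hB : ‖transverse e ℓ (Z y)‖ ≤ C₄ := H4 y hyR
  have hzn : ‖transverse e ℓ y‖ ≤ C₀ * I + C₄ * |m y| := by
    calc ‖transverse e ℓ y‖ = ‖(transverse e ℓ y - m y • transverse e ℓ (Z y))
          + m y • transverse e ℓ (Z y)‖ := by rw [sub_add_cancel]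
      _ ≤ C₀ * I + |m y| * C₄ := (norm_add_le _ _).trans
          (add_le_add hz (by rw [norm_smul, Real.norm_eq_abs]; gcongr))
      _ = _ := by ring
  -- value on the line
  have hline : |slope e Z p (ℓ y • e)| ≤ C₂ * C₀ * ‖e‖ * (I + ρ * |m y|) := by
    rcases le_or_gt 0 (ℓ y) with h0 | h0
    · rw [h.slope_eq_zero ⟨h0, (le_abs_self _).trans (hℓy.trans hρt)⟩, abs_zero]
      positivity
    · have h00 : slope e Z p 0 = 0 := by
        simpa using h.slope_eq_zero (t := 0) ⟨le_rfl, h.t_pos.le⟩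
      have := H2 (ℓ y • e) 0 hℓeR h0R
      rw [h00, sub_zero, sub_zero, norm_smul, Real.norm_eq_abs, Real.norm_eq_abs,
        abs_of_neg h0] at this
      refine this.trans ?_
      have : C₂ * (-ℓ y * ‖e‖) ≤ C₂ * ((C₀ * (I + ρ * |m y|)) * ‖e‖) := by
        gcongr
        linarith
      linarith
  -- linearization
  have hconv : Convex ℝ (Metric.closedBall (0 : E) (ρ * q)) := convex_closedBall _ _
  have hsub := hconv.norm_image_sub_le_of_norm_fderiv_le' (f := slope e Z p)
    (φ := fderiv ℝ (slope e Z p) 0) (C := C₁ * (ρ * q)) (x := ℓ y • e) (y := y)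
    (fun x _ => hh.differentiable (by simp) x)
    (fun x hx => by
      rw [mem_closedBall_zero_iff] at hx
      have := H1 x 0 (hx.trans hρR) h0R
      rw [sub_zero] at this
      exact this.trans (by gcongr))
    (mem_closedBall_zero_iff.2 hℓe)
    (mem_closedBall_zero_iff.2 (hy.trans (le_mul_of_one_le_right hρ0 hq0)))
  rw [← transverse_apply] at hsub
  have hZ0 : transverse e ℓ (Z 0) = Z 0 := by rw [transverse_apply, h.ℓ_Z]; simp
  have hdiff : ‖transverse e ℓ y - m y • Z 0‖ ≤ C₀ * I + C₃ * ρ * |m y| := by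
    have h1 := H3 y 0 hyR h0R
    rw [hZ0, sub_zero] at h1
    calc ‖transverse e ℓ y - m y • Z 0‖ = ‖(transverse e ℓ y - m y • transverse e ℓ (Z y))
          + m y • (transverse e ℓ (Z y) - Z 0)‖ := by rw [smul_sub]; congr 1; abel
      _ ≤ C₀ * I + |m y| * (C₃ * ρ) := (norm_add_le _ _).trans
          (add_le_add hz (by
            rw [norm_smul, Real.norm_eq_abs]
            gcongr
            exact h1.trans (by gcongr)))
      _ = _ := by ring
  have hlin : |fderiv ℝ (slope e Z p) 0 (transverse e ℓ y - m y • Z 0)|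
      ≤ A * (C₀ * I + C₃ * ρ * |m y|) :=
    ((fderiv ℝ (slope e Z p) 0).le_opNorm _).trans (by gcongr)
  have hsplit : slope e Z p y - fderiv ℝ (slope e Z p) 0 (Z 0) * m y
      = (slope e Z p y - slope e Z p (ℓ y • e) - fderiv ℝ (slope e Z p) 0 (transverse e ℓ y))
        + slope e Z p (ℓ y • e) + fderiv ℝ (slope e Z p) 0 (transverse e ℓ y - m y • Z 0) := by
    rw [map_sub, map_smul, smul_eq_mul]; ring
  rw [hsplit]
  have hρ1 : ρ ≤ 1 := hρ.trans h.r_le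
  have t1 : C₁ * (ρ * q) * ‖transverse e ℓ y‖ ≤ C₁ * q * (C₀ + C₄) * (I + ρ * |m y|) := by
    have e1 : ρ * (C₀ * I + C₄ * |m y|) ≤ (C₀ + C₄) * (I + ρ * |m y|) := by
      have a1 : ρ * (C₀ * I) ≤ C₀ * I := mul_le_of_le_one_left (by positivity) hρ1
      have a2 : 0 ≤ C₄ * I := by positivity
      have a3 : 0 ≤ C₀ * (ρ * |m y|) := by positivity
      linarith
    calc C₁ * (ρ * q) * ‖transverse e ℓ y‖ ≤ C₁ * (ρ * q) * (C₀ * I + C₄ * |m y|) := by gcongr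
      _ = C₁ * q * (ρ * (C₀ * I + C₄ * |m y|)) := by ring
      _ ≤ C₁ * q * ((C₀ + C₄) * (I + ρ * |m y|)) := by gcongr
      _ = _ := by ring
  have t2 : A * (C₀ * I + C₃ * ρ * |m y|) ≤ A * (C₀ + C₃) * (I + ρ * |m y|) := by
    have hA0 : 0 ≤ A := norm_nonneg _
    have a2 : 0 ≤ C₃ * I := by positivity
    have a3 : 0 ≤ C₀ * (ρ * |m y|) := by positivity
    have a4 : C₀ * I + C₃ * ρ * |m y| ≤ (C₀ + C₃) * (I + ρ * |m y|) := by linarith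
    calc _ ≤ A * ((C₀ + C₃) * (I + ρ * |m y|)) := by gcongr
      _ = _ := by ring
  have t3 : 0 ≤ I + ρ * |m y| := by positivity
  rw [Real.norm_eq_abs] at hsub
  refine (abs_add_le _ _).trans ((add_le_add_left (abs_add_le _ _) _).trans ?_)
  linarith

end IsNormalForm

end NormalForm

/-- Cauchy–Schwarz, from integrating `(|f| - I/S)² ≥ 0`. -/
lemma sq_integral_abs_le {f : ℝ → ℝ} {S : ℝ} (hS : 0 ≤ S) (hf : ContinuousOn f (Icc 0 S)) :
    (∫ t in (0 : ℝ)..S, |f t|) ^ 2 ≤ S * ∫ t in (0 : ℝ)..S, f t ^ 2 := by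
  rcases hS.eq_or_lt with rfl | hS'
  · simp
  rw [← uIcc_of_le hS] at hf
  set I := ∫ t in (0 : ℝ)..S, |f t|
  have h1 : IntervalIntegrable (fun t => f t ^ 2) volume 0 S := (hf.pow 2).intervalIntegrable
  have h2 : IntervalIntegrable (fun t => |f t|) volume 0 S := hf.abs.intervalIntegrable
  have h3 : 0 ≤ ∫ t in (0 : ℝ)..S, (f t ^ 2 - 2 * (I / S) * |f t| + (I / S) ^ 2) := by
    refine intervalIntegral.integral_nonneg hS fun t _ => ?_
    have : f t ^ 2 - 2 * (I / S) * |f t| + (I / S) ^ 2 = (|f t| - I / S) ^ 2 := by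
      rw [sub_sq, sq_abs]; ring
    rw [this]
    positivity
  rw [intervalIntegral.integral_add (h1.sub (h2.const_mul _)) (by simp),
    intervalIntegral.integral_sub h1 (h2.const_mul _), intervalIntegral.integral_const_mul,
    intervalIntegral.integral_const, smul_eq_mul, sub_zero] at h3
  change 0 ≤ _ - 2 * (I / S) * I + S * (I / S) ^ 2 at h3
  have h4 : 2 * (I / S) * I - S * (I / S) ^ 2 = I ^ 2 / S := by field_simp; ring
  have h5 : I ^ 2 / S ≤ ∫ t in (0 : ℝ)..S, f t ^ 2 := by linarith
  rwa [div_le_iff₀' hS'] at h5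

/-! ### The second-order expansion of `p`. -/

section NormalForm

variable {E : Type*} [NormedAddCommGroup E] [NormedSpace ℝ E]
  [FiniteDimensional ℝ E] {e : E} {Z : E → E} {ℓ m p : E →L[ℝ] ℝ} {r t₁ : ℝ}

namespace IsNormalForm

/-- Correct `p` by multiples of powers of `m` until its derivative along `Z` is of order `m³`. What
is left to order `m²` comes from the drift: `-v m · slope + v (m²/2) e(k)`, where `k` is the
derivative of `p ∘ Z` along `Z`. Since `slope ≈ m · d(slope)₀(Z 0)`, this is `κ/2 · v m²`. The error
`I ∫ |m| = I²` is absorbed by Cauchy–Schwarz. -/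
lemma exists_expansion (h : IsNormalForm e Z ℓ m p r t₁) {C₀ : ℝ} (hC₀ : 0 < C₀) :
    ∃ C > 0, ∀ ρ S v w x, 0 ≤ S → IsFlatCurve e Z S v w x → ρ ≤ r → ‖ℓ‖ * ρ ≤ t₁ →
      (∀ t ∈ Icc 0 S, ‖x t‖ ≤ ρ) → transverse e ℓ (x 0) = 0 → m (x 0) = 0 → m (x S) = 0 →
      (∀ s ∈ Icc 0 S, -(C₀ * ((∫ t in (0 : ℝ)..S, |m (x t)|) + ρ * |m (x s)|)) ≤ ℓ (x s)) →
      |p (x S) - curvature e Z p / 2 * ∫ t in (0 : ℝ)..S, v t * m (x t) ^ 2|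
        ≤ C * (ρ + S) * ∫ t in (0 : ℝ)..S, m (x t) ^ 2 := by
  obtain ⟨C₁, hC₁, H1⟩ := h.exists_transverse_le
  obtain ⟨C₂, hC₂, H2⟩ := h.exists_slope_sub_le (max C₀ C₁) (by positivity)
  have hce : ∀ n : ℕ, ContDiff ℝ n fun _ : E => e := fun n => contDiff_const
  set g : E → ℝ := fun x => p (Z x) with hg
  have hg4 : ContDiff ℝ (4 : ℕ) g := p.contDiff.comp h.contDiff
  set k : E → ℝ := dirDeriv Z g with hk
  have hk3 : ContDiff ℝ (3 : ℕ) k :=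
    ContDiff.dirDeriv (h.contDiff.of_le (by norm_num)) hg4 (by norm_num)
  set kk : E → ℝ := dirDeriv Z k with hkk
  have hkk2 : ContDiff ℝ (2 : ℕ) kk :=
    ContDiff.dirDeriv (h.contDiff.of_le (by norm_num)) hk3 (by norm_num)
  have hke : ContDiff ℝ (1 : ℕ) (dirDeriv (fun _ => e) k) :=
    ContDiff.dirDeriv (hce _) hk3 (by norm_num)
  have hkke : ContDiff ℝ (1 : ℕ) (dirDeriv (fun _ => e) kk) :=
    ContDiff.dirDeriv (hce _) hkk2 (by norm_num)
  have hkkk : ContDiff ℝ (1 : ℕ) (dirDeriv Z kk) :=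
    ContDiff.dirDeriv (h.contDiff.of_le (by norm_num)) hkk2 (by norm_num)
  obtain ⟨C₃, hC₃, H3⟩ := exists_norm_sub_le_of_contDiff hke r
  obtain ⟨C₄, hC₄, H4⟩ := exists_norm_le_of_continuous hkke.continuous r
  obtain ⟨C₅, hC₅, H5⟩ := exists_norm_le_of_continuous hkkk.continuous r
  set κ := curvature e Z p with hκ
  set C := C₂ + C₃ + ‖m‖ * (C₄ + 2 * C₅) with hC
  refine ⟨C, by positivity, fun ρ S v w x hS hx hρr hρt hxρ hz0 hm0 hmS hℓ => ?_⟩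
  set I := ∫ t in (0 : ℝ)..S, |m (x t)| with hI
  set J := ∫ t in (0 : ℝ)..S, m (x t) ^ 2 with hJ
  have hρ0 : 0 ≤ ρ := (norm_nonneg _).trans (hxρ 0 ⟨le_rfl, hS⟩)
  have hS' : S ∈ Icc 0 S := ⟨hS, le_rfl⟩
  have hI0 : 0 ≤ I := intervalIntegral.integral_nonneg hS fun t _ => abs_nonneg _
  have hJ0 : 0 ≤ J := intervalIntegral.integral_nonneg hS fun t _ => by positivity
  have hIm : IntervalIntegrable (fun t => |m (x t)|) volume 0 S :=
    hx.intervalIntegrable hS' (F := fun y => |m y|) (by fun_prop)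
  have hJm : IntervalIntegrable (fun t => m (x t) ^ 2) volume 0 S :=
    hx.intervalIntegrable hS' (F := fun y => m y ^ 2) (by fun_prop)
  have hvm : IntervalIntegrable (fun t => v t * m (x t) ^ 2) volume 0 S :=
    hx.intervalIntegrable_mul hS' (F := fun y => m y ^ 2) (by fun_prop)
  -- Since `m` has derivative `1` along `Z`, the derivative of `G` along `Z` telescopes to `-(m³/6)
  -- Z(kk)`. As `m` vanishes at both ends, `G` and `p` agree there.
  let G : E → ℝ := fun y => p y - m y * g y + m y ^ 2 / 2 * k y - m y ^ 3 / 6 * kk y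
  have hG : ContDiff ℝ 1 G := by
    refine ((p.contDiff.sub (m.contDiff.mul (hg4.of_le (by norm_num)))).add
      (((m.contDiff.pow 2).div_const 2).mul (hk3.of_le (by norm_num)))).sub
      (((m.contDiff.pow 3).div_const 6).mul (hkk2.of_le (by norm_num)))
  have hx0 : x 0 = ℓ (x 0) • e := by
    rw [transverse_apply, sub_eq_zero] at hz0; exact hz0
  have hp0 : p (x 0) = 0 := by rw [hx0, map_smul, h.p_e, smul_zero]
  have hG0 : G (x 0) = 0 := by simp [G, hm0, hp0]
  have hGS : G (x S) = p (x S) := by simp [G, hmS]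
  have hmain : ∀ t ∈ Ioo 0 S, |fderiv ℝ G (x t) (v t • e + w t • Z (x t))
      - κ / 2 * (v t * m (x t) ^ 2)| ≤ C * (I * |m (x t)| + ρ * m (x t) ^ 2) := by
    intro t ht
    have ht' := Ioo_subset_Icc_self ht
    have hyρ := hxρ t ht'
    have hyr := hyρ.trans hρr
    have hv := hx.v_le t ht'
    have hw := hx.w_le t ht'
    have hslope := H2 ρ (x t) I hI0 hyρ hρr hρt
      (by
        refine (H1 S v w x hx (fun s hs => (hxρ s hs).trans hρr) hz0 hm0 t ht').trans ?_
        gcongr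
        · exact intervalIntegral.integral_nonneg ht'.1 fun t _ => abs_nonneg _
        · exact le_max_right _ _
        · refine intervalIntegral.integral_mono_interval le_rfl ht'.1 ht'.2
            (Filter.Eventually.of_forall fun t => abs_nonneg _) hIm)
      (by
        refine le_trans ?_ (hℓ t ht')
        gcongr
        exact le_max_left _ _)
    set y := x t with hy
    have hmy : |m y| ≤ ‖m‖ * ρ := (m.le_opNorm y).trans (by gcongr)
    have b1 : |dirDeriv (fun _ => e) k y - dirDeriv (fun _ => e) k 0| ≤ C₃ * ρ := by
      have := H3 y 0 hyr (by rw [norm_zero]; exact h.r_pos.le)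
      rw [sub_zero, Real.norm_eq_abs] at this
      exact this.trans (by gcongr)
    have b2 : |dirDeriv (fun _ => e) kk y| ≤ C₄ := H4 y hyr
    have b3 : |dirDeriv Z kk y| ≤ C₅ := H5 y hyr
    have hd : fderiv ℝ G y (v t • e + w t • Z y)
        = -(v t * m y * slope e Z p y) + v t * m y ^ 2 / 2 * dirDeriv (fun _ => e) k y
          - m y ^ 3 / 6 * (v t * dirDeriv (fun _ => e) kk y + w t * dirDeriv Z kk y) := by
      have dm := m.hasFDerivAt (x := y)
      have dg := (hg4.differentiable (by simp) y).hasFDerivAt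
      have dk := (hk3.differentiable (by simp) y).hasFDerivAt
      have dkk := (hkk2.differentiable (by simp) y).hasFDerivAt
      have d2 : HasFDerivAt (fun y => m y ^ 2 / 2) (m y • m) y := by
        have := (dm.pow 2).mul_const (2⁻¹ : ℝ)
        convert! this using 1
        ext z; simp; ring
      have d3 : HasFDerivAt (fun y => m y ^ 3 / 6) ((m y ^ 2 / 2) • m) y := by
        have := (dm.pow 3).mul_const (6⁻¹ : ℝ)
        convert! this using 1
        ext z; simp; ring
      have dG := ((p.hasFDerivAt (x := y)).sub (dm.mul dg)).add (d2.mul dk) |>.sub (d3.mul dkk)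
      have e1 : m (v t • e + w t • Z y) = w t := by simp [h.m_e, h.m_Z y hyr]
      have e2 : p (v t • e + w t • Z y) = w t * g y := by simp [h.p_e, hg]
      have e3 : ∀ F : E → ℝ, fderiv ℝ F y (v t • e + w t • Z y)
          = v t * dirDeriv (fun _ => e) F y + w t * dirDeriv Z F y := by
        intro F; simp [dirDeriv]
      have dG' : fderiv ℝ G y = _ := dG.fderiv
      rw [dG']
      simp only [_root_.sub_apply, _root_.add_apply, _root_.smul_apply, smul_eq_mul, e1, e2, e3]
      rw [slope]
      ring
    rw [hd]
    have hsplit : -(v t * m y * slope e Z p y) + v t * m y ^ 2 / 2 * dirDeriv (fun _ => e) k y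
          - m y ^ 3 / 6 * (v t * dirDeriv (fun _ => e) kk y + w t * dirDeriv Z kk y)
          - κ / 2 * (v t * m y ^ 2)
        = -(v t * m y * (slope e Z p y - fderiv ℝ (slope e Z p) 0 (Z 0) * m y))
          + v t * m y ^ 2 / 2 * (dirDeriv (fun _ => e) k y - dirDeriv (fun _ => e) k 0)
          + -(m y ^ 3 / 6 * (v t * dirDeriv (fun _ => e) kk y + w t * dirDeriv Z kk y)) := by
      rw [hκ, curvature]; ring
    rw [hsplit]
    have c1 : |-(v t * m y * (slope e Z p y - fderiv ℝ (slope e Z p) 0 (Z 0) * m y))|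
        ≤ 1 * |m y| * (C₂ * (I + ρ * |m y|)) := by
      rw [abs_neg, abs_mul, abs_mul]; gcongr
    have c2 : |v t * m y ^ 2 / 2 * (dirDeriv (fun _ => e) k y - dirDeriv (fun _ => e) k 0)|
        ≤ 1 * |m y| ^ 2 / 2 * (C₃ * ρ) := by
      rw [abs_mul, abs_div, abs_mul, abs_pow, abs_two]; gcongr
    have c3 : |-(m y ^ 3 / 6 * (v t * dirDeriv (fun _ => e) kk y + w t * dirDeriv Z kk y))|
        ≤ |m y| ^ 2 * (‖m‖ * ρ) / 6 * (1 * C₄ + 2 * C₅) := by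
      rw [abs_neg, abs_mul, abs_div, abs_pow, pow_succ |m y| 2]
      have : |(6 : ℝ)| = 6 := by norm_num
      rw [this]
      gcongr
      refine (abs_add_le _ _).trans ?_
      rw [abs_mul, abs_mul]
      gcongr
    refine (abs_add_le _ _).trans ((add_le_add_left (abs_add_le _ _) _).trans ?_)
    have hR : C * (I * |m y| + ρ * m y ^ 2) = C * (I * |m y| + ρ * |m y| ^ 2) := by rw [sq_abs]
    rw [hR, hC]
    have f1 : 0 ≤ |m y| := abs_nonneg _
    have g1 : 0 ≤ C₃ * (I * |m y|) := by positivity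
    have g2 : 0 ≤ ‖m‖ * (C₄ + 2 * C₅) * (I * |m y|) := by positivity
    have g3 : 0 ≤ C₃ * (ρ * |m y| ^ 2) := by positivity
    have g4 : 0 ≤ ‖m‖ * (C₄ + 2 * C₅) * (ρ * |m y| ^ 2) := by positivity
    linarith
  have hφ : IntervalIntegrable (fun t => C * (I * |m (x t)| + ρ * m (x t) ^ 2)) volume 0 S :=
    ((hIm.const_mul I).add (hJm.const_mul ρ)).const_mul C
  have hvm' := hvm.const_mul (κ / 2)
  have up := hx.sub_le_integral hS' hG (hvm'.add hφ)
    (fun t ht => by have := (abs_le.1 (hmain t ht)).2; linarith)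
  have lo := hx.sub_le_integral hS' hG.neg (hφ.sub hvm') (fun t ht => by
    have := (abs_le.1 (hmain t ht)).1
    rw [fderiv_fun_neg, _root_.neg_apply]
    linarith)
  have hint : ∫ t in (0 : ℝ)..S, C * (I * |m (x t)| + ρ * m (x t) ^ 2)
      = C * (I ^ 2 + ρ * J) := by
    rw [intervalIntegral.integral_const_mul,
      intervalIntegral.integral_add (hIm.const_mul I) (hJm.const_mul ρ),
      intervalIntegral.integral_const_mul, intervalIntegral.integral_const_mul, ← hI, ← hJ, sq]
  rw [intervalIntegral.integral_add hvm' hφ, intervalIntegral.integral_const_mul, hint, hG0,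
    hGS] at up
  rw [intervalIntegral.integral_sub hφ hvm', hint, intervalIntegral.integral_const_mul, hG0,
    hGS] at lo
  have hCS : I ^ 2 ≤ S * J := sq_integral_abs_le hS (m.continuous.comp_continuousOn hx.continuousOn)
  have hfin : C * (I ^ 2 + ρ * J) ≤ C * (ρ + S) * J := by
    rw [mul_assoc]
    gcongr
    linarith
  rw [abs_le]
  constructor <;> linarith

end IsNormalForm

end NormalForm

/-- First exit time: before the first time at distance `R` the curve is confined, so at that time
its distance is at most `B * S < R`, a contradiction. -/
lemma norm_sub_le_mul_of_confined {E : Type*} [NormedAddCommGroup E] {x : ℝ → E} {S R B : ℝ}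
    (hx : ContinuousOn x (Icc 0 S)) (hB : 0 ≤ B) (hR : B * S < R)
    (H : ∀ t ∈ Icc 0 S, (∀ s ∈ Ico 0 t, ‖x s - x 0‖ ≤ R) → ‖x t - x 0‖ ≤ B * t) :
    ∀ t ∈ Icc 0 S, ‖x t - x 0‖ ≤ B * t := by
  have hlt : ∀ t ∈ Icc 0 S, ‖x t - x 0‖ < R := by
    by_contra! hne
    have hcl : IsCompact (Icc 0 S ∩ (fun t => ‖x t - x 0‖) ⁻¹' Ici R) :=
      isCompact_Icc.of_isClosed_subset
        ((hx.sub continuousOn_const).norm.preimage_isClosed_of_isClosed isClosed_Icc isClosed_Ici)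
        inter_subset_left
    obtain ⟨t, ⟨ht, htR⟩, hmin⟩ := hcl.exists_isLeast hne
    have h1 := H t ht fun s hs => by
      by_contra! hs'
      exact absurd (hmin ⟨⟨hs.1, hs.2.le.trans ht.2⟩, hs'.le⟩) (not_le.2 hs.2)
    have h2 : B * t ≤ B * S := by gcongr; exact ht.2
    change R ≤ ‖x t - x 0‖ at htR
    linarith
  exact fun t ht => H t ht fun s hs => (hlt s ⟨hs.1, hs.2.le.trans ht.2⟩).le

/-! ### Forward curves cannot gain time; backward loops reach `p < 0`. -/

section NormalForm

variable {E : Type*} [NormedAddCommGroup E] [NormedSpace ℝ E]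
  {e : E} {Z : E → E} {ℓ m p : E →L[ℝ] ℝ} {r t₁ : ℝ}

namespace IsFlatCurve

variable {S : ℝ} {v w : ℝ → ℝ} {x : ℝ → E} [FiniteDimensional ℝ E]

lemma apply_sub_le_integral (hx : IsFlatCurve e Z S v w x) (h : IsNormalForm e Z ℓ m p r t₁)
    (hxr : ∀ t ∈ Icc 0 S, ‖x t‖ ≤ r) {s : ℝ} (hs : s ∈ Icc 0 S) {φ : ℝ → ℝ}
    (hφ : IntervalIntegrable φ volume 0 s) (hw : ∀ t ∈ Icc 0 S, |w t| ≤ φ t) :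
    |m (x s) - m (x 0)| ≤ ∫ t in (0 : ℝ)..s, φ t := by
  have hd : ∀ t ∈ Ioo 0 S, m (v t • e + w t • Z (x t)) = w t := fun t ht => by
    simp [h.m_e, h.m_Z _ (hxr t (Ioo_subset_Icc_self ht))]
  have up := hx.sub_le_integral hs m.contDiff hφ fun t ht => by
    rw [m.fderiv, hd t ht]
    exact (le_abs_self _).trans (hw t (Ioo_subset_Icc_self ht))
  have lo := hx.sub_le_integral hs (-m).contDiff hφ fun t ht => by
    rw [(-m).fderiv, _root_.neg_apply, hd t ht]
    exact (neg_le_abs _).trans (hw t (Ioo_subset_Icc_self ht))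
  rw [_root_.neg_apply, _root_.neg_apply] at lo
  rw [abs_le]
  constructor <;> linarith

end IsFlatCurve

namespace IsNormalForm

variable [FiniteDimensional ℝ E]

/-- Along curves which return to the hyperplane `m = 0`, with endpoint in `p ≤ 0`, time cannot be
shorter than the coordinate `ℓ`. -/
theorem exists_apply_le_time (h : IsNormalForm e Z ℓ m p r t₁) (hκ : 0 < curvature e Z p) {A : ℝ}
    (hA : 0 < A) :
    ∃ S₀ > 0, ∀ S v w x, 0 ≤ S → S ≤ S₀ → IsFlatCurve e Z S v w x →
      (∀ t ∈ Icc 0 S, ‖x t‖ ≤ A * S) → x 0 = 0 → (∀ t ∈ Icc 0 S, w t ^ 2 ≤ 8 * (1 - v t)) →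
      m (x S) = 0 → p (x S) ≤ 0 → ℓ (x S) ≤ S := by
  obtain ⟨C₂, hC₂, H2⟩ := h.exists_longitudinal_le
  obtain ⟨L, hL, HL⟩ := exists_norm_sub_le_of_contDiff (F := fun x => ℓ (Z x))
    (ℓ.contDiff.comp (h.contDiff.of_le (by norm_num))) r
  obtain ⟨C, hC, H⟩ := h.exists_expansion (C₀ := 2 * C₂ + L) (by positivity)
  set κ := curvature e Z p with hκd
  -- The first term is the cost of replacing `∫ v m²` by `∫ m²`, the second is the error of the
  -- expansion with `ρ = A * S`. The condition `S ≤ κ / (4 * Q)` leaves half of the main coefficient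
  -- `κ / 2`.
  set Q := 4 * κ * C₂ ^ 2 + C * (A + 1) with hQ
  have hQ0 : 0 < Q := by positivity
  have hr := h.r_pos
  have ht := h.t_pos
  refine ⟨min (min 1 (κ / (4 * Q))) (min (r / A) (t₁ / ((‖ℓ‖ + 1) * A))), by positivity,
    fun S v w x hS hSS hx hxA hx0 hw hmS hpS => ?_⟩
  by_contra! hlt
  rw [le_min_iff, le_min_iff, le_min_iff] at hSS
  obtain ⟨⟨hS1, hSQ⟩, hSr, hSt⟩ := hSS
  rw [le_div_iff₀ (by positivity)] at hSQ hSr hSt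
  have hρr : A * S ≤ r := by linarith
  have hρt : ‖ℓ‖ * (A * S) ≤ t₁ := by
    have : 0 ≤ S * A := by positivity
    linarith
  have hxr : ∀ t ∈ Icc 0 S, ‖x t‖ ≤ r := fun t ht => (hxA t ht).trans hρr
  have hm0 : m (x 0) = 0 := by rw [hx0, map_zero]
  have hS' : S ∈ Icc 0 S := ⟨hS, le_rfl⟩
  have hv : IntervalIntegrable v volume 0 S := by
    simpa using hx.intervalIntegrable_mul hS' (F := fun _ => 1) continuous_const
  have hv1 : IntervalIntegrable (fun t => 1 - v t) volume 0 S := intervalIntegrable_const.sub hv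
  have hv0 : ∀ t ∈ Icc 0 S, 0 ≤ 1 - v t := fun t ht => by
    have := (abs_le.1 (hx.v_le t ht)).2; linarith
  have hJm : IntervalIntegrable (fun t => m (x t) ^ 2) volume 0 S :=
    hx.intervalIntegrable hS' (F := fun y => m y ^ 2) (by fun_prop)
  have hvm : IntervalIntegrable (fun t => v t * m (x t) ^ 2) volume 0 S :=
    hx.intervalIntegrable_mul hS' (F := fun y => m y ^ 2) (by fun_prop)
  set I := ∫ t in (0 : ℝ)..S, |m (x t)| with hI
  set J := ∫ t in (0 : ℝ)..S, m (x t) ^ 2 with hJ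
  set D := ∫ t in (0 : ℝ)..S, (1 - v t) with hD
  have hI0 : 0 ≤ I := intervalIntegral.integral_nonneg hS fun t _ => abs_nonneg _
  have hJ0 : 0 ≤ J := intervalIntegral.integral_nonneg hS fun t _ => by positivity
  have hD0 : 0 ≤ D := intervalIntegral.integral_nonneg hS fun t ht => hv0 t ht
  have hIm : IntervalIntegrable (fun t => |m (x t)|) volume 0 S :=
    hx.intervalIntegrable hS' (F := fun y => |m y|) (by fun_prop)
  have hIs : ∀ s ∈ Icc 0 S, ∫ t in (0 : ℝ)..s, |m (x t)| ≤ I := fun s hs =>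
    intervalIntegral.integral_mono_interval le_rfl hs.1 hs.2
      (Filter.Eventually.of_forall fun t => abs_nonneg _) hIm
  have hsub : ∀ s ∈ Icc 0 S, IntervalIntegrable (fun t => 1 - v t) volume 0 s := fun s hs =>
    hv1.mono_set (by rw [uIcc_of_le hs.1, uIcc_of_le hS]; exact Icc_subset_Icc_right hs.2)
  have hDs : ∀ s ∈ Icc 0 S, ∫ t in (0 : ℝ)..s, (1 - v t) ≤ D := fun s hs => by
    refine intervalIntegral.integral_mono_interval le_rfl hs.1 hs.2 ?_ hv1
    rw [Filter.EventuallyLE, ae_restrict_iff' measurableSet_Ioc]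
    exact Filter.Eventually.of_forall fun t ht => hv0 t (Ioc_subset_Icc_self ht)
  have hvs : ∀ s ∈ Icc 0 S, ∫ t in (0 : ℝ)..s, v t = s - ∫ t in (0 : ℝ)..s, (1 - v t) := by
    intro s hs
    have h1 := intervalIntegral.integral_sub (intervalIntegrable_const (c := (1 : ℝ))) (hsub s hs)
    simpa using h1
  -- A gain of time would force the total deficit `D` of forward speed to be controlled by `∫ |m|`.
  have hDI : D ≤ C₂ * I - (ℓ (x S) - S) := by
    have h1 := (abs_le.1 (H2 S v w x hx hxr hm0 S hS')).2
    rw [hvs S hS', hmS, hx0, map_zero] at h1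
    linarith
  have hDI' : D ≤ C₂ * I := by linarith
  have hℓ : ∀ s ∈ Icc 0 S, -((2 * C₂ + L) * (I + A * S * |m (x s)|)) ≤ ℓ (x s) := by
    intro s hs
    have h1 := (abs_le.1 (H2 S v w x hx hxr hm0 s hs)).1
    rw [hvs s hs, hx0, map_zero] at h1
    have h2 : C₂ * ∫ t in (0 : ℝ)..s, |m (x t)| ≤ C₂ * I := by gcongr; exact hIs s hs
    have h3 := hDs s hs
    have h4 : |m (x s) * ℓ (Z (x s))| ≤ |m (x s)| * (L * (A * S)) := by
      have := HL (x s) 0 (hxr s hs) (by rw [norm_zero]; exact hr.le)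
      rw [h.ℓ_Z, sub_zero, sub_zero, Real.norm_eq_abs] at this
      rw [abs_mul]
      gcongr
      exact this.trans (by gcongr; exact hxA s hs)
    have h5 := (abs_le.1 h4).1
    have h6 : 0 ≤ A * S * |m (x s)| := by positivity
    have h7 : 0 ≤ C₂ * (A * S * |m (x s)|) := by positivity
    have h8 : 0 ≤ L * I := by positivity
    linarith [hs.1]
  have hM : ∀ s ∈ Icc 0 S, m (x s) ^ 2 ≤ 8 * S * D := by
    intro s hs
    rcases (abs_nonneg (m (x s))).eq_or_lt with h0 | hpos
    · rw [abs_eq_zero.1 h0.symm, zero_pow two_ne_zero]; positivity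
    have hSpos : 0 < S := by
      refine hS.lt_of_ne fun h0 => ?_
      have : s = 0 := le_antisymm (hs.2.trans h0.ge) hs.1
      rw [this, hm0, abs_zero] at hpos
      exact lt_irrefl _ hpos
    -- From `2 η |w| ≤ w² + η² ≤ 8 (1 - v) + η²`, the control is dominated by an integrable
    -- function. This choice of `η` gives the bound that Cauchy–Schwarz would give for `∫ |w|`,
    -- although `w` need not be measurable.
    set η := |m (x s)| / S with hη
    have hη0 : 0 < η := by positivity
    have h1 := hx.apply_sub_le_integral h hxr hs (φ := fun t => 4 / η * (1 - v t) + η / 2)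
      (((hsub s hs).const_mul _).add intervalIntegrable_const) (fun t ht => by
        have h2 := hw t ht
        have h3 : 4 / η * (1 - v t) + η / 2 = (8 * (1 - v t) + η ^ 2) / (2 * η) := by
          field_simp; ring
        rw [h3, le_div_iff₀ (by positivity)]
        nlinarith [sq_nonneg (|w t| - η), sq_abs (w t)])
    rw [hm0, sub_zero, intervalIntegral.integral_add ((hsub s hs).const_mul _)
      intervalIntegrable_const, intervalIntegral.integral_const_mul,
      intervalIntegral.integral_const, sub_zero, smul_eq_mul] at h1
    have h2 : |m (x s)| ≤ 4 / η * D + S * (η / 2) := by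
      refine h1.trans ?_
      gcongr
      · exact hDs s hs
      · exact hs.2
    have h3 : 4 / η * D + S * (η / 2) = 4 * S * D / |m (x s)| + |m (x s)| / 2 := by
      rw [hη]; field_simp
    rw [h3] at h2
    have h4 : |m (x s)| / 2 ≤ 4 * S * D / |m (x s)| := by linarith
    rw [le_div_iff₀ hpos] at h4
    rw [← sq_abs]
    linarith
  have hCS : I ^ 2 ≤ S * J :=
    sq_integral_abs_le hS (m.continuous.comp_continuousOn hx.continuousOn)
  have hVM : J - 8 * C₂ ^ 2 * S * J ≤ ∫ t in (0 : ℝ)..S, v t * m (x t) ^ 2 := by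
    have h1 : ∫ t in (0 : ℝ)..S, (m (x t) ^ 2 - v t * m (x t) ^ 2)
        ≤ ∫ t in (0 : ℝ)..S, (8 * S * D) * (1 - v t) := by
      refine intervalIntegral.integral_mono_on hS (hJm.sub hvm) (hv1.const_mul _) fun t ht => ?_
      have h1 := hM t ht
      have h2 := hv0 t ht
      have h3 : m (x t) ^ 2 - v t * m (x t) ^ 2 = m (x t) ^ 2 * (1 - v t) := by ring
      rw [h3]
      gcongr
    rw [intervalIntegral.integral_sub hJm hvm, intervalIntegral.integral_const_mul, ← hJ,
      ← hD] at h1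
    have h2 : D * D ≤ (C₂ * I) * (C₂ * I) := by gcongr
    have h3 : 8 * S * D * D ≤ 8 * C₂ ^ 2 * S * J := by
      calc 8 * S * D * D = 8 * S * (D * D) := by ring
        _ ≤ 8 * S * ((C₂ * I) * (C₂ * I)) := by gcongr
        _ = 8 * C₂ ^ 2 * S * I ^ 2 := by ring
        _ ≤ 8 * C₂ ^ 2 * S * (S * J) := by gcongr
        _ ≤ 8 * C₂ ^ 2 * S * (1 * J) := by gcongr
        _ = _ := by ring
    linarith
  have hexp := (abs_le.1 (H (A * S) S v w x hS hx hρr hρt hxA (by rw [hx0, map_zero]) hm0 hmS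
    hℓ)).1
  -- The endpoint has `p ≤ 0` while the expansion gives at least `κ/4 · J`. Once `J`, hence `I`,
  -- vanishes, `hDI` says that `D` is negative, a contradiction.
  have hJz : J = 0 := by
    have h1 : κ / 2 * (J - 8 * C₂ ^ 2 * S * J)
        ≤ κ / 2 * ∫ t in (0 : ℝ)..S, v t * m (x t) ^ 2 := by gcongr
    have h2 : κ / 2 * (J - 8 * C₂ ^ 2 * S * J) - C * (A * S + S) * J
        = (κ / 2 - Q * S) * J := by rw [hQ]; ring
    have h3 : κ / 4 * J ≤ (κ / 2 - Q * S) * J := by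
      gcongr
      linarith
    have h4 : κ / 4 * J ≤ 0 := by linarith
    have h5 : 0 < κ / 4 := by positivity
    nlinarith
  have hIz : I = 0 := by
    rw [hJz, mul_zero] at hCS
    exact pow_eq_zero_iff (two_ne_zero) |>.1 (le_antisymm hCS (by positivity))
  rw [hIz] at hDI
  linarith

/-- Existence of the curve which follows `-e / 2` while the control of `Z` describes a loop. -/
lemma exists_backward_curve (h : IsNormalForm e Z ℓ m p r t₁) (x₀ : E) :
    ∃ B > 0, ∃ ε > 0, ∀ θ, 0 < θ → θ < ε → ∃ x : ℝ → E, x 0 = x₀ ∧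
      (∀ s ∈ Icc 0 θ, HasDerivAt x ((-1 / 2 : ℝ) • e + (θ - 2 * s) • Z (x s)) s) ∧
      ∀ s ∈ Icc 0 θ, ‖x s - x₀‖ ≤ B * s := by
  -- Time and `θ` are made state variables, so that a single existence interval serves all small
  -- `θ`.
  let f : E × ℝ × ℝ → E × ℝ × ℝ := fun q =>
    ((-1 / 2 : ℝ) • e + (q.2.2 - 2 * q.2.1) • Z q.1, 1, 0)
  have hZ : ContDiff ℝ 1 Z := h.contDiff.of_le (by norm_num)
  have hf : ContDiff ℝ 1 f := by fun_prop
  obtain ⟨r', hr', ε, hε, Hf⟩ :=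
    (hf.contDiffAt (x := (x₀, 0, 0))).exists_forall_mem_closedBall_exists_eq_forall_mem_Ioo_hasDerivAt 0
  obtain ⟨C, hC, HC⟩ := exists_norm_le_of_continuous h.contDiff.continuous (‖x₀‖ + 1)
  refine ⟨‖e‖ + C, by positivity, min (min r' ε) (min 1 (1 / (‖e‖ + C))), by positivity,
    fun θ hθ hθ' => ?_⟩
  rw [lt_min_iff, lt_min_iff, lt_min_iff, lt_div_iff₀ (by positivity)] at hθ'
  obtain ⟨⟨hθr, hθε⟩, hθ1, hθC⟩ := hθ'
  obtain ⟨α, hα0, hα⟩ := Hf (x₀, 0, θ) (by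
    rw [mem_closedBall_iff_norm, Prod.norm_def, Prod.norm_def]
    simp [hr'.le, abs_of_pos hθ, hθr.le])
  rw [zero_sub, zero_add] at hα
  have hmem : ∀ s ∈ Icc 0 θ, s ∈ Ioo (-ε) ε := fun s hs => ⟨by linarith [hs.1], by linarith [hs.2]⟩
  have hα₁ : ∀ s ∈ Icc 0 θ, HasDerivAt (fun s => (α s).1) (f (α s)).1 s := fun s hs =>
    (ContinuousLinearMap.fst ℝ E (ℝ × ℝ)).hasFDerivAt.comp_hasDerivAt s (hα s (hmem s hs))
  have hα₂ : ∀ s ∈ Icc 0 θ, HasDerivAt (fun s => (α s).2.1) 1 s := fun s hs =>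
    ((ContinuousLinearMap.fst ℝ ℝ ℝ).comp
      (ContinuousLinearMap.snd ℝ E (ℝ × ℝ))).hasFDerivAt.comp_hasDerivAt s (hα s (hmem s hs))
  have hα₃ : ∀ s ∈ Icc 0 θ, HasDerivAt (fun s => (α s).2.2) 0 s := fun s hs =>
    ((ContinuousLinearMap.snd ℝ ℝ ℝ).comp
      (ContinuousLinearMap.snd ℝ E (ℝ × ℝ))).hasFDerivAt.comp_hasDerivAt s (hα s (hmem s hs))
  have hσ : ∀ s ∈ Icc 0 θ, (α s).2.1 = s := by
    intro s hs
    have hd : ∀ t ∈ Ico 0 θ, HasDerivWithinAt (fun t => (α t).2.1 - t) 0 (Ici t) t := fun t ht => by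
      have := (hα₂ t (Ico_subset_Icc_self ht)).sub (hasDerivAt_id t)
      rw [sub_self] at this
      exact this.hasDerivWithinAt
    have hc : ContinuousOn (fun t => (α t).2.1 - t) (Icc 0 θ) := fun t ht =>
      ((hα₂ t ht).continuousAt.sub continuousAt_id).continuousWithinAt
    have := constant_of_has_deriv_right_zero hc hd s hs
    simp only [hα0, sub_zero] at this
    linarith
  have hη : ∀ s ∈ Icc 0 θ, (α s).2.2 = θ := by
    intro s hs
    have hd : ∀ t ∈ Ico 0 θ, HasDerivWithinAt (fun t => (α t).2.2) 0 (Ici t) t := fun t ht =>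
      (hα₃ t (Ico_subset_Icc_self ht)).hasDerivWithinAt
    have hc : ContinuousOn (fun t => (α t).2.2) (Icc 0 θ) := fun t ht =>
      (hα₃ t ht).continuousAt.continuousWithinAt
    have := constant_of_has_deriv_right_zero hc hd s hs
    simpa only [hα0] using this
  have hx : ∀ s ∈ Icc 0 θ, HasDerivAt (fun s => (α s).1)
      ((-1 / 2 : ℝ) • e + (θ - 2 * s) • Z (α s).1) s := by
    intro s hs
    have := hα₁ s hs
    simpa only [f, hσ s hs, hη s hs] using this
  have hx0 : (α 0).1 = x₀ := by rw [hα0]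
  refine ⟨fun s => (α s).1, hx0, hx, ?_⟩
  have hcont : ContinuousOn (fun s => (α s).1) (Icc 0 θ) := fun s hs =>
    (hx s hs).continuousAt.continuousWithinAt
  have key := norm_sub_le_mul_of_confined hcont (by positivity : 0 ≤ ‖e‖ + C) (R := 1)
    (by linarith) (fun t ht hts => by
      have hbound : ∀ s ∈ Ico 0 t, ‖(-1 / 2 : ℝ) • e + (θ - 2 * s) • Z (α s).1‖ ≤ ‖e‖ + C := by
        intro s hs
        have h1 := hts s hs
        rw [hx0] at h1
        have h2 : ‖(α s).1‖ ≤ ‖x₀‖ + 1 := by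
          have := norm_add_le ((α s).1 - x₀) x₀
          rw [sub_add_cancel] at this
          linarith
        have h3 : |θ - 2 * s| ≤ 1 := by
          rw [abs_le]; constructor <;> linarith [hs.1, hs.2, ht.2]
        refine (norm_add_le _ _).trans ?_
        rw [norm_smul, norm_smul, Real.norm_eq_abs, Real.norm_eq_abs]
        refine add_le_add (mul_le_of_le_one_left (norm_nonneg _) (by norm_num [abs_of_neg]))
          ((mul_le_of_le_one_left (norm_nonneg _) h3).trans (HC _ h2))
      have := norm_image_sub_le_of_norm_deriv_right_le_segment
        (hcont.mono (Icc_subset_Icc_right ht.2))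
        (fun s hs => (hx s ⟨hs.1, hs.2.le.trans ht.2⟩).hasDerivWithinAt) hbound t ⟨ht.1, le_rfl⟩
      simpa using this)
  rwa [hx0] at key

/-- Moving backwards along the abnormal line while the control of `Z` describes a loop leads into
the half space `p < 0`. -/
theorem exists_backward_loop (h : IsNormalForm e Z ℓ m p r t₁) (hκ : 0 < curvature e Z p) :
    ∃ ρ > 0, ∀ t₀ > 0, t₀ * ‖e‖ < ρ → ∃ B > 0, ∃ ε > 0, ∀ θ, 0 < θ → θ < ε →
      ∃ x : ℝ → E, x 0 = t₀ • e ∧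
      (∀ s ∈ Icc 0 θ, HasDerivAt x ((-1 / 2 : ℝ) • e + (θ - 2 * s) • Z (x s)) s) ∧
      (∀ s ∈ Icc 0 θ, ‖x s - t₀ • e‖ ≤ B * s) ∧ m (x θ) = 0 ∧ p (x θ) < 0 ∧
      ‖transverse e ℓ (x θ)‖ ^ 2 ≤ B * θ * |p (x θ)| := by
  obtain ⟨C₁, hC₁, H1⟩ := h.exists_transverse_le
  obtain ⟨C, hC, H⟩ := h.exists_expansion (C₀ := 1) one_pos
  set κ := curvature e Z p with hκd
  have hr := h.r_pos
  have ht := h.t_pos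
  -- With `v = -1/2` the main term is `-κ/4 · J`. Since `θ < ρ`, each half of the error `C (ρ + θ)
  -- J` is at most `κ/16 · J`, which leaves `-κ/8 · J`.
  set ρ := min (min r (t₁ / (‖ℓ‖ + 1))) (κ / (16 * C)) with hρ
  have hρ0 : 0 < ρ := by positivity
  have hρr : ρ ≤ r := (min_le_left _ _).trans (min_le_left _ _)
  have hρt : ‖ℓ‖ * ρ ≤ t₁ := by
    have : ρ ≤ t₁ / (‖ℓ‖ + 1) := (min_le_left _ _).trans (min_le_right _ _)
    rw [le_div_iff₀ (by positivity)] at this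
    linarith
  have hρC : C * ρ ≤ κ / 16 := by
    have : ρ ≤ κ / (16 * C) := min_le_right _ _
    rw [le_div_iff₀ (by positivity)] at this
    linarith
  refine ⟨ρ, hρ0, fun t₀ ht₀ ht₀ρ => ?_⟩
  obtain ⟨B, hB, ε, hε, HB⟩ := h.exists_backward_curve (t₀ • e)
  refine ⟨max B (C₁ ^ 2 * (8 / κ)), by positivity,
    min (min ε 1) (min (min ρ ((ρ - t₀ * ‖e‖) / B)) (t₀ / ((‖ℓ‖ + 1) * B))),
    by have : 0 < ρ - t₀ * ‖e‖ := by linarith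
       positivity, fun θ hθ hθ' => ?_⟩
  rw [lt_min_iff, lt_min_iff, lt_min_iff, lt_min_iff, lt_div_iff₀ hB,
    lt_div_iff₀ (by positivity)] at hθ'
  obtain ⟨⟨hθε, hθ1⟩, ⟨hθρ, hθB⟩, hθℓ⟩ := hθ'
  obtain ⟨x, hx0, hxd, hxB⟩ := HB θ hθ hθε
  have hxc : ContinuousOn x (Icc 0 θ) := fun s hs => (hxd s hs).continuousAt.continuousWithinAt
  have hθ' : θ ∈ Icc 0 θ := ⟨hθ.le, le_rfl⟩
  have hBs : ∀ s ∈ Icc 0 θ, B * s ≤ B * θ := fun s hs => by gcongr; exact hs.2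
  have hxρ : ∀ s ∈ Icc 0 θ, ‖x s‖ ≤ ρ := fun s hs => by
    have h1 := norm_add_le (x s - t₀ • e) (t₀ • e)
    rw [sub_add_cancel, norm_smul, Real.norm_eq_abs, abs_of_pos ht₀] at h1
    have h2 := hxB s hs
    have h3 := hBs s hs
    linarith
  have hxr : ∀ s ∈ Icc 0 θ, ‖x s‖ ≤ r := fun s hs => (hxρ s hs).trans hρr
  have hflat : IsFlatCurve e Z θ (fun _ => -1 / 2) (fun s => θ - 2 * s) x := by
    refine ⟨?_, Filter.Eventually.of_forall fun t ht => hxd t (Ioo_subset_Icc_self ht),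
      measurable_const, fun t _ => by norm_num [abs_of_neg], fun t ht => ?_⟩
    · have hc : ContinuousOn (fun s => (-1 / 2 : ℝ) • e + (θ - 2 * s) • Z (x s)) (Icc 0 θ) := by
        refine continuousOn_const.add (ContinuousOn.smul (by fun_prop) ?_)
        exact h.contDiff.continuous.comp_continuousOn hxc
      obtain ⟨K, hK⟩ := isCompact_Icc.exists_bound_of_continuousOn hc
      have hK0 : 0 ≤ K := (norm_nonneg _).trans (hK 0 ⟨le_rfl, hθ.le⟩)
      refine ⟨⟨K, hK0⟩, (convex_Icc 0 θ).lipschitzOnWith_of_nnnorm_hasDerivWithin_le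
        (fun s hs => (hxd s hs).hasDerivWithinAt) fun s hs => ?_⟩
      exact hK s hs
    · rw [abs_le]; constructor <;> linarith [ht.1, ht.2]
  have hm0 : m (x 0) = 0 := by rw [hx0, map_smul, h.m_e, smul_zero]
  have hm : ∀ s ∈ Icc 0 θ, m (x s) = s * (θ - s) := by
    intro s hs
    have hd : ∀ t ∈ Ico 0 θ,
        HasDerivWithinAt (fun t => m (x t) - t * (θ - t)) 0 (Ici t) t := fun t ht => by
      have ht' := Ico_subset_Icc_self ht
      have h1 := HasFDerivAt.comp_hasDerivAt t m.hasFDerivAt (hxd t ht')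
      have h2 := (hasDerivAt_id t).mul ((hasDerivAt_id t).const_sub θ)
      have h3 := h1.sub h2
      have h4 : m ((-1 / 2 : ℝ) • e + (θ - 2 * t) • Z (x t)) - (1 * (θ - id t) + id t * -1) = 0 := by
        simp [h.m_e, h.m_Z _ (hxr t ht')]
        ring
      rw [h4] at h3
      exact h3.hasDerivWithinAt
    have hc : ContinuousOn (fun t => m (x t) - t * (θ - t)) (Icc 0 θ) := by
      have := m.continuous.comp_continuousOn hxc
      fun_prop
    have := constant_of_has_deriv_right_zero hc hd s hs
    simp only [hm0, zero_mul, sub_zero] at this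
    linarith
  have hmθ : m (x θ) = 0 := by rw [hm θ hθ']; ring
  have hz0 : transverse e ℓ (x 0) = 0 := by
    rw [hx0, map_smul, transverse_apply, h.ℓ_e, one_smul, sub_self, smul_zero]
  set I := ∫ t in (0 : ℝ)..θ, |m (x t)| with hI
  set J := ∫ t in (0 : ℝ)..θ, m (x t) ^ 2 with hJ
  have hI0 : 0 ≤ I := intervalIntegral.integral_nonneg hθ.le fun t _ => abs_nonneg _
  have hJ0 : 0 < J := by
    have hcm : ContinuousOn (fun t => m (x t) ^ 2) (Icc 0 θ) :=
      (m.continuous.comp_continuousOn hxc).pow 2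
    refine intervalIntegral.integral_pos hθ hcm (fun t _ => by positivity)
      ⟨θ / 2, ⟨by linarith, by linarith⟩, ?_⟩
    rw [hm (θ / 2) ⟨by linarith, by linarith⟩]
    have : 0 < θ / 2 * (θ - θ / 2) := by nlinarith
    positivity
  -- The loop starts at `ℓ = t₀ > 0` and `θ` is small compared with `t₀`, so in fact `ℓ` stays
  -- nonnegative.
  have hℓ : ∀ s ∈ Icc 0 θ, -(1 * (I + ρ * |m (x s)|)) ≤ ℓ (x s) := by
    intro s hs
    have h1 : |ℓ (x s - t₀ • e)| ≤ ‖ℓ‖ * (B * θ) := by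
      refine (ℓ.le_opNorm _).trans ?_
      gcongr
      exact (hxB s hs).trans (hBs s hs)
    rw [map_sub, map_smul, h.ℓ_e, smul_eq_mul, mul_one] at h1
    have h2 := (abs_le.1 h1).1
    have h3 : 0 ≤ ρ * |m (x s)| := by positivity
    have h4 : 0 ≤ θ * B := by positivity
    linarith
  have hexp := (abs_le.1 (H ρ θ _ _ x hθ.le hflat hρr hρt hxρ hz0 hm0 hmθ hℓ)).2
  rw [intervalIntegral.integral_const_mul, ← hJ] at hexp
  have hpJ : p (x θ) ≤ -(κ / 8) * J := by
    have h1 : C * (ρ + θ) * J ≤ (κ / 8) * J := by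
      gcongr
      have : C * θ ≤ C * ρ := by gcongr
      linarith
    linarith
  have hp : p (x θ) < 0 := by
    have : 0 < κ / 8 * J := by positivity
    linarith
  refine ⟨x, hx0, hxd, fun s hs => (hxB s hs).trans ?_, hmθ, hp, ?_⟩
  · gcongr
    · exact hs.1
    · exact le_max_left _ _
  · have h1 := H1 θ _ _ x hflat hxr hz0 hm0 θ hθ'
    rw [hmθ, zero_smul, sub_zero] at h1
    have hCS : I ^ 2 ≤ θ * J := sq_integral_abs_le hθ.le (m.continuous.comp_continuousOn hxc)
    have h2 : J ≤ 8 / κ * |p (x θ)| := by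
      rw [abs_of_neg hp, div_mul_eq_mul_div, le_div_iff₀ hκ]
      linarith
    -- Both sides are governed by `J`: the transverse part is at most `C₁ I` with `I² ≤ θ J`, and `J
    -- ≤ (8/κ) |p|`.
    calc ‖transverse e ℓ (x θ)‖ ^ 2 ≤ (C₁ * I) ^ 2 := by gcongr
      _ = C₁ ^ 2 * I ^ 2 := by ring
      _ ≤ C₁ ^ 2 * (θ * J) := by gcongr
      _ ≤ C₁ ^ 2 * (θ * (8 / κ * |p (x θ)|)) := by gcongr
      _ = C₁ ^ 2 * (8 / κ) * θ * |p (x θ)| := by ring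
      _ ≤ _ := by gcongr; exact le_max_right _ _

end IsNormalForm

end NormalForm

/-! ### Concatenation of trajectories and the distance. -/

section Reachable

variable {n : ℕ} {X Y : Space n → Space n}

lemma IsTrajectory.intervalIntegrable (hX : Continuous X) (hY : Continuous Y) {S : ℝ} (hS : 0 ≤ S)
    {v u : ℝ → ℝ} {x : ℝ → Space n} (hv : Measurable v) (hu : Measurable u)
    (hvu : ∀ t ∈ Icc 0 S, v t ^ 2 + u t ^ 2 ≤ 1) (hx : ContinuousOn x (Icc 0 S)) :
    IntervalIntegrable (fun s => v s • X (x s) + u s • Y (x s)) volume 0 S := by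
  have h1 : ∀ {w : ℝ → ℝ} {W : Space n → Space n}, Measurable w → Continuous W →
      (∀ t ∈ Icc 0 S, w t ^ 2 ≤ 1) →
      IntervalIntegrable (fun s => w s • W (x s)) volume 0 S := by
    intro w W hw hW hw1
    have h2 : ContinuousOn (fun s => W (x s)) (Icc 0 S) := hW.comp_continuousOn hx
    rw [← uIcc_of_le hS] at h2
    have h3 := h2.intervalIntegrable (μ := volume)
    rw [intervalIntegrable_iff_integrableOn_Icc_of_le hS] at h3 ⊢
    refine h3.bdd_smul 1 hw.aestronglyMeasurable ?_
    rw [ae_restrict_iff' measurableSet_Icc]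
    refine Filter.Eventually.of_forall fun t ht => ?_
    rw [Real.norm_eq_abs, ← sq_le_one_iff_abs_le_one]
    exact hw1 t ht
  exact (h1 hv hX fun t ht => by nlinarith [hvu t ht, sq_nonneg (u t)]).add
    (h1 hu hY fun t ht => by nlinarith [hvu t ht, sq_nonneg (v t)])

lemma reachable_append (hX : Continuous X) (hY : Continuous Y) {S δ : ℝ} (hS : 0 ≤ S)
    (hδ : 0 ≤ δ) {q : Space n} (hq : q ∈ reachable X Y S) {v u : ℝ → ℝ} {c : ℝ → Space n}
    (hv : ContinuousOn v (Icc 0 δ)) (hu : ContinuousOn u (Icc 0 δ))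
    (hvu : ∀ t ∈ Icc 0 δ, v t ^ 2 + u t ^ 2 ≤ 1) (hc0 : c 0 = q)
    (hc : ∀ t ∈ Icc 0 δ, HasDerivAt c (v t • X (c t) + u t • Y (c t)) t) :
    c δ ∈ reachable X Y (S + δ) := by
  obtain ⟨v₀, u₀, x, hv₀, hu₀, hvu₀, hx, hxq⟩ := hq
  have hcc : ContinuousOn c (Icc 0 δ) := fun t ht => (hc t ht).continuousAt.continuousWithinAt
  -- The controls are only known to be continuous on `[0, δ]`; extending them by zero makes them
  -- measurable on the whole line.
  let v₁ : ℝ → ℝ := (Icc 0 δ).piecewise v 0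
  let u₁ : ℝ → ℝ := (Icc 0 δ).piecewise u 0
  have hv₁ : Measurable v₁ := hv.measurable_piecewise continuousOn_const measurableSet_Icc
  have hu₁ : Measurable u₁ := hu.measurable_piecewise continuousOn_const measurableSet_Icc
  have hv₁e : ∀ t ∈ Icc 0 δ, v₁ t = v t := fun t ht => piecewise_eq_of_mem _ _ _ ht
  have hu₁e : ∀ t ∈ Icc 0 δ, u₁ t = u t := fun t ht => piecewise_eq_of_mem _ _ _ ht
  let V : ℝ → ℝ := fun t => if t ≤ S then v₀ t else v₁ (t - S)
  let U : ℝ → ℝ := fun t => if t ≤ S then u₀ t else u₁ (t - S)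
  let ξ : ℝ → Space n := fun t => if t ≤ S then x t else c (t - S)
  have hξ1 : ∀ t ≤ S, ξ t = x t := fun t ht => if_pos ht
  have hξ2 : ∀ t, S ≤ t → ξ t = c (t - S) := by
    intro t ht
    rcases ht.eq_or_lt with rfl | ht
    · rw [hξ1 _ le_rfl, sub_self, hc0, hxq]
    · exact if_neg (not_le.2 ht)
  have hshift : ∀ t ∈ Icc S (S + δ), t - S ∈ Icc 0 δ := fun t ht =>
    ⟨sub_nonneg.2 ht.1, by linarith [ht.2]⟩
  have hVU : ∀ t ∈ Icc 0 (S + δ), V t ^ 2 + U t ^ 2 ≤ 1 := by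
    intro t ht
    by_cases h : t ≤ S
    · simp only [V, U, if_pos h]
      exact hvu₀ t ⟨ht.1, h⟩
    · have h' := hshift t ⟨(not_le.1 h).le, ht.2⟩
      simp only [V, U, if_neg h]
      rw [hv₁e _ h', hu₁e _ h']
      exact hvu _ h'
  have hξc : ContinuousOn ξ (Icc 0 (S + δ)) := by
    have h1 : ContinuousOn ξ (Icc 0 S) := hx.cont.congr fun t ht => hξ1 t ht.2
    have h2 : ContinuousOn ξ (Icc S (S + δ)) := by
      refine ContinuousOn.congr (f := fun t => c (t - S)) ?_ fun t ht => hξ2 t ht.1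
      exact hcc.comp (by fun_prop) hshift
    have := h1.union_of_isClosed h2 isClosed_Icc isClosed_Icc
    rwa [Icc_union_Icc_eq_Icc hS (by linarith)] at this
  have hint := IsTrajectory.intervalIntegrable hX hY (by positivity : 0 ≤ S + δ)
    (hv₀.ite measurableSet_Iic (hv₁.comp (measurable_id.sub_const S)) : Measurable V)
    (hu₀.ite measurableSet_Iic (hu₁.comp (measurable_id.sub_const S)) : Measurable U) hVU hξc
  have hleft : ∀ t ∈ Icc 0 S,
      ξ t = ∫ s in (0 : ℝ)..t, (V s • X (ξ s) + U s • Y (ξ s)) := by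
    intro t ht
    rw [hξ1 t ht.2, hx.eq t ht]
    refine intervalIntegral.integral_congr fun s hs => ?_
    rw [uIcc_of_le ht.1] at hs
    have hs' : s ≤ S := hs.2.trans ht.2
    simp only [V, U, hξ1 s hs', if_pos hs']
  have hright : ∀ t ∈ Icc S (S + δ),
      ξ t - ξ S = ∫ s in S..t, (V s • X (ξ s) + U s • Y (ξ s)) := by
    intro t ht
    have ht' := hshift t ht
    have h1 : ∫ s in S..t, (V s • X (ξ s) + U s • Y (ξ s))
        = ∫ s in S..t, (v (s - S) • X (c (s - S)) + u (s - S) • Y (c (s - S))) := by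
      refine intervalIntegral.integral_congr_ae (Filter.Eventually.of_forall fun s hs => ?_)
      rw [uIoc_of_le ht.1] at hs
      have hs' : ¬ s ≤ S := not_le.2 hs.1
      have hs'' := hshift s ⟨hs.1.le, hs.2.trans ht.2⟩
      simp only [V, U, hξ2 s hs.1.le, if_neg hs', hv₁e _ hs'', hu₁e _ hs'']
    have hsub : Icc 0 (t - S) ⊆ Icc 0 δ := Icc_subset_Icc_right ht'.2
    have h2 : ContinuousOn (fun s => v s • X (c s) + u s • Y (c s)) (Icc 0 (t - S)) :=
      ((hv.mono hsub).smul (hX.comp_continuousOn (hcc.mono hsub))).add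
        ((hu.mono hsub).smul (hY.comp_continuousOn (hcc.mono hsub)))
    rw [← uIcc_of_le ht'.1] at h2
    rw [h1, intervalIntegral.integral_comp_sub_right
      (fun s => v s • X (c s) + u s • Y (c s)) S, sub_self,
      intervalIntegral.integral_eq_sub_of_hasDerivAt
        (fun s hs => hc s (hsub (by rwa [uIcc_of_le ht'.1] at hs))) h2.intervalIntegrable,
      hξ2 t ht.1, hξ2 S le_rfl, sub_self]
  refine ⟨V, U, ξ, hv₀.ite measurableSet_Iic (hv₁.comp (measurable_id.sub_const S)),
    hu₀.ite measurableSet_Iic (hu₁.comp (measurable_id.sub_const S)), hVU,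
    ⟨hξc, by rw [hξ1 0 hS, hx.init], fun t ht => ?_⟩, ?_⟩
  · rcases le_total t S with h | h
    · exact hleft t ⟨ht.1, h⟩
    · have e1 : ξ t = ξ S + (ξ t - ξ S) := by abel
      rw [e1, hright t ⟨h, ht.2⟩, hleft S ⟨hS, le_rfl⟩]
      refine intervalIntegral.integral_add_adjacent_intervals (hint.mono_set ?_)
        (hint.mono_set ?_)
      · rw [uIcc_of_le hS, uIcc_of_le (by positivity)]
        exact Icc_subset_Icc_right (by linarith)
      · rw [uIcc_of_le h, uIcc_of_le (by positivity)]
        exact Icc_subset_Icc hS ht.2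
  · rw [hξ2 _ (by linarith), add_sub_cancel_left]

lemma srDist_le_of_reachable {S : ℝ} (hS : 0 ≤ S) {q : Space n} (hq : q ∈ reachable X Y S) :
    srDist X Y q ≤ ENNReal.ofReal S :=
  (iInf_le _ S).trans ((iInf_le _ hS).trans (iInf_le _ hq))

lemma srDist_le_add (hX : Continuous X) (hY : Continuous Y) {δ : ℝ} (hδ : 0 ≤ δ) {v u : ℝ → ℝ}
    {c : ℝ → Space n} (hv : ContinuousOn v (Icc 0 δ)) (hu : ContinuousOn u (Icc 0 δ))
    (hvu : ∀ t ∈ Icc 0 δ, v t ^ 2 + u t ^ 2 ≤ 1)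
    (hc : ∀ t ∈ Icc 0 δ, HasDerivAt c (v t • X (c t) + u t • Y (c t)) t) :
    srDist X Y (c δ) ≤ srDist X Y (c 0) + ENNReal.ofReal δ := by
  unfold srDist
  simp only [ENNReal.iInf_add]
  refine le_iInf fun S => le_iInf fun hS => le_iInf fun hq => ?_
  rw [← ENNReal.ofReal_add hS hδ]
  exact srDist_le_of_reachable (by positivity)
    (reachable_append hX hY hS hδ hq hv hu hvu rfl hc)

lemma zero_mem_reachable : (0 : Space n) ∈ reachable X Y 0 := by
  refine ⟨0, 0, 0, measurable_zero, measurable_zero, by simp, ⟨continuousOn_const, rfl, ?_⟩, rfl⟩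
  intro t ht
  rw [Icc_self, mem_singleton_iff] at ht
  simp [ht]

end Reachable

/-! ### The adjoint vector and the cone it annihilates. -/

section Adjoint

variable {E : Type*} [NormedAddCommGroup E] [NormedSpace ℝ E] {X : E → E} {γ : ℝ → E} {τ : ℝ}

/-- Grönwall for the linear adjoint equation. -/
lemma adjoint_eq_zero (hX : ContDiff ℝ 1 X) (hγ : ContinuousOn γ (Icc 0 τ)) {p : ℝ → E →L[ℝ] ℝ}
    (hp : ∀ t ∈ Icc 0 τ,
      HasDerivWithinAt p (-((p t).comp (fderiv ℝ X (γ t)))) (Icc 0 τ) t)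
    (h0 : p 0 = 0) : ∀ t ∈ Icc 0 τ, p t = 0 := by
  obtain ⟨K, hK⟩ := isCompact_Icc.exists_bound_of_continuousOn
    ((hX.continuous_fderiv (by simp)).comp_continuousOn hγ)
  refine eq_zero_of_abs_deriv_le_mul_abs_self_of_eq_zero_right (K := K)
    (fun t ht => (hp t ht).continuousWithinAt)
    (fun t ht => (hp t (Ico_subset_Icc_self ht)).mono_of_mem_nhdsWithin
      (Icc_mem_nhdsGE_of_mem ht)) h0 fun t ht => ?_
  rw [norm_neg, mul_comm]
  refine (ContinuousLinearMap.opNorm_comp_le _ _).trans ?_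
  gcongr
  exact hK t (Ico_subset_Icc_self ht)

/-- By the adjoint equation, the derivative of `p(W(γ))` is `p([X, W](γ))`. -/
lemma adjoint_lieBracket_eq_zero (hτ : 0 < τ) {W : E → E}
    (hW : Differentiable ℝ W)
    (hγ : ∀ t ∈ Icc 0 τ, HasDerivWithinAt γ (X (γ t)) (Icc 0 τ) t) {p : ℝ → E →L[ℝ] ℝ}
    (hp : ∀ t ∈ Icc 0 τ,
      HasDerivWithinAt p (-((p t).comp (fderiv ℝ X (γ t)))) (Icc 0 τ) t)
    (h0 : ∀ t ∈ Icc 0 τ, p t (W (γ t)) = 0) :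
    ∀ t ∈ Icc 0 τ, p t (VectorField.lieBracket ℝ X W (γ t)) = 0 := by
  intro t ht
  have h1 : HasDerivWithinAt (fun s => p s (W (γ s)))
      (-((p t).comp (fderiv ℝ X (γ t))) (W (γ t)) + p t (fderiv ℝ W (γ t) (X (γ t))))
      (Icc 0 τ) t :=
    (hp t ht).clm_apply ((hW (γ t)).hasFDerivAt.comp_hasDerivWithinAt t (hγ t ht))
  have h2 : HasDerivWithinAt (fun s => p s (W (γ s))) 0 (Icc 0 τ) t :=
    (hasDerivWithinAt_const t (Icc 0 τ) (0 : ℝ)).congr h0 (h0 t ht)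
  have h3 := (uniqueDiffOn_Icc hτ t ht).eq_deriv _ h1 h2
  rw [VectorField.lieBracket_eq, map_sub]
  simp only [ContinuousLinearMap.comp_apply] at h3
  linarith

variable {n : ℕ}

lemma contDiff_ad {X Y : Space n → Space n} (hX : ContDiff ℝ ∞ X) (hY : ContDiff ℝ ∞ Y) (k : ℕ) :
    ContDiff ℝ ∞ (ad X Y k) := by
  induction k with
  | zero => exact hY
  | succ k ih =>
    rw [ad, Function.iterate_succ_apply']
    exact hX.lieBracket_vectorField ih (by simp)

lemma adjoint_eq_zero_of_mem_cone {X Y : Space n → Space n} {γ : ℝ → Space n} (hτ : 0 < τ)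
    (hX : ContDiff ℝ ∞ X) (hY : ContDiff ℝ ∞ Y)
    (hγ : ∀ t ∈ Icc 0 τ, HasDerivWithinAt γ (X (γ t)) (Icc 0 τ) t) {p : ℝ → Space n →L[ℝ] ℝ}
    (hp : ∀ t ∈ Icc 0 τ,
      HasDerivWithinAt p (-((p t).comp (fderiv ℝ X (γ t)))) (Icc 0 τ) t)
    (h0 : ∀ t ∈ Icc 0 τ, p t (Y (γ t)) = 0) :
    ∀ t ∈ Icc 0 τ, ∀ w ∈ cone X Y (γ t), p t w = 0 := by
  have h1 : ∀ k : ℕ, ∀ t ∈ Icc 0 τ, p t (ad X Y k (γ t)) = 0 := by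
    intro k
    induction k with
    | zero => exact h0
    | succ k ih =>
      have := adjoint_lieBracket_eq_zero hτ
        ((contDiff_ad hX hY k).differentiable (by simp)) hγ hp ih
      intro t ht
      rw [ad, Function.iterate_succ_apply']
      exact this t ht
  intro t ht w hw
  have : cone X Y (γ t) ≤ LinearMap.ker (p t : Space n →ₗ[ℝ] ℝ) := by
    refine Submodule.span_le.2 ?_
    rintro _ ⟨k, rfl⟩
    exact h1 k t ht
  exact this hw

lemma apply_ne_zero_of_notMem_of_finrank {K : Submodule ℝ (Space n)}
    (hK : Module.finrank ℝ K + 1 = n) {p : Space n →L[ℝ] ℝ} (hp : p ≠ 0)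
    (hpK : ∀ w ∈ K, p w = 0) {w : Space n} (hw : w ∉ K) : p w ≠ 0 := by
  intro h0
  have hle : K ≤ LinearMap.ker (p : Space n →ₗ[ℝ] ℝ) := fun w hw => hpK w hw
  have hp' : (p : Space n →ₗ[ℝ] ℝ) ≠ 0 := fun h => hp (by ext x; exact LinearMap.congr_fun h x)
  have h1 := Module.Dual.finrank_ker_add_one_of_ne_zero hp'
  rw [finrank_euclideanSpace_fin] at h1
  have := Submodule.eq_of_le_of_finrank_eq hle (by omega)
  exact hw (this ▸ h0)

end Adjoint

/-! ### Construction of the straightening chart. -/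

section Straightening

variable {E : Type*} [NormedAddCommGroup E] [NormedSpace ℝ E]

/-- The chart `Ψ` at the origin straightens `X` into the constant field `X 0`, and pulls `Y` back
to `F • Z`. -/
structure IsStraightening (X Y : E → E) (Ψ : OpenPartialHomeomorph E E) (Z : E → E) (F : E → ℝ)
    (r : ℝ) : Prop where
  contDiff_Z : ContDiff ℝ 5 Z
  contDiff_F : ContDiff ℝ 5 F
  le_F : ∀ y, 1 / 2 ≤ F y
  F_le : ∀ y, F y ≤ 2
  r_pos : 0 < r
  r_le : r ≤ 1
  map_zero : Ψ 0 = 0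
  contDiffOn : ContDiffOn ℝ 6 Ψ Ψ.source
  contDiffOn_symm : ContDiffOn ℝ 6 Ψ.symm Ψ.target
  hasFDerivAt_zero : HasFDerivAt Ψ (ContinuousLinearMap.id ℝ E) 0
  mem_source : ∀ y, ‖y‖ ≤ r → y ∈ Ψ.source
  fderiv_X : ∀ y, ‖y‖ ≤ r → fderiv ℝ Ψ y (X 0) = X (Ψ y)
  fderiv_Z : ∀ y, ‖y‖ ≤ r → F y • fderiv ℝ Ψ y (Z y) = Y (Ψ y)

lemma fderiv_comp_fderiv_symm {Ψ : OpenPartialHomeomorph E E} {y : E} (hy : y ∈ Ψ.source)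
    (h : DifferentiableOn ℝ Ψ Ψ.source) (h' : DifferentiableOn ℝ Ψ.symm Ψ.target) (w : E) :
    fderiv ℝ Ψ y (fderiv ℝ Ψ.symm (Ψ y) w) = w := by
  have hy' := Ψ.map_source hy
  have h1 := ((h y hy).differentiableAt (Ψ.open_source.mem_nhds hy)).hasFDerivAt
  have h2 := ((h' _ hy').differentiableAt (Ψ.open_target.mem_nhds hy')).hasFDerivAt
  rw [← Ψ.left_inv hy] at h1
  have h3 := h1.comp (Ψ y) h2
  have h4 : HasFDerivAt (Ψ ∘ Ψ.symm) (ContinuousLinearMap.id ℝ E) (Ψ y) := by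
    refine (hasFDerivAt_id _).congr_of_eventuallyEq ?_
    filter_upwards [Ψ.open_target.mem_nhds hy'] with x hx using Ψ.right_inv hx
  have h5 := congrArg (fun L : E →L[ℝ] E => L w) (h3.unique h4)
  simpa [Ψ.left_inv hy] using h5

lemma fderiv_symm_comp_fderiv {Ψ : OpenPartialHomeomorph E E} {y : E} (hy : y ∈ Ψ.source)
    (h : DifferentiableOn ℝ Ψ Ψ.source) (h' : DifferentiableOn ℝ Ψ.symm Ψ.target) (w : E) :
    fderiv ℝ Ψ.symm (Ψ y) (fderiv ℝ Ψ y w) = w := by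
  have := fderiv_comp_fderiv_symm (Ψ := Ψ.symm) (Ψ.map_source hy) h' h w
  rwa [Ψ.symm_symm, Ψ.left_inv hy] at this

/-- Pull `Y` back by the flow box, extend it globally with a cutoff, and divide by its `m`-component
`F` so that `m ∘ Z = 1`. -/
lemma exists_isStraightening [FiniteDimensional ℝ E] {X Y : E → E} (hX : ContDiff ℝ ∞ X)
    (hY : ContDiff ℝ ∞ Y) (hX0 : X 0 ≠ 0) {m : E →L[ℝ] ℝ} (hm : m (Y 0) = 1) :
    ∃ Ψ Z F r, IsStraightening X Y Ψ Z F r ∧ ∀ y, m (Z y) = 1 := by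
  have : CompleteSpace E := FiniteDimensional.complete ℝ E
  obtain ⟨Ψ, h0, hΨ0, hΨ, hΨ', hid, hflow⟩ := exists_flowBox hX hX0 (N := 6) (by norm_num)
  have hd := hΨ.differentiableOn (by norm_num)
  have hd' := hΨ'.differentiableOn (by norm_num)
  let V : E → E := fun y => fderiv ℝ Ψ.symm (Ψ y) (Y (Ψ y))
  have hV : ContDiffOn ℝ 5 V Ψ.source := by
    have h1 : ContDiffOn ℝ 5 (fderiv ℝ Ψ.symm) Ψ.target :=
      hΨ'.fderiv_of_isOpen Ψ.open_target (by norm_num)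
    have h2 : ContDiffOn ℝ 5 Ψ Ψ.source := hΨ.of_le (by norm_num)
    exact (h1.comp h2 Ψ.mapsTo).clm_apply
      ((contDiff_infty.1 hY 5).comp_contDiffOn h2)
  have hVΨ : ∀ y ∈ Ψ.source, fderiv ℝ Ψ y (V y) = Y (Ψ y) := fun y hy =>
    fderiv_comp_fderiv_symm hy hd hd' _
  have hV0 : V 0 = Y 0 := by
    have := hVΨ 0 h0
    rwa [hid.fderiv, hΨ0] at this
  obtain ⟨δ, hδ, hball⟩ : ∃ δ > 0, ∀ y ∈ Metric.ball (0 : E) δ,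
      y ∈ Ψ.source ∧ |m (V y) - 1| < 1 / 2 := by
    have h1 : ContinuousAt (fun y => |m (V y) - 1|) 0 :=
      ((m.continuous.continuousAt.comp
        (hV.continuousOn.continuousAt (Ψ.open_source.mem_nhds h0))).sub continuousAt_const).abs
    have h2 : ∀ᶠ y in 𝓝 (0 : E), |m (V y) - 1| < 1 / 2 :=
      h1.eventually_lt_const (by simp [hV0, hm])
    exact Metric.eventually_nhds_iff_ball.1 ((Ψ.open_source.eventually_mem h0).and h2)
  let χ : ContDiffBump (0 : E) := ⟨δ / 4, δ / 2, by positivity, by linarith⟩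
  have hχball : tsupport χ ⊆ Metric.ball 0 δ := by
    rw [χ.tsupport_eq]
    exact Metric.closedBall_subset_ball (by simp only [χ]; linarith)
  -- Interpolating towards the constant `Y 0`, rather than `0`, keeps `m ∘ W` within `1/2` of `1`
  -- everywhere.
  let W : E → E := fun y => Y 0 + χ y • (V y - Y 0)
  have hW : ContDiff ℝ 5 W := by
    refine contDiff_const.add (contDiff_iff_contDiffAt.2 fun y => ?_)
    by_cases hy : y ∈ tsupport fun y => χ y • (V y - Y 0)
    swap
    · exact contDiffAt_const.congr_of_eventuallyEq (notMem_tsupport_iff_eventuallyEq.1 hy)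
    have hy' := (hball y (hχball (tsupport_smul_subset_left _ _ hy))).1
    exact χ.contDiff.contDiffAt.smul
      ((hV.contDiffAt (Ψ.open_source.mem_nhds hy')).sub contDiffAt_const)
  let F : E → ℝ := fun y => m (W y)
  have hF : ContDiff ℝ 5 F := m.contDiff.comp hW
  have hFabs : ∀ y, |F y - 1| ≤ 1 / 2 := by
    intro y
    have h1 : F y - 1 = χ y * (m (V y) - 1) := by
      simp only [F, W, map_add, map_smul, map_sub, hm, smul_eq_mul]
      ring
    rw [h1, abs_mul]
    by_cases hy : y ∈ tsupport χ
    · have h2 := (hball y (hχball hy)).2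
      have h3 : |χ y| ≤ 1 := by
        rw [abs_of_nonneg χ.nonneg]
        exact χ.le_one
      nlinarith [abs_nonneg (m (V y) - 1), abs_nonneg (χ y)]
    · rw [image_eq_zero_of_notMem_tsupport hy]
      norm_num
  have hF1 : ∀ y, 1 / 2 ≤ F y := fun y => by linarith [(abs_le.1 (hFabs y)).1]
  have hF0 : ∀ y, F y ≠ 0 := fun y => by linarith [hF1 y]
  have hr : ∀ y : E, ‖y‖ ≤ min (δ / 4) 1 → χ y = 1 ∧ y ∈ Ψ.source := by
    intro y hy
    have h1 : ‖y‖ ≤ δ / 4 := hy.trans (min_le_left _ _)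
    exact ⟨χ.one_of_mem_closedBall (mem_closedBall_zero_iff.2 h1),
      (hball y (mem_ball_zero_iff.2 (by linarith))).1⟩
  refine ⟨Ψ, fun y => (F y)⁻¹ • W y, F, min (δ / 4) 1,
    ⟨(hF.inv hF0).smul hW, hF, hF1, fun y => by linarith [(abs_le.1 (hFabs y)).2],
      by positivity, min_le_right _ _, hΨ0, hΨ, hΨ', hid, fun y hy => (hr y hy).2,
      fun y hy => hflow y (hr y hy).2, fun y hy => ?_⟩, fun y => ?_⟩
  · rw [map_smul, smul_inv_smul₀ (hF0 y), ← hVΨ y (hr y hy).2]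
    simp [W, (hr y hy).1]
  · rw [map_smul, smul_eq_mul]
    exact inv_mul_cancel₀ (hF0 y)

lemma exists_dual_pair [FiniteDimensional ℝ E] {a b : E} (h : LinearIndependent ℝ ![a, b]) :
    ∃ ℓ : E →L[ℝ] ℝ, ℓ a = 1 ∧ ℓ b = 0 := by
  have ha : a ∉ Submodule.span ℝ {b} := by
    intro ha
    obtain ⟨c, hc⟩ := Submodule.mem_span_singleton.1 ha
    have := (LinearIndependent.pair_iff.1 h) 1 (-c) (by rw [← hc]; simp)
    exact one_ne_zero this.1
  obtain ⟨f, hf, hf'⟩ := Submodule.exists_le_ker_of_notMem ha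
  refine ⟨(f a)⁻¹ • LinearMap.toContinuousLinearMap f, ?_, ?_⟩
  · simpa using inv_mul_cancel₀ hf
  · have : f b = 0 := hf' (Submodule.mem_span_singleton_self b)
    simp [this]

end Straightening

lemma eventually_norm_le {E : Type*} [NormedAddCommGroup E] {r : ℝ} {y : E} (hy : ‖y‖ < r) :
    ∀ᶠ z in 𝓝 y, ‖z‖ ≤ r :=
  (continuous_norm.continuousAt.eventually_lt_const hy).mono fun _ hz => hz.le

/-! ### Transport of brackets, curve and covector by the chart. -/

section Transport

variable {E : Type*} [NormedAddCommGroup E] [NormedSpace ℝ E]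

/-- Differentiate both relations; the second derivatives of `f` cancel in the difference by
symmetry. -/
lemma fderiv_lieBracket_of_related {G : Type*} [NormedAddCommGroup G] [NormedSpace ℝ G] {f : E → G}
    {A B : E → E} {A' B' : G → G} {x : E} (hf : ContDiffAt ℝ 2 f x)
    (hA : DifferentiableAt ℝ A x) (hB : DifferentiableAt ℝ B x)
    (hA' : DifferentiableAt ℝ A' (f x)) (hB' : DifferentiableAt ℝ B' (f x))
    (hAA' : ∀ᶠ y in 𝓝 x, fderiv ℝ f y (A y) = A' (f y))
    (hBB' : ∀ᶠ y in 𝓝 x, fderiv ℝ f y (B y) = B' (f y)) :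
    fderiv ℝ f x (VectorField.lieBracket ℝ A B x) = VectorField.lieBracket ℝ A' B' (f x) := by
  have hdf := (hf.differentiableAt (by norm_num)).hasFDerivAt
  have hddf : HasFDerivAt (fderiv ℝ f) (fderiv ℝ (fderiv ℝ f) x) x :=
    ((hf.fderiv_right (m := 1) (by norm_num)).differentiableAt (by norm_num)).hasFDerivAt
  have hsymm : IsSymmSndFDerivAt ℝ f x := hf.isSymmSndFDerivAt (by simp)
  have key : ∀ {C : E → E} {C' : G → G}, DifferentiableAt ℝ C x → DifferentiableAt ℝ C' (f x) →
      (∀ᶠ y in 𝓝 x, fderiv ℝ f y (C y) = C' (f y)) → ∀ w,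
      fderiv ℝ f x (fderiv ℝ C x w) + fderiv ℝ (fderiv ℝ f) x w (C x)
        = fderiv ℝ C' (f x) (fderiv ℝ f x w) := by
    intro C C' hC hC' hCC' w
    have h1 := hddf.clm_apply hC.hasFDerivAt
    have h2 := (hC'.hasFDerivAt.comp x hdf).congr_of_eventuallyEq hCC'
    exact congrArg (fun L : E →L[ℝ] G => L w) (h1.unique h2)
  have h1 := key hA hA' hAA' (B x)
  have h2 := key hB hB' hBB' (A x)
  rw [hAA'.self_of_nhds] at h2
  rw [hBB'.self_of_nhds] at h1
  simp only [VectorField.lieBracket_eq, map_sub]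
  rw [← h1, ← h2, hsymm.eq (A x) (B x)]
  abel

variable {X Y : E → E} {Ψ : OpenPartialHomeomorph E E} {Z : E → E} {F : E → ℝ} {r : ℝ}

namespace IsStraightening

lemma contDiffAt (h : IsStraightening X Y Ψ Z F r) {y : E} (hy : ‖y‖ ≤ r) : ContDiffAt ℝ 6 Ψ y :=
  h.contDiffOn.contDiffAt (Ψ.open_source.mem_nhds (h.mem_source y hy))

lemma hasFDerivAt (h : IsStraightening X Y Ψ Z F r) {y : E} (hy : ‖y‖ ≤ r) :
    HasFDerivAt Ψ (fderiv ℝ Ψ y) y :=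
  ((h.contDiffAt hy).differentiableAt (by norm_num)).hasFDerivAt

lemma contDiffAt_symm (h : IsStraightening X Y Ψ Z F r) {y : E} (hy : ‖y‖ ≤ r) :
    ContDiffAt ℝ 6 Ψ.symm (Ψ y) :=
  h.contDiffOn_symm.contDiffAt (Ψ.open_target.mem_nhds (Ψ.map_source (h.mem_source y hy)))

lemma fderiv_symm_apply (h : IsStraightening X Y Ψ Z F r) {y : E} (hy : ‖y‖ ≤ r) (w : E) :
    fderiv ℝ Ψ.symm (Ψ y) (fderiv ℝ Ψ y w) = w :=
  fderiv_symm_comp_fderiv (h.mem_source y hy) (h.contDiffOn.differentiableOn (by norm_num))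
    (h.contDiffOn_symm.differentiableOn (by norm_num)) w

lemma zero_mem (h : IsStraightening X Y Ψ Z F r) : (0 : E) ∈ Ψ.source :=
  h.mem_source 0 (by simpa using h.r_pos.le)

lemma symm_zero (h : IsStraightening X Y Ψ Z F r) : Ψ.symm 0 = 0 := by
  have := Ψ.left_inv h.zero_mem
  rwa [h.map_zero] at this

lemma zero_mem_target (h : IsStraightening X Y Ψ Z F r) : (0 : E) ∈ Ψ.target := by
  have := Ψ.map_source h.zero_mem
  rwa [h.map_zero] at this

/-- In the chart `γ` has constant velocity `X 0`. -/
lemma exists_map_smul_eq (h : IsStraightening X Y Ψ Z F r) {γ : ℝ → E} {τ : ℝ} (hτ : 0 < τ)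
    (h0 : γ 0 = 0) (hγ : ∀ t ∈ Icc 0 τ, HasDerivWithinAt γ (X (γ t)) (Icc 0 τ) t) :
    ∃ t₁ > 0, t₁ ≤ τ ∧ t₁ * ‖X 0‖ < r ∧ ∀ t ∈ Icc 0 t₁, Ψ (t • X 0) = γ t := by
  have hc : ContinuousWithinAt γ (Icc 0 τ) 0 := (hγ 0 ⟨le_rfl, hτ.le⟩).continuousWithinAt
  have hsc : ContinuousAt Ψ.symm (γ 0) := by
    rw [h0]
    exact Ψ.symm.continuousAt h.zero_mem_target
  have h1 : ∀ᶠ t in 𝓝[Icc 0 τ] (0 : ℝ), γ t ∈ Ψ.target ∧ ‖Ψ.symm (γ t)‖ < r := by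
    refine (hc.eventually (Ψ.open_target.mem_nhds (h0 ▸ h.zero_mem_target))).and ?_
    have h2 : ContinuousWithinAt (fun t => ‖Ψ.symm (γ t)‖) (Icc 0 τ) 0 :=
      (hsc.comp_continuousWithinAt hc).norm
    exact h2.eventually_lt_const (by simpa [h0, h.symm_zero] using h.r_pos)
  obtain ⟨δ, hδ, hball⟩ := Metric.eventually_nhds_iff_ball.1 (eventually_nhdsWithin_iff.1 h1)
  have hr := h.r_pos
  refine ⟨min (min (δ / 2) τ) (r / 2 / (‖X 0‖ + 1)), by positivity,
    (min_le_left _ _).trans (min_le_right _ _), ?_, ?_⟩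
  · have h2 : min (min (δ / 2) τ) (r / 2 / (‖X 0‖ + 1)) * (‖X 0‖ + 1) ≤ r / 2 := by
      rw [← le_div_iff₀ (by positivity)]
      exact min_le_right _ _
    have h3 : 0 < min (min (δ / 2) τ) (r / 2 / (‖X 0‖ + 1)) := by positivity
    nlinarith [norm_nonneg (X 0)]
  · set t₁ := min (min (δ / 2) τ) (r / 2 / (‖X 0‖ + 1)) with ht₁
    have hsub : Icc 0 t₁ ⊆ Icc 0 τ :=
      Icc_subset_Icc_right ((min_le_left _ _).trans (min_le_right _ _))
    have hmem : ∀ t ∈ Icc 0 t₁, γ t ∈ Ψ.target ∧ ‖Ψ.symm (γ t)‖ < r := by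
      intro t ht
      refine hball t ?_ (hsub ht)
      rw [Metric.mem_ball, Real.dist_0_eq_abs, abs_of_nonneg ht.1]
      have : t₁ ≤ δ / 2 := (min_le_left _ _).trans (min_le_left _ _)
      linarith [ht.2]
    have hder : ∀ t ∈ Icc 0 t₁,
        HasDerivWithinAt (fun s => Ψ.symm (γ s) - s • X 0) 0 (Icc 0 t₁) t := by
      intro t ht
      obtain ⟨h3, h4⟩ := hmem t ht
      have h5 := h.fderiv_symm_apply h4.le (X 0)
      have h6 := h.contDiffAt_symm h4.le
      rw [h.fderiv_X _ h4.le] at h5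
      rw [Ψ.right_inv h3] at h5 h6
      have h7 := (h6.differentiableAt (by norm_num)).hasFDerivAt.comp_hasDerivWithinAt t
        ((hγ t (hsub ht)).mono hsub)
      rw [h5] at h7
      have h8 := h7.fun_sub ((hasDerivWithinAt_id t _).smul_const (X 0))
      rwa [one_smul, sub_self] at h8
    intro t ht
    have h3 := constant_of_has_deriv_right_zero (fun t ht => (hder t ht).continuousWithinAt)
      (fun t ht => (hder t (Ico_subset_Icc_self ht)).mono_of_mem_nhdsWithin
        (Icc_mem_nhdsGE_of_mem ht)) t ht
    simp only [h0, h.symm_zero, zero_smul, sub_zero, sub_eq_zero] at h3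
    rw [← h3, Ψ.right_inv (hmem t ht).1]

/-- In the chart `X` is constant, so the pulled back adjoint vector is constant, equal to its value
at `t = 0` where `Ψ` is tangent to the identity. -/
lemma adjoint_fderiv_eq (h : IsStraightening X Y Ψ Z F r) (hX : Differentiable ℝ X) {γ : ℝ → E}
    {τ : ℝ} (hτr : τ * ‖X 0‖ < r) (hγ : ∀ t ∈ Icc 0 τ, Ψ (t • X 0) = γ t) {p : ℝ → E →L[ℝ] ℝ}
    (hp : ∀ t ∈ Icc 0 τ,
      HasDerivWithinAt p (-((p t).comp (fderiv ℝ X (γ t)))) (Icc 0 τ) t) (w : E) :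
    ∀ t ∈ Icc 0 τ, p t (fderiv ℝ Ψ (t • X 0) w) = p 0 w := by
  have hder : ∀ t ∈ Icc 0 τ,
      HasDerivWithinAt (fun s => p s (fderiv ℝ Ψ (s • X 0) w)) 0 (Icc 0 τ) t := by
    intro t ht
    have hr : ‖t • X 0‖ < r := by
      rw [norm_smul, Real.norm_of_nonneg ht.1]
      exact lt_of_le_of_lt (mul_le_mul_of_nonneg_right ht.2 (norm_nonneg _)) hτr
    have hcd := h.contDiffAt hr.le
    have hddf : HasFDerivAt (fderiv ℝ Ψ) (fderiv ℝ (fderiv ℝ Ψ) (t • X 0)) (t • X 0) :=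
      ((hcd.fderiv_right (m := 1) (by norm_num)).differentiableAt (by norm_num)).hasFDerivAt
    have hsymm : IsSymmSndFDerivAt ℝ Ψ (t • X 0) :=
      (hcd.of_le (by norm_num : (2 : WithTop ℕ∞) ≤ 6)).isSymmSndFDerivAt (by simp)
    have h1 : fderiv ℝ (fderiv ℝ Ψ) (t • X 0) w (X 0)
        = fderiv ℝ X (γ t) (fderiv ℝ Ψ (t • X 0) w) := by
      have h2 := hddf.clm_apply (hasFDerivAt_const (X 0) (t • X 0))
      have h3 := ((hX _).hasFDerivAt.comp (t • X 0) (h.hasFDerivAt hr.le)).congr_of_eventuallyEq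
        ((eventually_norm_le hr).mono fun y hy => h.fderiv_X y hy)
      have h4 := congrArg (fun L : E →L[ℝ] E => L w) (h2.unique h3)
      simpa [hγ t ht] using h4
    have h2 : HasDerivAt (fun s : ℝ => s • X 0) (X 0) t := by
      simpa using (hasDerivAt_id t).smul_const (X 0)
    have hw : HasFDerivAt (fun y => fderiv ℝ Ψ y w) ((fderiv ℝ (fderiv ℝ Ψ) (t • X 0)).flip w)
        (t • X 0) := by
      refine (hddf.clm_apply (hasFDerivAt_const w (t • X 0))).congr_fderiv ?_
      ext v
      simp
    have h3 : HasDerivAt (fun s : ℝ => fderiv ℝ Ψ (s • X 0) w)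
        ((fderiv ℝ (fderiv ℝ Ψ) (t • X 0)).flip w (X 0)) t :=
      HasFDerivAt.comp_hasDerivAt (l := fun y => fderiv ℝ Ψ y w) (f := fun s : ℝ => s • X 0) t hw h2
    rw [ContinuousLinearMap.flip_apply, hsymm.eq (X 0) w, h1] at h3
    have h4 := (hp t ht).clm_apply h3.hasDerivWithinAt
    rwa [_root_.neg_apply, ContinuousLinearMap.comp_apply, neg_add_cancel] at h4
  intro t ht
  have h3 := constant_of_has_deriv_right_zero (fun t ht => (hder t ht).continuousWithinAt)
    (fun t ht => (hder t (Ico_subset_Icc_self ht)).mono_of_mem_nhdsWithin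
      (Icc_mem_nhdsGE_of_mem ht)) t ht
  rw [h3]
  simp [h.hasFDerivAt_zero.fderiv]

lemma F_zero (h : IsStraightening X Y Ψ Z F r) {m : E →L[ℝ] ℝ} (hm : m (Y 0) = 1)
    (hZ : m (Z 0) = 1) : F 0 = 1 := by
  have h1 := h.fderiv_Z 0 (by simpa using h.r_pos.le)
  rw [h.hasFDerivAt_zero.fderiv, h.map_zero, ContinuousLinearMap.id_apply] at h1
  have h2 := congrArg m h1
  rwa [map_smul, hZ, hm, smul_eq_mul, mul_one] at h2

lemma lieBracket_lieBracket_eq (h : IsStraightening X Y Ψ Z F r) (hX : ContDiff ℝ 2 X)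
    (hY : ContDiff ℝ 2 Y) :
    VectorField.lieBracket ℝ Y (VectorField.lieBracket ℝ Y X) 0
      = VectorField.lieBracket ℝ (fun y => F y • Z y)
        (VectorField.lieBracket ℝ (fun y => F y • Z y) fun _ => X 0) 0 := by
  set W : E → E := fun y => F y • Z y with hW
  have hWc : ContDiff ℝ 5 W := h.contDiff_F.smul h.contDiff_Z
  have hWY : ∀ y, ‖y‖ ≤ r → fderiv ℝ Ψ y (W y) = Y (Ψ y) := by
    intro y hy
    rw [hW, map_smul, h.fderiv_Z y hy]
  have h0 : ‖(0 : E)‖ < r := by simpa using h.r_pos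
  have h1 : ∀ y, ‖y‖ < r → fderiv ℝ Ψ y (VectorField.lieBracket ℝ W (fun _ => X 0) y)
      = VectorField.lieBracket ℝ Y X (Ψ y) := fun y hy =>
    fderiv_lieBracket_of_related ((h.contDiffAt hy.le).of_le (by norm_num))
      (hWc.differentiable (by norm_num) y) (differentiableAt_const _)
      (hY.differentiable (by norm_num) _) (hX.differentiable (by norm_num) _)
      ((eventually_norm_le hy).mono fun z hz => hWY z hz)
      ((eventually_norm_le hy).mono fun z hz => h.fderiv_X z hz)
  have h2 := fderiv_lieBracket_of_related (f := Ψ) (x := 0) (A := W)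
    (B := VectorField.lieBracket ℝ W fun _ => X 0) (A' := Y) (B' := VectorField.lieBracket ℝ Y X)
    ((h.contDiffAt h0.le).of_le (by norm_num)) (hWc.differentiable (by norm_num) _)
    ((hWc.lieBracket_vectorField (m := 1) (n := 5) contDiff_const (by norm_num)).differentiable
      (by norm_num) _)
    (hY.differentiable (by norm_num) _)
    ((hY.lieBracket_vectorField (m := 1) (n := 2) hX (by norm_num)).differentiable
      (by norm_num) _)
    ((eventually_norm_le h0).mono fun z hz => hWY z hz)
    ((continuous_norm.continuousAt.eventually_lt_const h0).mono fun z hz => h1 z hz)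
  rw [h.hasFDerivAt_zero.fderiv, h.map_zero, ContinuousLinearMap.id_apply] at h2
  exact h2.symm

end IsStraightening

/-- The factor `F` does not matter: the terms containing its derivatives carry the factor `p(Z 0) =
0` or `slope 0 = 0`, except for two copies of `dF(e) · d(p ∘ Z)(Z 0)` that cancel. -/
lemma apply_lieBracket_smul_eq_curvature {e : E} {Z : E → E} {F : E → ℝ} {p : E →L[ℝ] ℝ}
    (hZ : ContDiff ℝ 2 Z) (hF : ContDiff ℝ 2 F) (hF0 : F 0 = 1) (hp : p (Z 0) = 0)
    (hs : slope e Z p 0 = 0) :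
    p (VectorField.lieBracket ℝ (fun y => F y • Z y)
      (VectorField.lieBracket ℝ (fun y => F y • Z y) fun _ => e) 0) = curvature e Z p := by
  set g : E → ℝ := fun x => p (Z x) with hg
  have hgc : ContDiff ℝ 2 g := p.contDiff.comp hZ
  have hg1 : Differentiable ℝ g := hgc.differentiable (by norm_num)
  have hZ1 : Differentiable ℝ Z := hZ.differentiable (by norm_num)
  have hF1 : Differentiable ℝ F := hF.differentiable (by norm_num)
  have hdg : Differentiable ℝ (fderiv ℝ g) :=
    (hgc.fderiv_right (m := 1) (by norm_num)).differentiable (by norm_num)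
  have hdF : Differentiable ℝ (fderiv ℝ F) :=
    (hF.fderiv_right (m := 1) (by norm_num)).differentiable (by norm_num)
  have hg0 : g 0 = 0 := hp
  have hs' : fderiv ℝ g 0 e = 0 := hs
  have hsymm : IsSymmSndFDerivAt ℝ g 0 := hgc.contDiffAt.isSymmSndFDerivAt (by simp)
  set W : E → E := fun y => F y • Z y with hW
  have hWc : ContDiff ℝ 2 W := hF.smul hZ
  have hdW : Differentiable ℝ (fderiv ℝ W) :=
    (hWc.fderiv_right (m := 1) (by norm_num)).differentiable (by norm_num)
  have hWd : ∀ y, fderiv ℝ W y = F y • fderiv ℝ Z y + (fderiv ℝ F y).smulRight (Z y) := fun y =>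
    ((hF1 y).hasFDerivAt.smul (hZ1 y).hasFDerivAt).fderiv
  have hbr : VectorField.lieBracket ℝ W (fun _ => e) = fun y => -fderiv ℝ W y e := by
    ext1 y
    simp [VectorField.lieBracket_eq]
  have hpW : ∀ y w, p (fderiv ℝ W y w) = F y * fderiv ℝ g y w + fderiv ℝ F y w * g y := by
    intro y w
    have h1 : fderiv ℝ g y w = p (fderiv ℝ Z y w) := by
      have h2 : HasFDerivAt g (p ∘L fderiv ℝ Z y) y :=
        p.hasFDerivAt.comp y (hZ1 y).hasFDerivAt
      rw [h2.fderiv, ContinuousLinearMap.comp_apply]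
    rw [h1, hWd]
    simp [hg]
  have hU : HasFDerivAt (fun y => -fderiv ℝ W y e)
      (-(fderiv ℝ (fderiv ℝ W) 0).flip e) 0 := by
    refine HasFDerivAt.fun_neg ?_
    have := (hdW 0).hasFDerivAt.clm_apply (hasFDerivAt_const e (0 : E))
    convert this using 1
    ext w
    simp
  have hpU : p ((fderiv ℝ (fderiv ℝ W) 0) (Z 0) e)
      = fderiv ℝ (slope e Z p) 0 (Z 0) + fderiv ℝ g 0 (Z 0) * fderiv ℝ F 0 e := by
    have hsl : HasFDerivAt (slope e Z p) ((fderiv ℝ (fderiv ℝ g) 0).flip e) 0 := by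
      have := (hdg 0).hasFDerivAt.clm_apply (hasFDerivAt_const e (0 : E))
      refine (this.congr_fderiv ?_)
      ext w
      simp
    have h1 : HasFDerivAt (fun y => p (fderiv ℝ W y e))
        (p ∘L (fderiv ℝ (fderiv ℝ W) 0).flip e) 0 := by
      refine p.hasFDerivAt.comp 0 ?_
      have := (hdW 0).hasFDerivAt.clm_apply (hasFDerivAt_const e (0 : E))
      refine (this.congr_fderiv ?_)
      ext w
      simp
    have h2 : HasFDerivAt (fun y => p (fderiv ℝ W y e))
        (F 0 • (fderiv ℝ (fderiv ℝ g) 0).flip e + fderiv ℝ g 0 e • fderiv ℝ F 0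
          + (fderiv ℝ F 0 e • fderiv ℝ g 0 + g 0 • (fderiv ℝ (fderiv ℝ F) 0).flip e)) 0 := by
      simp only [hpW]
      have hFe : HasFDerivAt (fun y => fderiv ℝ F y e) ((fderiv ℝ (fderiv ℝ F) 0).flip e) 0 := by
        have := (hdF 0).hasFDerivAt.clm_apply (hasFDerivAt_const e (0 : E))
        refine (this.congr_fderiv ?_)
        ext w
        simp
      exact ((hF1 0).hasFDerivAt.mul hsl).add (hFe.mul (hg1 0).hasFDerivAt)
    have h3 := congrArg (fun L : E →L[ℝ] ℝ => L (Z 0)) (h1.unique h2)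
    simp only [ContinuousLinearMap.comp_apply, ContinuousLinearMap.flip_apply, hF0, hg0, hs',
      one_smul, zero_smul, add_zero, _root_.add_apply, _root_.smul_apply, smul_eq_mul] at h3
    rw [h3, hsl.fderiv, ContinuousLinearMap.flip_apply]
    ring
  have hcurv : curvature e Z p = fderiv ℝ g 0 (fderiv ℝ Z 0 e)
      - fderiv ℝ (slope e Z p) 0 (Z 0) := by
    have hsl : fderiv ℝ (slope e Z p) 0 (Z 0) = fderiv ℝ (fderiv ℝ g) 0 (Z 0) e := by
      have := (hdg 0).hasFDerivAt.clm_apply (hasFDerivAt_const e (0 : E))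
      have h4 : fderiv ℝ (slope e Z p) 0 = _ := this.fderiv
      rw [h4]
      simp
    have h5 : dirDeriv (fun _ => e) (dirDeriv Z g) 0
        = fderiv ℝ (fderiv ℝ g) 0 e (Z 0) + fderiv ℝ g 0 (fderiv ℝ Z 0 e) := by
      have := (hdg 0).hasFDerivAt.clm_apply (hZ1 0).hasFDerivAt
      have h4 : fderiv ℝ (dirDeriv Z g) 0 = _ := this.fderiv
      rw [dirDeriv, h4]
      simp [add_comm]
    rw [curvature, h5, hsl, hsymm.eq e (Z 0)]
    ring
  rw [hbr, VectorField.lieBracket_eq]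
  beta_reduce
  rw [hU.fderiv, hcurv]
  have hW0 : W 0 = Z 0 := by simp [hW, hF0]
  have hUe : fderiv ℝ W 0 e = fderiv ℝ Z 0 e + fderiv ℝ F 0 e • Z 0 := by
    rw [hWd, hF0]
    simp
  simp only [_root_.neg_apply, ContinuousLinearMap.flip_apply, map_sub, map_neg, hW0, hpU, hpW,
    hF0, hg0, hUe, map_add, map_smul, smul_eq_mul]
  ring

end Transport

/-! ### Trajectories as flat curves; the lower bound on the distance. -/

section Trajectories

variable {n : ℕ} {X Y : Space n → Space n}

lemma norm_velocity_le {C₁ C₂ v u : ℝ} {a b : Space n} (hvu : v ^ 2 + u ^ 2 ≤ 1) (ha : ‖a‖ ≤ C₁)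
    (hb : ‖b‖ ≤ C₂) : ‖v • a + u • b‖ ≤ C₁ + C₂ := by
  have hv : |v| ≤ 1 := abs_le_one_iff_mul_self_le_one.2 (by nlinarith [sq_nonneg u])
  have hu : |u| ≤ 1 := abs_le_one_iff_mul_self_le_one.2 (by nlinarith [sq_nonneg v])
  refine (norm_add_le _ _).trans ?_
  rw [norm_smul, norm_smul, Real.norm_eq_abs, Real.norm_eq_abs]
  nlinarith [norm_nonneg a, norm_nonneg b, abs_nonneg v, abs_nonneg u]

lemma IsTrajectory.norm_le {S R C₁ C₂ : ℝ} {v u : ℝ → ℝ} {x : ℝ → Space n}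
    (hx : IsTrajectory X Y S v u x) (hvu : ∀ t ∈ Icc 0 S, v t ^ 2 + u t ^ 2 ≤ 1) (hC₁ : 0 ≤ C₁)
    (hC₂ : 0 ≤ C₂) (hXC : ∀ q, ‖q‖ ≤ R → ‖X q‖ ≤ C₁) (hYC : ∀ q, ‖q‖ ≤ R → ‖Y q‖ ≤ C₂)
    (hS : (C₁ + C₂) * S < R) : ∀ t ∈ Icc 0 S, ‖x t‖ ≤ (C₁ + C₂) * t := by
  have := norm_sub_le_mul_of_confined hx.cont (by positivity) hS fun t ht hR => ?_
  · simpa [hx.init] using this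
  · simp only [hx.init, sub_zero] at hR ⊢
    rw [hx.eq t ht]
    have h1 := intervalIntegral.norm_integral_le_of_norm_le_const_ae (a := 0) (b := t)
      (C := C₁ + C₂) (f := fun s => v s • X (x s) + u s • Y (x s)) ?_
    · rwa [sub_zero, abs_of_nonneg ht.1] at h1
    · have h2 : ∀ᵐ s : ℝ, s ≠ t := by simp [ae_iff, measure_singleton]
      filter_upwards [h2] with s hs hst
      rw [uIoc_of_le ht.1] at hst
      have hs' := hR s ⟨hst.1.le, lt_of_le_of_ne hst.2 hs⟩
      exact norm_velocity_le (hvu s ⟨hst.1.le, hst.2.trans ht.2⟩) (hXC _ hs') (hYC _ hs')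

variable {Ψ : OpenPartialHomeomorph (Space n) (Space n)} {Z : Space n → Space n} {F : Space n → ℝ}
  {r : ℝ}

namespace IsStraightening

/-- The control of `Z` is `w = u F`. From `F ≤ 2` and `u² ≤ (1 - v)(1 + v) ≤ 2 (1 - v)` follows the
bound by `8 (1 - v)`, which ties sideways motion to loss of forward speed. -/
lemma exists_isFlatCurve (h : IsStraightening X Y Ψ Z F r) (hX : Continuous X)
    (hY : Continuous Y) :
    ∃ S₀ > 0, ∃ A > 0, ∀ S v u x, 0 ≤ S → S ≤ S₀ → Measurable v → Measurable u →
      (∀ t ∈ Icc 0 S, v t ^ 2 + u t ^ 2 ≤ 1) → IsTrajectory X Y S v u x →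
      ∃ w, IsFlatCurve (X 0) Z S v w (fun t => Ψ.symm (x t)) ∧
        (∀ t ∈ Icc 0 S, ‖Ψ.symm (x t)‖ ≤ A * S) ∧ ∀ t ∈ Icc 0 S, w t ^ 2 ≤ 8 * (1 - v t) := by
  have h0 : ‖(0 : Space n)‖ ≤ r := by simpa using h.r_pos.le
  have hcd := h.contDiffAt_symm h0
  rw [h.map_zero] at hcd
  obtain ⟨K, U, hU, hK⟩ :=
    (hcd.of_le (by norm_num : (1 : WithTop ℕ∞) ≤ 6)).exists_lipschitzOnWith
  have hnear : ∀ᶠ q in 𝓝 (0 : Space n), q ∈ U ∧ q ∈ Ψ.target ∧ ‖Ψ.symm q‖ < r := by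
    refine (Filter.eventually_mem_set.2 hU).and ((Ψ.open_target.eventually_mem
      h.zero_mem_target).and ?_)
    exact hcd.continuousAt.norm.eventually_lt_const (by simpa [h.symm_zero] using h.r_pos)
  obtain ⟨R', hR', hball⟩ := Metric.eventually_nhds_iff_ball.1 hnear
  set R := R' / 2 with hR
  have hball' : ∀ q : Space n, ‖q‖ ≤ R → q ∈ U ∧ q ∈ Ψ.target ∧ ‖Ψ.symm q‖ < r := fun q hq =>
    hball q (mem_ball_zero_iff.2 (by linarith))
  obtain ⟨C₁, hC₁, hXC⟩ := exists_norm_le_of_continuous hX R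
  obtain ⟨C₂, hC₂, hYC⟩ := exists_norm_le_of_continuous hY R
  set C := C₁ + C₂ with hC
  have hCpos : 0 < C := by positivity
  have hRpos : 0 < R := by positivity
  refine ⟨R / 2 / C, by positivity, (K + 1) * C, by positivity,
    fun S v u x hS hSS₀ hv hu hvu hx => ?_⟩
  have hCS : C * S < R := by
    rw [le_div_iff₀ hCpos] at hSS₀
    linarith
  have hxn := hx.norm_le hvu hC₁.le hC₂.le hXC hYC hCS
  have hxR : ∀ t ∈ Icc 0 S, ‖x t‖ ≤ R := fun t ht =>
    (hxn t ht).trans ((mul_le_mul_of_nonneg_left ht.2 hCpos.le).trans hCS.le)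
  have hint := IsTrajectory.intervalIntegrable hX hY hS hv hu hvu hx.cont
  have hvel : ∀ t ∈ Icc 0 S, ‖v t • X (x t) + u t • Y (x t)‖ ≤ C := fun t ht =>
    norm_velocity_le (hvu t ht) (hXC _ (hxR t ht)) (hYC _ (hxR t ht))
  have hlip : LipschitzOnWith C.toNNReal x (Icc 0 S) := by
    refine LipschitzOnWith.of_dist_le_mul fun t ht s hs => ?_
    have h1 : ∀ a ∈ Icc 0 S, IntervalIntegrable (fun s => v s • X (x s) + u s • Y (x s)) volume
        0 a := fun a ha => hint.mono_set (by
      rw [uIcc_of_le ha.1, uIcc_of_le hS]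
      exact Icc_subset_Icc_right ha.2)
    rw [dist_eq_norm, Real.coe_toNNReal _ hCpos.le, hx.eq t ht, hx.eq s hs,
      intervalIntegral.integral_interval_sub_left (h1 t ht) (h1 s hs), Real.dist_eq]
    refine intervalIntegral.norm_integral_le_of_norm_le_const fun a ha => hvel a ?_
    exact (ordConnected_Icc.uIcc_subset hs ht) (uIoc_subset_uIcc ha)
  have hF2 : ∀ q, F q ^ 2 ≤ 4 := fun q => by nlinarith [h.le_F q, h.F_le q]
  have hw : ∀ t ∈ Icc 0 S, (u t * F (Ψ.symm (x t))) ^ 2 ≤ 4 * u t ^ 2 := fun t _ => by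
    rw [mul_pow]
    nlinarith [hF2 (Ψ.symm (x t)), sq_nonneg (u t)]
  have hv1 : ∀ t ∈ Icc 0 S, |v t| ≤ 1 := fun t ht => by
    rw [← sq_le_one_iff_abs_le_one]
    nlinarith [hvu t ht, sq_nonneg (u t)]
  refine ⟨fun t => u t * F (Ψ.symm (x t)), ⟨⟨K * C.toNNReal, ?_⟩, ?_, hv, hv1, ?_⟩, ?_, ?_⟩
  · exact hK.comp hlip fun t ht => (hball' _ (hxR t ht)).1
  · filter_upwards [hint.ae_hasDerivAt_integral] with t hint ht
    have ht' := Ioo_subset_Icc_self ht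
    rw [uIcc_of_le hS] at hint
    have h1 : HasDerivAt x (v t • X (x t) + u t • Y (x t)) t :=
      (hint ht' 0 ⟨le_rfl, hS⟩).congr_of_eventuallyEq
        (Filter.eventually_of_mem (Icc_mem_nhds ht.1 ht.2) hx.eq)
    obtain ⟨-, htar, hr⟩ := hball' _ (hxR t ht')
    have hcd := h.contDiffAt_symm hr.le
    have hXe := h.fderiv_symm_apply hr.le (X 0)
    have hYe := h.fderiv_symm_apply hr.le (F (Ψ.symm (x t)) • Z (Ψ.symm (x t)))
    rw [map_smul (fderiv ℝ Ψ (Ψ.symm (x t))), h.fderiv_Z _ hr.le, Ψ.right_inv htar] at hYe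
    rw [h.fderiv_X _ hr.le, Ψ.right_inv htar] at hXe
    rw [Ψ.right_inv htar] at hcd
    have h2 := (hcd.differentiableAt (by norm_num)).hasFDerivAt.comp_hasDerivAt t h1
    rw [map_add, map_smul, map_smul, hXe, hYe, smul_smul] at h2
    exact h2
  · intro t ht
    refine abs_le_of_sq_le_sq (b := 2) ?_ (by norm_num)
    nlinarith [hw t ht, hvu t ht, sq_nonneg (v t)]
  · intro t ht
    have h1 := hK.dist_le_mul _ (hball' _ (hxR t ht)).1 _
      (hball' 0 (by simpa using hRpos.le)).1
    rw [h.symm_zero, dist_zero_right, dist_zero_right] at h1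
    have h2 : ‖x t‖ ≤ C * S := (hxn t ht).trans (mul_le_mul_of_nonneg_left ht.2 hCpos.le)
    calc ‖Ψ.symm (x t)‖ ≤ K * ‖x t‖ := h1
      _ ≤ K * (C * S) := by gcongr
      _ ≤ (K + 1) * C * S := by
        have : 0 ≤ C * S := by positivity
        nlinarith
  · intro t ht
    have h1 := abs_le.1 (hv1 t ht)
    nlinarith [hw t ht, hvu t ht]

/-- Short trajectories are handled by `exists_apply_le_time`. For the others there is nothing to
prove, since `ℓ y` is below the time threshold when `y` is small. -/
lemma exists_le_srDist (h : IsStraightening X Y Ψ Z F r) (hX : Continuous X)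
    (hY : Continuous Y) {ℓ m p : Space n →L[ℝ] ℝ} {t₁ : ℝ} (hN : IsNormalForm (X 0) Z ℓ m p r t₁)
    (hκ : 0 < curvature (X 0) Z p) :
    ∃ ρ > 0, ρ ≤ r ∧ ∀ y, ‖y‖ ≤ ρ → m y = 0 → p y ≤ 0 →
      ENNReal.ofReal (ℓ y) ≤ srDist X Y (Ψ y) := by
  obtain ⟨S₀, hS₀, A, hA, H⟩ := h.exists_isFlatCurve hX hY
  obtain ⟨S₁, hS₁, H₁⟩ := hN.exists_apply_le_time hκ hA
  have hr := h.r_pos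
  refine ⟨min r (min S₀ S₁ / (‖ℓ‖ + 1)), by positivity, min_le_left _ _, fun y hy hm hp => ?_⟩
  refine le_iInf fun S => le_iInf fun hS => le_iInf fun hq => ENNReal.ofReal_le_ofReal ?_
  rcases le_or_gt S (min S₀ S₁) with hSS | hSS
  · obtain ⟨v, u, x, hv, hu, hvu, hx, hxq⟩ := hq
    obtain ⟨w, hflat, hA', hw⟩ := H S v u x hS (hSS.trans (min_le_left _ _)) hv hu hvu hx
    have hxS : Ψ.symm (x S) = y := by
      rw [hxq, Ψ.left_inv (h.mem_source y (hy.trans (min_le_left _ _)))]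
    have := H₁ S v w _ hS (hSS.trans (min_le_right _ _)) hflat hA'
      (by simp [hx.init, h.symm_zero]) hw
    simp only [hxS] at this
    exact this hm hp
  · have h1 : ‖y‖ * (‖ℓ‖ + 1) ≤ min S₀ S₁ := by
      rw [← le_div_iff₀ (by positivity)]
      exact hy.trans (min_le_right _ _)
    have h2 := (le_abs_self _).trans (ℓ.le_opNorm y)
    nlinarith [norm_nonneg y]

end IsStraightening

end Trajectories

/-! ### The generic assumptions put in normal form. -/

section Setup

variable {n : ℕ} {X Y : Space n → Space n}

/-- `p 0` is nonzero by uniqueness for the adjoint equation, and its kernel is the hyperplane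
`K(0)`, so (H₂) makes its value on `ad²Y.X` nonzero; change the sign of `p` if necessary. -/
lemma exists_adjoint_pos (hX : ContDiff ℝ ∞ X) (hY : ContDiff ℝ ∞ Y) {γ : ℝ → Space n} {τ : ℝ}
    (hτ : 0 < τ) (hγ : IsReferenceCurve X γ τ) (habn : IsAbnormal X Y γ τ)
    (hgen : GenericAlong X Y γ τ) :
    ∃ p : ℝ → (Space n →L[ℝ] ℝ), 0 < p 0 (ad Y X 2 0) ∧
      (∀ t ∈ Icc 0 τ, HasDerivWithinAt p (-((p t).comp (fderiv ℝ X (γ t)))) (Icc 0 τ) t) ∧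
      (∀ t ∈ Icc 0 τ, p t (X (γ t)) = 0) ∧ ∀ t ∈ Icc 0 τ, p t (Y (γ t)) = 0 := by
  obtain ⟨p, ⟨t, ht, hpt⟩, hp, hpX, hpY⟩ := habn
  have hγc : ContinuousOn γ (Icc 0 τ) := fun t ht => (hγ.deriv t ht).continuousWithinAt
  have h0 : (0 : ℝ) ∈ Icc 0 τ := ⟨le_rfl, hτ.le⟩
  have hp0 : p 0 ≠ 0 := fun h =>
    hpt (adjoint_eq_zero (hX.of_le (by exact_mod_cast le_top)) hγc hp h t ht)
  have hne := apply_ne_zero_of_notMem_of_finrank (hgen.codim_one 0 h0) hp0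
    (adjoint_eq_zero_of_mem_cone hτ hX hY hγ.deriv hp hpY 0 h0) (hgen.ad_sq 0 h0)
  rw [hγ.init] at hne
  rcases hne.lt_or_gt with hlt | hgt
  · refine ⟨fun t => -p t, by simpa using hlt, fun t ht => ?_, fun t ht => by simp [hpX t ht],
      fun t ht => by simp [hpY t ht]⟩
    simpa using (hp t ht).fun_neg
  · exact ⟨p, hgt, hp, hpX, hpY⟩

/-- In the last clause, a covector `f` with kernel `K(t)` is proportional to the adjoint vector at
`t`, hence, through `Ψ`, to the constant covector `p`. The sign is read off on `ad²Y.X`. -/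
lemma exists_isStraightening_isNormalForm (hX : ContDiff ℝ ∞ X) (hY : ContDiff ℝ ∞ Y)
    (hrank : LinearIndependent ℝ ![X 0, Y 0]) {γ : ℝ → Space n} {τ : ℝ}
    (hτ : 0 < τ) (hγ : IsReferenceCurve X γ τ) (habn : IsAbnormal X Y γ τ)
    (hgen : GenericAlong X Y γ τ) :
    ∃ Ψ Z F r ℓ m p t₁, IsStraightening X Y Ψ Z F r ∧ IsNormalForm (X 0) Z ℓ m p r t₁ ∧
      0 < curvature (X 0) Z p ∧ t₁ ≤ τ ∧ t₁ * ‖X 0‖ < r ∧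
      (∀ t ∈ Icc 0 t₁, Ψ (t • X 0) = γ t) ∧
      ∀ t ∈ Icc 0 t₁, ∀ f : Space n →L[ℝ] ℝ, (∀ w, w ∈ cone X Y (γ t) ↔ f w = 0) →
        0 < f (ad Y X 2 (γ t)) → ∃ c > 0, ∀ w, f (fderiv ℝ Ψ (t • X 0) w) = c * p w := by
  obtain ⟨p, hpos, hp, hpX, hpY⟩ := exists_adjoint_pos hX hY hτ hγ habn hgen
  obtain ⟨ℓ, hℓX, hℓY⟩ := exists_dual_pair hrank
  obtain ⟨m, hmY, hmX⟩ := exists_dual_pair (LinearIndependent.pair_symm_iff.1 hrank)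
  obtain ⟨Ψ, Z, F, r, h, hmZ⟩ := exists_isStraightening hX hY (by simpa using hrank.ne_zero 0) hmY
  obtain ⟨t₁, ht₁, ht₁τ, ht₁r, hΨγ⟩ := h.exists_map_smul_eq hτ hγ.init hγ.deriv
  have hsub : Icc 0 t₁ ⊆ Icc 0 τ := Icc_subset_Icc_right ht₁τ
  have htr := h.adjoint_fderiv_eq (hX.differentiable (by simp)) ht₁r hΨγ
    fun t ht => (hp t (hsub ht)).mono hsub
  have h0 : (0 : ℝ) ∈ Icc 0 t₁ := ⟨le_rfl, ht₁.le⟩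
  have hF0 := h.F_zero hmY (hmZ 0)
  have hZ0 : Z 0 = Y 0 := by
    have := h.fderiv_Z 0 (by simpa using h.r_pos.le)
    rwa [hF0, one_smul, h.hasFDerivAt_zero.fderiv, h.map_zero] at this
  have hN : IsNormalForm (X 0) Z ℓ m (p 0) r t₁ := by
    refine ⟨h.contDiff_Z.of_le (by norm_num), h.r_pos, h.r_le, ht₁, hℓX, by rw [hZ0, hℓY], hmX,
      fun x _ => hmZ x, ?_, fun t ht => ?_⟩
    · have := hpX 0 (hsub h0)
      rwa [hγ.init] at this
    · have h1 := h.fderiv_Z (t • X 0) (by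
        rw [norm_smul, Real.norm_of_nonneg ht.1]
        exact (mul_le_mul_of_nonneg_right ht.2 (norm_nonneg _)).trans ht₁r.le)
      have h2 := congrArg (p t) h1
      rw [map_smul, htr _ t ht, hΨγ t ht, hpY t (hsub ht), smul_eq_mul] at h2
      exact (mul_eq_zero.1 h2).resolve_left (by linarith [h.le_F (t • X 0)])
  have hcurv : curvature (X 0) Z (p 0) = p 0 (ad Y X 2 0) := by
    rw [← apply_lieBracket_smul_eq_curvature (h.contDiff_Z.of_le (by norm_num))
      (h.contDiff_F.of_le (by norm_num)) hF0 (by simpa using hN.p_Z 0 h0)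
      (by simpa using hN.slope_eq_zero h0),
      ← h.lieBracket_lieBracket_eq (contDiff_infty.1 hX 2) (contDiff_infty.1 hY 2)]
    rfl
  -- The value is continuous in `t`, never zero by (H₂), and positive at `t = 0`.
  have hPpos : ∀ t ∈ Icc 0 t₁, 0 < p t (ad Y X 2 (γ t)) := by
    have hcont : ContinuousOn (fun t => p t (ad Y X 2 (γ t))) (Icc 0 t₁) := fun t ht =>
      ((hp t (hsub ht)).continuousWithinAt.mono hsub).clm_apply
        ((contDiff_ad hY hX 2).continuous.continuousAt.comp_continuousWithinAt
          ((hγ.deriv t (hsub ht)).continuousWithinAt.mono hsub))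
    have hne : ∀ t ∈ Icc 0 t₁, p t (ad Y X 2 (γ t)) ≠ 0 := by
      intro t ht
      refine apply_ne_zero_of_notMem_of_finrank (hgen.codim_one t (hsub ht)) (fun hpt => ?_)
        (adjoint_eq_zero_of_mem_cone hτ hX hY hγ.deriv hp hpY t (hsub ht))
        (hgen.ad_sq t (hsub ht))
      have := htr (ad Y X 2 0) t ht
      rw [hpt, _root_.zero_apply] at this
      exact hpos.ne this
    intro t ht
    by_contra! hle
    obtain ⟨s, hs, hs0⟩ := isPreconnected_Icc.intermediate_value ht h0 hcont
      ⟨hle, by simpa [hγ.init] using hpos.le⟩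
    exact hne s hs hs0
  refine ⟨Ψ, Z, F, r, ℓ, m, p 0, t₁, h, hN, hcurv ▸ hpos, ht₁τ, ht₁r, hΨγ,
    fun t ht f hf hfpos => ?_⟩
  set a := ad Y X 2 (γ t)
  refine ⟨f a / p t a, div_pos hfpos (hPpos t ht), fun w => ?_⟩
  rw [← htr w t ht]
  set z := fderiv ℝ Ψ (t • X 0) w
  have h1 : p t (z - (f z / f a) • a) = 0 := by
    refine adjoint_eq_zero_of_mem_cone hτ hX hY hγ.deriv hp hpY t (hsub ht) _ ((hf _).2 ?_)
    rw [map_sub, map_smul, smul_eq_mul]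
    field_simp
    ring
  rw [map_sub, map_smul, smul_eq_mul, sub_eq_zero] at h1
  rw [h1]
  have ha : p t a ≠ 0 := (hPpos t ht).ne'
  field_simp

end Setup

/-! ### A Taylor bound along the abnormal line. -/

section Taylor

variable {E : Type*} [NormedAddCommGroup E] [NormedSpace ℝ E]

lemma ContDiffAt.exists_abs_sub_sub_fderiv_le {g : E → ℝ} {a : E} (hg : ContDiffAt ℝ 2 g a) :
    ∃ C ≥ 0, ∃ δ > 0, ∀ x ∈ Metric.ball a δ, ∀ y ∈ Metric.ball a δ,
      |g y - g x - fderiv ℝ g x (y - x)| ≤ C * ‖y - x‖ ^ 2 := by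
  obtain ⟨K, U, hU, hK⟩ :=
    (hg.fderiv_right (m := 1) (by norm_num)).exists_lipschitzOnWith
  have hd : ∀ᶠ x in 𝓝 a, DifferentiableAt ℝ g x :=
    (hg.eventually (by simp)).mono fun x hx => hx.differentiableAt (by norm_num)
  obtain ⟨δ, hδ, hball⟩ := Metric.eventually_nhds_iff_ball.1
    ((Filter.eventually_mem_set.2 hU).and hd)
  refine ⟨K, K.2, δ, hδ, fun x hx y hy => ?_⟩
  have hseg : segment ℝ x y ⊆ Metric.ball a δ := (convex_ball a δ).segment_subset hx hy
  have := (convex_segment x y).norm_image_sub_le_of_norm_hasFDerivWithin_le' (f := g)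
    (f' := fderiv ℝ g) (φ := fderiv ℝ g x) (C := K * ‖y - x‖)
    (fun z hz => (hball z (hseg hz)).2.hasFDerivAt.hasFDerivWithinAt) (fun z hz => ?_)
    (left_mem_segment ℝ x y) (right_mem_segment ℝ x y)
  · rw [Real.norm_eq_abs] at this
    exact this.trans (by rw [sq, mul_assoc])
  · have h1 := hK.dist_le_mul _ (hball z (hseg hz)).1 _ (hball x hx).1
    rw [dist_eq_norm, dist_eq_norm] at h1
    exact h1.trans (mul_le_mul_of_nonneg_left (norm_sub_le_of_mem_segment hz) K.2)

/-- Expand `g` at the foot point `ℓ(y) e`, where `g` vanishes and its differential is `c' p`. The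
coefficient `c'` depends on the foot point but stays above half its value at `T`, and `p y ≤ 0`
turns this into an upper bound. -/
lemma exists_eventually_le_of_fderiv_eq {g : E → ℝ} {e : E} {ℓ p : E →L[ℝ] ℝ} {T : ℝ}
    (hg : ContDiffAt ℝ 2 g (T • e)) (hℓ : ℓ e = 1) (hpe : p e = 0) (hp : p ≠ 0)
    (H : ∀ᶠ t in 𝓝 T, g (t • e) = 0 ∧ ∃ c > 0, ∀ w, fderiv ℝ g (t • e) w = c * p w) :
    ∃ c > 0, ∃ C ≥ 0, ∀ᶠ y in 𝓝 (T • e), p y ≤ 0 →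
      g y ≤ c * p y + C * ‖transverse e ℓ y‖ ^ 2 := by
  obtain ⟨k, hk⟩ : ∃ k, 0 < p k := by
    obtain ⟨k, hk⟩ := DFunLike.ne_iff.1 hp
    rcases lt_or_gt_of_ne hk with h | h
    · exact ⟨-k, by simpa using h⟩
    · exact ⟨k, by simpa using h⟩
  obtain ⟨C, hC, δ, hδ, hT⟩ := ContDiffAt.exists_abs_sub_sub_fderiv_le hg
  obtain ⟨-, c, hc, hcw⟩ := H.self_of_nhds
  have hline : ContinuousAt (fun t : ℝ => t • e) T := by fun_prop
  have hder : ContinuousAt (fun t : ℝ => fderiv ℝ g (t • e) k) T := by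
    have h1 : ContinuousAt (fderiv ℝ g) (T • e) :=
      (hg.fderiv_right (m := 0) (by norm_num)).continuousAt
    exact (h1.comp_of_eq hline rfl).clm_apply continuousAt_const
  have hlt : ∀ᶠ t in 𝓝 T, c / 2 * p k < fderiv ℝ g (t • e) k := by
    refine hder.eventually_const_lt ?_
    beta_reduce
    rw [hcw k]
    nlinarith [mul_pos hc hk]
  have hℓc : Filter.Tendsto ℓ (𝓝 (T • e)) (𝓝 T) := by
    have := ℓ.continuous.tendsto (T • e)
    rwa [map_smul, hℓ, smul_eq_mul, mul_one] at this
  refine ⟨c / 2, by positivity, C, hC, ?_⟩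
  have hb := Metric.ball_mem_nhds (T • e) hδ
  filter_upwards [hℓc.eventually H, hℓc.eventually hlt,
    hℓc.eventually (hline.eventually_mem hb), hb] with y h1 h2 h3 h4 hpy
  obtain ⟨h5, c', -, hc'⟩ := h1
  have h6 := (abs_le.1 (hT _ h3 y h4)).2
  rw [h5, hc', map_sub, map_smul, hpe, smul_zero, sub_zero, sub_zero] at h6
  rw [hc'] at h2
  have h7 := lt_of_mul_lt_mul_right h2 hk.le
  rw [transverse_apply]
  nlinarith

end Taylor

/-! ### Points of the sphere with `p < 0`. -/

section Sphere

variable {n : ℕ} {X Y : Space n → Space n} {Ψ : OpenPartialHomeomorph (Space n) (Space n)}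
  {Z : Space n → Space n} {F : Space n → ℝ} {r : ℝ}

lemma srDist_zero : srDist X Y 0 = 0 := by
  have := srDist_le_of_reachable le_rfl (zero_mem_reachable (X := X) (Y := Y))
  rwa [ENNReal.ofReal_zero, nonpos_iff_eq_zero] at this

namespace IsStraightening

/-- The control of `Y` is `b / F` with `F ≥ 1/2`, whence the factor `4`. -/
lemma srDist_le_add (h : IsStraightening X Y Ψ Z F r) (hX : Continuous X) (hY : Continuous Y)
    {δ : ℝ} (hδ : 0 ≤ δ) {a b : ℝ → ℝ} {x : ℝ → Space n} (ha : ContinuousOn a (Icc 0 δ))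
    (hb : ContinuousOn b (Icc 0 δ)) (hab : ∀ s ∈ Icc 0 δ, a s ^ 2 + 4 * b s ^ 2 ≤ 1)
    (hx : ∀ s ∈ Icc 0 δ, HasDerivAt x (a s • X 0 + b s • Z (x s)) s)
    (hr : ∀ s ∈ Icc 0 δ, ‖x s‖ ≤ r) :
    srDist X Y (Ψ (x δ)) ≤ srDist X Y (Ψ (x 0)) + ENNReal.ofReal δ := by
  have hF : ∀ y, F y ≠ 0 := fun y => by linarith [h.le_F y]
  have hxc : ContinuousOn x (Icc 0 δ) := fun s hs => (hx s hs).continuousAt.continuousWithinAt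
  refine SubRiemannian.srDist_le_add (c := fun s => Ψ (x s)) (v := a)
    (u := fun s => b s / F (x s)) hX hY hδ ha
    (hb.div (h.contDiff_F.continuous.comp_continuousOn hxc) fun s _ => hF _)
    (fun s hs => ?_) fun s hs => ?_
  · have h1 : (b s / F (x s)) ^ 2 ≤ 4 * b s ^ 2 := by
      rw [div_pow, div_le_iff₀ (by have := h.le_F (x s); positivity)]
      have h2 : 1 ≤ 4 * F (x s) ^ 2 := by nlinarith [h.le_F (x s)]
      nlinarith [sq_nonneg (b s)]
    linarith [hab s hs]
  · have h1 := (h.hasFDerivAt (hr s hs)).comp_hasDerivAt s (hx s hs)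
    rw [map_add, map_smul, map_smul, h.fderiv_X _ (hr s hs)] at h1
    rw [← h.fderiv_Z _ (hr s hs), smul_smul, div_mul_cancel₀ _ (hF _)]
    exact h1

lemma srDist_add_smul_le (h : IsStraightening X Y Ψ Z F r) (hX : Continuous X) (hY : Continuous Y)
    {y : Space n} {a b : ℝ} (hr : ∀ s ∈ uIcc a b, ‖y + s • X 0‖ ≤ r) :
    srDist X Y (Ψ (y + b • X 0)) ≤ srDist X Y (Ψ (y + a • X 0)) + ENNReal.ofReal |b - a| := by
  obtain ⟨σ, hσ, hσ'⟩ : ∃ σ : ℝ, σ ^ 2 = 1 ∧ σ * |b - a| = b - a := by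
    rcases le_total 0 (b - a) with hab | hab
    · exact ⟨1, by norm_num, by rw [abs_of_nonneg hab, one_mul]⟩
    · exact ⟨-1, by norm_num, by rw [abs_of_nonpos hab]; ring⟩
  have := h.srDist_le_add hX hY (abs_nonneg (b - a)) (a := fun _ => σ) (b := fun _ => 0)
    (x := fun s => y + (a + σ * s) • X 0) continuousOn_const continuousOn_const
    (fun s _ => by simp [hσ]) (fun s _ => ?_) fun s hs => hr _ ?_
  · simpa [hσ'] using this
  · have h1 : HasDerivAt (fun s : ℝ => a + σ * s) σ s := by
      simpa using ((hasDerivAt_id s).const_mul σ).const_add a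
    simpa using (h1.smul_const (X 0)).const_add y
  · have h1 : a + σ * s = a + (s / |b - a|) * (b - a) ∨ a = b := by
      rcases eq_or_ne a b with hab | hab
      · exact Or.inr hab
      · left
        have h2 : |b - a| ≠ 0 := abs_ne_zero.2 (sub_ne_zero.2 hab.symm)
        generalize |b - a| = d at h2 hσ'
        rw [← hσ']
        field_simp
    rcases h1 with h1 | h1
    · rw [h1, ← segment_eq_uIcc, segment_eq_image']
      exact ⟨s / |b - a|, ⟨div_nonneg hs.1 (abs_nonneg _), div_le_one_of_le₀ hs.2 (abs_nonneg _)⟩,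
        rfl⟩
    · subst h1
      simp only [sub_self, abs_zero, Icc_self, mem_singleton_iff] at hs
      simp [hs]

lemma srDist_smul_le (h : IsStraightening X Y Ψ Z F r) (hX : Continuous X) (hY : Continuous Y)
    {t : ℝ} (ht : 0 ≤ t) (hr : t * ‖X 0‖ ≤ r) :
    srDist X Y (Ψ (t • X 0)) ≤ ENNReal.ofReal t := by
  have := h.srDist_add_smul_le hX hY (y := 0) (a := 0) (b := t) fun s hs => ?_
  · simpa [h.map_zero, srDist_zero, abs_of_nonneg ht] using this
  · rw [uIcc_of_le ht] at hs
    rw [zero_add, norm_smul, Real.norm_of_nonneg hs.1]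
    exact (mul_le_mul_of_nonneg_right hs.2 (norm_nonneg _)).trans hr

/-- Intermediate value theorem: along the segment the distance is finite and `1`-Lipschitz in the
parameter, as one may move along `X` in both directions at unit speed. -/
lemma exists_srDist_eq (h : IsStraightening X Y Ψ Z F r) (hX : Continuous X) (hY : Continuous Y)
    {y : Space n} {a b T : ℝ} (hab : a ≤ b) (hr : ∀ s ∈ Icc a b, ‖y + s • X 0‖ ≤ r)
    (ha : srDist X Y (Ψ (y + a • X 0)) ≤ ENNReal.ofReal T)
    (hb : ENNReal.ofReal T ≤ srDist X Y (Ψ (y + b • X 0))) :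
    ∃ s ∈ Icc a b, srDist X Y (Ψ (y + s • X 0)) = ENNReal.ofReal T := by
  set D : ℝ → ℝ≥0∞ := fun s => srDist X Y (Ψ (y + s • X 0)) with hD
  have hstep : ∀ s ∈ Icc a b, ∀ t ∈ Icc a b, D t ≤ D s + ENNReal.ofReal |t - s| :=
    fun s hs t ht => h.srDist_add_smul_le hX hY fun u hu =>
      hr u (ordConnected_Icc.uIcc_subset hs ht hu)
  have haI : a ∈ Icc a b := ⟨le_rfl, hab⟩
  have hbI : b ∈ Icc a b := ⟨hab, le_rfl⟩
  have hfin : ∀ s ∈ Icc a b, D s ≠ ⊤ := fun s hs =>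
    ((hstep a haI s hs).trans_lt (ENNReal.add_lt_top.2
      ⟨ha.trans_lt ENNReal.ofReal_lt_top, ENNReal.ofReal_lt_top⟩)).ne
  have hcont : ContinuousOn (fun s => (D s).toReal) (Icc a b) := by
    refine (LipschitzOnWith.of_le_add_mul 1 fun s hs t ht => ?_).continuousOn
    rw [NNReal.coe_one, one_mul, Real.dist_eq, ← ENNReal.toReal_ofReal (abs_nonneg (s - t)),
      ← ENNReal.toReal_add (hfin t ht) ENNReal.ofReal_ne_top]
    exact ENNReal.toReal_mono (ENNReal.add_ne_top.2 ⟨hfin t ht, ENNReal.ofReal_ne_top⟩)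
      (hstep t ht s hs)
  obtain ⟨s, hs, hsT⟩ := isPreconnected_Icc.intermediate_value haI hbI hcont
    (show (ENNReal.ofReal T).toReal ∈ _ from
      ⟨ENNReal.toReal_mono ENNReal.ofReal_ne_top ha, ENNReal.toReal_mono (hfin b hbI) hb⟩)
  exact ⟨s, hs, (ENNReal.toReal_eq_toReal_iff' (hfin s hs) ENNReal.ofReal_ne_top).1 hsT⟩

theorem exists_sphere_point (h : IsStraightening X Y Ψ Z F r) (hX : Continuous X)
    (hY : Continuous Y) {ℓ m p : Space n →L[ℝ] ℝ} {t₁ : ℝ} (hN : IsNormalForm (X 0) Z ℓ m p r t₁)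
    (hκ : 0 < curvature (X 0) Z p) :
    ∃ ρ > 0, ρ ≤ r ∧ ∀ T > 0, T * ‖X 0‖ < ρ →
      srDist X Y (Ψ (T • X 0)) = ENNReal.ofReal T ∧
      ∃ B > 0, ∃ ε > 0, ∀ θ, 0 < θ → θ < ε → ∃ y, ‖y - T • X 0‖ ≤ B * θ ∧
        srDist X Y (Ψ y) = ENNReal.ofReal T ∧ p y < 0 ∧
        ‖transverse (X 0) ℓ y‖ ^ 2 ≤ B * θ * |p y| := by
  obtain ⟨ρ₁, hρ₁, hρ₁r, Hlow⟩ := h.exists_le_srDist hX hY hN hκ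
  obtain ⟨ρ₂, hρ₂, Hloop⟩ := hN.exists_backward_loop hκ
  refine ⟨min (ρ₁ / 2) ρ₂, by positivity, ((min_le_left _ _).trans (by linarith)).trans hρ₁r,
    fun T hT hTρ => ?_⟩
  set e := X 0 with he
  have hT1 : 2 * (T * ‖e‖) < ρ₁ := by linarith [hTρ.trans_le (min_le_left _ _)]
  have hT2 : T / 2 * ‖e‖ < ρ₂ := by
    have := hTρ.trans_le (min_le_right _ _)
    nlinarith [norm_nonneg e]
  have hTe : 0 ≤ T * ‖e‖ := by positivity
  refine ⟨le_antisymm (h.srDist_smul_le hX hY hT.le (by linarith)) ?_, ?_⟩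
  · have := Hlow (T • e) (by rw [norm_smul, Real.norm_of_nonneg hT.le]; linarith)
      (by simp [hN.m_e]) (by simp [hN.p_e])
    rwa [map_smul, hN.ℓ_e, smul_eq_mul, mul_one] at this
  -- The loop is based at `T/2`, so that room remains to travel forward to distance `T`.
  obtain ⟨B, hB, ε, hε, H⟩ := Hloop (T / 2) (by positivity) hT2
  set B' := B + (1 + ‖ℓ‖ * B) * ‖e‖ with hB'
  have hBB' : B ≤ B' := le_add_of_nonneg_right (by positivity)
  set M := ‖ℓ‖ * B with hM
  have hMnn : 0 ≤ M := by positivity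
  obtain ⟨ε', hε', hε'1⟩ : ∃ ε' > 0, ∀ θ, 0 < θ → θ < ε' →
      θ < ε ∧ θ < 1 / 4 ∧ θ < T / 2 ∧ M * θ < T / 2 ∧ B * θ < (ρ₁ - 2 * (T * ‖e‖)) := by
    have h1 : 0 < ρ₁ - 2 * (T * ‖e‖) := by linarith
    have hmul : ∀ {a b : ℝ}, 0 < b → ∀ᶠ θ in 𝓝 (0 : ℝ), a * θ < b := fun {a b} hb =>
      have hc : ContinuousAt (fun θ : ℝ => a * θ) 0 := by fun_prop
      hc.eventually_lt_const (by simpa using hb)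
    obtain ⟨ε', hε', hball⟩ := Metric.eventually_nhds_iff_ball.1 ((eventually_lt_nhds hε).and
      ((eventually_lt_nhds (by norm_num : (0 : ℝ) < 1 / 4)).and
        ((eventually_lt_nhds (by positivity : (0 : ℝ) < T / 2)).and
          ((hmul (a := M) (by positivity : (0 : ℝ) < T / 2)).and (hmul (a := B) h1)))))
    exact ⟨ε', hε', fun θ hθ hθε => hball θ (by
      rwa [Metric.mem_ball, Real.dist_0_eq_abs, abs_of_pos hθ])⟩
  refine ⟨B', hB.trans_le hBB', ε', hε', fun θ hθ hθε => ?_⟩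
  obtain ⟨hθ1, hθ2, hθ3, hθ4, hθ5⟩ := hε'1 θ hθ hθε
  obtain ⟨x, hx0, hx, hxB, hm, hp, htr⟩ := H θ hθ hθ1
  set y := x θ with hy
  have hyB : ‖y - (T / 2) • e‖ ≤ B * θ := hxB θ ⟨hθ.le, le_rfl⟩
  have hTnorm : ∀ s : ℝ, 0 ≤ s → s ≤ T → ‖s • e‖ ≤ T * ‖e‖ := fun s hs hsT => by
    rw [norm_smul, Real.norm_of_nonneg hs]
    exact mul_le_mul_of_nonneg_right hsT (norm_nonneg _)
  have hhalf := hTnorm (T / 2) (by positivity) (by linarith)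
  have hnorm : ∀ s ∈ Icc 0 T, ‖y + s • e‖ ≤ ρ₁ := by
    intro s hs
    have h1 : y + s • e = (y - (T / 2) • e) + (T / 2) • e + s • e := by abel
    rw [h1]
    refine (norm_add₃_le).trans ?_
    linarith [hTnorm s hs.1 hs.2]
  have hℓy : |ℓ y - T / 2| ≤ M * θ := by
    have h1 := ℓ.le_opNorm (y - (T / 2) • e)
    rw [map_sub, map_smul, hN.ℓ_e, smul_eq_mul, mul_one, Real.norm_eq_abs] at h1
    refine h1.trans ?_
    rw [hM, mul_assoc]
    exact mul_le_mul_of_nonneg_left hyB (norm_nonneg _)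
  obtain ⟨hℓ1, hℓ2⟩ := abs_le.1 hℓy
  have hstart : srDist X Y (Ψ y) ≤ ENNReal.ofReal (T / 2 + θ) := by
    have h1 := h.srDist_le_add hX hY hθ.le (a := fun _ => -1 / 2) (b := fun s => θ - 2 * s) (x := x)
      continuousOn_const (by fun_prop) (fun s hs => ?_) hx fun s hs => ?_
    · rw [hx0] at h1
      rw [ENNReal.ofReal_add (by positivity) hθ.le]
      refine h1.trans ?_
      gcongr
      exact h.srDist_smul_le hX hY (by positivity) (by nlinarith)
    · have : |θ - 2 * s| ≤ 1 / 4 := abs_le.2 ⟨by linarith [hs.2], by linarith [hs.1]⟩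
      nlinarith [sq_abs (θ - 2 * s), abs_nonneg (θ - 2 * s)]
    · have h1 : x s = (x s - (T / 2) • e) + (T / 2) • e := by abel
      rw [h1]
      refine (norm_add_le _ _).trans ?_
      nlinarith [hxB s hs, hs.2]
  have hsub : Icc 0 (T - ℓ y) ⊆ Icc 0 T := Icc_subset_Icc_right (by linarith)
  have hmp : ∀ s : ℝ, m (y + s • e) = 0 ∧ p (y + s • e) = p y ∧
      transverse e ℓ (y + s • e) = transverse e ℓ y := fun s => by
    refine ⟨by simp [hm, hN.m_e], by simp [hN.p_e], ?_⟩
    have : transverse e ℓ e = 0 := by rw [transverse_apply, hN.ℓ_e, one_smul, sub_self]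
    rw [map_add, map_smul, this, smul_zero, add_zero]
  have hT0 : 0 ≤ T - ℓ y := by linarith
  -- At `s = 0` the distance is at most `T/2 + θ ≤ T`; at `s = T - ℓ y` the lower bound applies with
  -- `ℓ = T`.
  obtain ⟨s, hs, hsT⟩ := h.exists_srDist_eq hX hY (y := y) (T := T) hT0
    (fun s hs => (hnorm s (hsub hs)).trans hρ₁r)
    (by
      rw [zero_smul, add_zero]
      exact hstart.trans (ENNReal.ofReal_le_ofReal (by linarith)))
    (by
      have h1 := Hlow (y + (T - ℓ y) • e) (hnorm _ (hsub ⟨hT0, le_rfl⟩)) (hmp _).1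
        ((hmp _).2.1.trans_le hp.le)
      rwa [map_add, map_smul, hN.ℓ_e, smul_eq_mul, mul_one, add_sub_cancel] at h1)
  -- Distance `T` cannot be reached earlier, by the Lipschitz bound. With `s ≤ T - ℓ y` this places
  -- `s` within `O(θ)` of `T/2`.
  have hs2 : T / 2 - θ ≤ s := by
    have h1 := h.srDist_add_smul_le hX hY (y := y) (a := 0) (b := s) fun u hu => by
      rw [uIcc_of_le hs.1] at hu
      exact (hnorm u (hsub ⟨hu.1, hu.2.trans hs.2⟩)).trans hρ₁r
    rw [hsT, zero_smul, add_zero, sub_zero, abs_of_nonneg hs.1] at h1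
    have h2 := h1.trans (add_le_add_left hstart _)
    rw [← ENNReal.ofReal_add (by positivity) hs.1,
      ENNReal.ofReal_le_ofReal_iff (by linarith [hs.1])] at h2
    linarith
  refine ⟨y + s • e, ?_, hsT, by rwa [(hmp s).2.1], ?_⟩
  · have h1 : y + s • e - T • e = (y - (T / 2) • e) + (s - T / 2) • e := by
      rw [sub_smul]
      have : T • e = (T / 2) • e + (T / 2) • e := by rw [← add_smul, add_halves]
      rw [this]
      abel
    have h2 : |s - T / 2| ≤ (1 + M) * θ := by
      have := mul_nonneg hMnn hθ.le
      exact abs_le.2 ⟨by linarith, by linarith [hs.2]⟩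
    rw [h1]
    refine (norm_add_le _ _).trans ?_
    rw [norm_smul, Real.norm_eq_abs, hB']
    have := mul_le_mul_of_nonneg_right h2 (norm_nonneg e)
    linarith
  · rw [(hmp s).2.1, (hmp s).2.2]
    refine htr.trans ?_
    gcongr

end IsStraightening

end Sphere
end SubRiemannian

/-! ### Conclusion in adapted coordinates. -/

theorem lemma2p7 {n : ℕ} (hn : 3 ≤ n)
    (X Y : SubRiemannian.Space n → SubRiemannian.Space n)
    (hX : ContDiff ℝ ∞ X) (hY : ContDiff ℝ ∞ Y)
    (hrank : ∀ q, LinearIndependent ℝ ![X q, Y q])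
    (γ : ℝ → SubRiemannian.Space n) (τ : ℝ) (hτ : 0 < τ)
    (hγ : SubRiemannian.IsReferenceCurve X γ τ)
    (habn : SubRiemannian.IsAbnormal X Y γ τ)
    (hgen : SubRiemannian.GenericAlong X Y γ τ) :
    ∃ T₀ : ℝ, 0 < T₀ ∧ T₀ ≤ τ ∧ ∀ T : ℝ, 0 < T → T < T₀ →
      γ T ∈ SubRiemannian.srSphere X Y T ∧
      ∀ φ : OpenPartialHomeomorph (SubRiemannian.Space n) (SubRiemannian.Space n),
        SubRiemannian.IsAdapted hn X Y γ τ φ →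
        ∀ V ∈ 𝓝 (γ T),
          (SubRiemannian.srSphere X Y T ∩ V ∩
            {x | x ∈ φ.source ∧ (φ x) (⟨n - 1, by omega⟩ : Fin n) < 0}).Nonempty := by
  obtain ⟨Ψ, Z, F, r, ℓ, m, p, t₁, h, hN, hκ, ht₁τ, ht₁r, hΨγ, hcone⟩ :=
    SubRiemannian.exists_isStraightening_isNormalForm hX hY (hrank 0) hτ hγ habn hgen
  obtain ⟨ρ, hρ, hρr, H⟩ := h.exists_sphere_point hX.continuous hY.continuous hN hκ
  have ht₁ := hN.t_pos
  refine ⟨min t₁ (ρ / (‖X 0‖ + 1)), by positivity, (min_le_left _ _).trans ht₁τ,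
    fun T hT hTT₀ => ?_⟩
  have hTt₁ : T < t₁ := hTT₀.trans_le (min_le_left _ _)
  have hTI : T ∈ Icc 0 t₁ := ⟨hT.le, hTt₁.le⟩
  have hTρ : T * ‖X 0‖ < ρ := by
    have := hTT₀.trans_le (min_le_right _ _)
    rw [lt_div_iff₀ (by positivity)] at this
    linarith
  obtain ⟨hsph, B, hB, ε, hε, Hθ⟩ := H T hT hTρ
  rw [hΨγ T hTI] at hsph
  refine ⟨hsph, fun φ hφ V hV => ?_⟩
  have hTr : ‖T • X 0‖ ≤ r := by
    rw [norm_smul, Real.norm_of_nonneg hT.le]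
    linarith
  let last : Fin n := ⟨n - 1, by omega⟩
  let π : SubRiemannian.Space n →L[ℝ] ℝ := EuclideanSpace.proj last
  let g : SubRiemannian.Space n → ℝ := fun y => π (φ (Ψ y))
  have hsrc : ∀ t ∈ Icc 0 t₁, γ t ∈ φ.source := fun t ht =>
    hφ.mem_source t ⟨ht.1, ht.2.trans ht₁τ⟩
  have hφc : ∀ t ∈ Icc 0 t₁, ContDiffAt ℝ 2 φ (γ t) := fun t ht =>
    (contDiffOn_infty.1 hφ.smooth 2).contDiffAt (φ.open_source.mem_nhds (hsrc t ht))
  have hg : ContDiffAt ℝ 2 g (T • X 0) := by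
    refine π.contDiff.contDiffAt.comp _ (ContDiffAt.comp (T • X 0) ?_
      ((h.contDiffAt hTr).of_le (by norm_num)))
    rw [hΨγ T hTI]
    exact hφc T hTI
  have hp : p ≠ 0 := by
    obtain ⟨y, -, -, hy, -⟩ := Hθ (ε / 2) (by positivity) (by linarith)
    rintro rfl
    exact hy.ne rfl
  obtain ⟨c, hc, C, hC, hev⟩ :=
    SubRiemannian.exists_eventually_le_of_fderiv_eq hg hN.ℓ_e hN.p_e hp (by
      filter_upwards [Icc_mem_nhds hT hTt₁] with t ht
      have htτ : t ∈ Icc 0 τ := ⟨ht.1, ht.2.trans ht₁τ⟩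
      have htr : ‖t • X 0‖ ≤ r := by
        rw [norm_smul, Real.norm_of_nonneg ht.1]
        exact (mul_le_mul_of_nonneg_right ht.2 (norm_nonneg _)).trans ht₁r.le
      refine ⟨?_, ?_⟩
      · have h0 : last ≠ ⟨0, by omega⟩ := by
          simp only [last, ne_eq, Fin.mk.injEq]
          omega
        have h1 : φ (Ψ (t • X 0)) last = 0 := by
          rw [hΨγ t ht, hφ.straight t htτ]
          simp [h0]
        exact h1
      · obtain ⟨c, hc, hcw⟩ := hcone t ht (π ∘L fderiv ℝ φ (γ t)) (hφ.cone_eq t htτ)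
          (hφ.orient t htτ)
        refine ⟨c, hc, fun w => ?_⟩
        rw [← hcw w]
        have h1 : HasFDerivAt φ (fderiv ℝ φ (γ t)) (Ψ (t • X 0)) := by
          rw [hΨγ t ht]
          exact ((hφc t ht).differentiableAt (by norm_num)).hasFDerivAt
        have h2 : HasFDerivAt g (π ∘L (fderiv ℝ φ (γ t) ∘L fderiv ℝ Ψ (t • X 0))) (t • X 0) :=
          π.hasFDerivAt.comp _ (h1.comp _ (h.hasFDerivAt htr))
        rw [h2.fderiv]
        rfl)
  have hΨc : Filter.Tendsto Ψ (𝓝 (T • X 0)) (𝓝 (γ T)) := by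
    have := (h.contDiffAt hTr).continuousAt
    rwa [ContinuousAt, hΨγ T hTI] at this
  obtain ⟨δ, hδ, hball⟩ := Metric.eventually_nhds_iff_ball.1 (hev.and ((hΨc.eventually_mem hV).and
    (hΨc.eventually_mem (φ.open_source.mem_nhds (hsrc T hTI)))))
  -- `B * θ < δ` puts the point in `V` and in the Taylor neighborhood; `C * (B * θ) < c` makes the
  -- quadratic term smaller than `c |p y|`.
  obtain ⟨θ, hθ, hθε, hθδ, hθc⟩ : ∃ θ > 0, θ < ε ∧ B * θ < δ ∧ C * (B * θ) < c := by
    refine ⟨min (ε / 2) (min (δ / (2 * B)) (c / (2 * (C + 1) * B))), by positivity, ?_, ?_, ?_⟩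
    · exact (min_le_left _ _).trans_lt (by linarith)
    · have h1 : B * (δ / (2 * B)) = δ / 2 := by field_simp
      have h2 := mul_le_mul_of_nonneg_left ((min_le_right (ε / 2) _).trans
        (min_le_left (δ / (2 * B)) (c / (2 * (C + 1) * B)))) hB.le
      linarith
    · have h1 : (C + 1) * (B * (c / (2 * (C + 1) * B))) = c / 2 := by field_simp
      set θ := min (ε / 2) (min (δ / (2 * B)) (c / (2 * (C + 1) * B)))
      have hθ0 : 0 < θ := by positivity
      have h2 : B * θ ≤ B * (c / (2 * (C + 1) * B)) :=
        mul_le_mul_of_nonneg_left ((min_le_right _ _).trans (min_le_right _ _)) hB.le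
      nlinarith [mul_pos hB hθ0]
  obtain ⟨y, hyT, hyS, hpy, htr⟩ := Hθ θ hθ hθε
  obtain ⟨h1, h2, h3⟩ := hball y (by
    rw [Metric.mem_ball, dist_eq_norm]
    linarith)
  refine ⟨Ψ y, ⟨hyS, h2⟩, h3, ?_⟩
  have h4 := h1 hpy.le
  rw [abs_of_neg hpy] at htr
  have h5 : g y < 0 := by nlinarith [mul_le_mul_of_nonneg_left htr hC]
  exact h5
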